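/- Let $k$ be an algebraically closed field of characteristic $p\ge 0$. Let $X_1,X_2$ be varieties over $k$ and let $f_i:\mathbb{P}^1\to X_i$ ($i=1,2$) be immersions, i.e. unramified $k$-morphisms. Write $T^*$ for the cotangent sheaf (the sheaf of Kähler differentials over $k$) and $F(d)=F\otimes\mathcal{O}_{\mathbb{P}^1}(d)$. For a $k$-morphism $g:\mathbb{P}^1\to X$ and an integer $d$, let $$V_d(g)\subseteq H^0(\mathbb{P}^1,T^*\mathbb{P}^1(d))\cong H^0(\mathbb{P}^1,\mathcal{O}(d-2))$$ be the image of $H^0(\mathbb{P}^1,g^*T^*X(d))$ under the map induced by the codifferential $g^*T^*X\to T^*\mathbb{P}^1$. Set $$d_0=\min\{d\ge 2 : V_d(f_1)=H^0(\mathbb{P}^1,T^*\mathbb{P}^1(d))\ \text{ or }\ V_d(f_2)=H^0(\mathbb{P}^1,T^*\mathbb{P}^1(d))\},$$ and assume that $p=0$ or $p\ge d_0-1$. Then there is a nonempty Zariski open subset of $\mathrm{Aut}(\mathbb{P}^1)=\mathrm{PGL}_2(k)$ such that for every $\alpha$ in it the following holds. Let $f=(f_1,f_2\circ\alpha):\mathbb{P}^1\to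 X_1\times X_2$, and for $i=1,2$ let $V_{i,d}=V_d(\mathrm{pr}_i\circ f)$ be the subspace attached to the $i$-th component of $f$, so that $V_{1,d}=V_d(f_1)$ and $V_{2,d}=V_d(f_2\circ\alpha)$. Then for every integer $d$ the subspaces $V_{1,d}$ and $V_{2,d}$ are transverse, i.e. $V_{1,d}\cap V_{2,d}=0$ or $V_{1,d}+V_{2,d}=H^0(\mathbb{P}^1,T^*\mathbb{P}^1(d))$. -/

import Mathlib

open CategoryTheory AlgebraicGeometry TensorProduct CartesianMonoidalCategory MonoidalCategory

universe u

noncomputable section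

namespace RationalCurves

section Rings

variable {k : Type u} [CommRing k] {A B A' B' : Type u} [CommRing A] [CommRing B] [CommRing A']
  [CommRing B'] [Algebra k A] [Algebra k B] [Algebra k A'] [Algebra k B']

/-- For a homomorphism `φ : A → B` of `k`-algebras, the `B`-module `B ⊗_A Ω_{A/k}`. -/
def PulledForms (φ : A →ₐ[k] B) : Type u :=
  letI := φ.toRingHom.toAlgebra
  B ⊗[A] Ω[A⁄k]

namespace PulledForms

instance (φ : A →ₐ[k] B) : AddCommGroup (PulledForms φ) :=
  letI := φ.toRingHom.toAlgebra
  (TensorProduct.addCommGroup : AddCommGroup (B ⊗[A] Ω[A⁄k]))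

instance (φ : A →ₐ[k] B) : Module B (PulledForms φ) :=
  letI := φ.toRingHom.toAlgebra
  (TensorProduct.leftModule : Module B (B ⊗[A] Ω[A⁄k]))

instance (φ : A →ₐ[k] B) : Module k (PulledForms φ) :=
  Module.compHom _ (algebraMap k B)

instance (φ : A →ₐ[k] B) : IsScalarTower k B (PulledForms φ) :=
  ⟨fun c b m => by
    rw [Algebra.smul_def, mul_smul]
    rfl⟩

instance (φ : A →ₐ[k] B) : SMulCommClass k B (PulledForms φ) :=
  ⟨fun c b m => smul_comm (algebraMap k B c) b m⟩

/-- The pure tensor `b ⊗ ω`. -/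
def tmul (φ : A →ₐ[k] B) (b : B) (ω : Ω[A⁄k]) : PulledForms φ :=
  letI := φ.toRingHom.toAlgebra
  b ⊗ₜ[A] ω

/-- The codifferential `B ⊗_A Ω_{A/k} → Ω_{B/k}`, `b ⊗ da ↦ b d(φ a)`. -/
def codiff (φ : A →ₐ[k] B) : PulledForms φ →ₗ[B] Ω[B⁄k] :=
  letI := φ.toRingHom.toAlgebra
  haveI : IsScalarTower k A B := IsScalarTower.of_algebraMap_eq' φ.comp_algebraMap.symm
  KaehlerDifferential.mapBaseChange k A B

/-- The restriction map `B ⊗_A Ω_{A/k} → B' ⊗_{A'} Ω_{A'/k}`, `b ⊗ da ↦ β b ⊗ d(α a)`, attached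
to a commutative square of `k`-algebras. -/
def restrict (φ : A →ₐ[k] B) (ψ : A' →ₐ[k] B') (α : A →ₐ[k] A') (β : B →ₐ[k] B')
    (comm : β.comp φ = ψ.comp α) : PulledForms φ →ₛₗ[β.toRingHom] PulledForms ψ :=
  letI := φ.toRingHom.toAlgebra
  letI := ψ.toRingHom.toAlgebra
  letI := α.toRingHom.toAlgebra
  letI := β.toRingHom.toAlgebra
  letI := (ψ.comp α).toRingHom.toAlgebra
  haveI : IsScalarTower A A' B' := IsScalarTower.of_algebraMap_eq' rfl
  haveI : IsScalarTower A B B' :=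
    IsScalarTower.of_algebraMap_eq' (congrArg (fun f : A →ₐ[k] B' => f.toRingHom) comm).symm
  haveI : IsScalarTower k A A' := IsScalarTower.of_algebraMap_eq' α.comp_algebraMap.symm
  let l : B ⊗[A] Ω[A⁄k] →ₗ[B] B' ⊗[A'] Ω[A'⁄k] :=
    LinearMap.liftBaseChange B
      (((TensorProduct.mk A' B' Ω[A'⁄k] 1).restrictScalars A).comp
        (KaehlerDifferential.map k k A A'))
  { toFun := l
    map_add' := l.map_add
    map_smul' := fun b m => (l.map_smul b m).trans (algebraMap_smul B' b (l m)).symm }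

lemma codiff_tmul (φ : A →ₐ[k] B) (b : B) (a : A) :
    codiff φ (tmul φ b (KaehlerDifferential.D k A a)) = b • KaehlerDifferential.D k B (φ a) := by
  let := φ.toRingHom.toAlgebra
  have : IsScalarTower k A B := IsScalarTower.of_algebraMap_eq' φ.comp_algebraMap.symm
  exact (KaehlerDifferential.mapBaseChange_tmul k A B b _).trans
    (congrArg (b • ·) (KaehlerDifferential.map_D k k A B a))

lemma restrict_tmul (φ : A →ₐ[k] B) (ψ : A' →ₐ[k] B') (α : A →ₐ[k] A') (β : B →ₐ[k] B')
    (comm : β.comp φ = ψ.comp α) (b : B) (a : A) :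
    restrict φ ψ α β comm (tmul φ b (KaehlerDifferential.D k A a)) =
      tmul ψ (β b) (KaehlerDifferential.D k A' (α a)) := by
  let := φ.toRingHom.toAlgebra
  let := ψ.toRingHom.toAlgebra
  let := α.toRingHom.toAlgebra
  let := β.toRingHom.toAlgebra
  let := (ψ.comp α).toRingHom.toAlgebra
  have : IsScalarTower A A' B' := IsScalarTower.of_algebraMap_eq' rfl
  have : IsScalarTower A B B' :=
    IsScalarTower.of_algebraMap_eq' (congrArg (fun f : A →ₐ[k] B' => f.toRingHom) comm).symm
  have : IsScalarTower k A A' := IsScalarTower.of_algebraMap_eq' α.comp_algebraMap.symm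
  have h1 : @Eq (B' ⊗[A'] Ω[A'⁄k])
      (restrict φ ψ α β comm (tmul φ b (KaehlerDifferential.D k A a)))
      (b • ((1 : B') ⊗ₜ[A'] KaehlerDifferential.map k k A A' (KaehlerDifferential.D k A a))) :=
    LinearMap.liftBaseChange_tmul B _ _ _
  refine h1.trans ?_
  rw [KaehlerDifferential.map_D, TensorProduct.smul_tmul', Algebra.smul_def, mul_one]
  rfl

end PulledForms

/-- The restriction map `Ω_{B/k} → Ω_{B'/k}`, `b dc ↦ β b d(β c)`, along a homomorphism
`β : B → B'` of `k`-algebras. -/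
def restrictForms (β : B →ₐ[k] B') : Ω[B⁄k] →ₛₗ[β.toRingHom] Ω[B'⁄k] :=
  letI := β.toRingHom.toAlgebra
  haveI : IsScalarTower k B B' := IsScalarTower.of_algebraMap_eq' β.comp_algebraMap.symm
  let l : Ω[B⁄k] →ₗ[B] Ω[B'⁄k] := KaehlerDifferential.map k k B B'
  { toFun := l
    map_add' := l.map_add
    map_smul' := fun b m => (l.map_smul b m).trans (algebraMap_smul B' b (l m)).symm }

lemma restrictForms_D (β : B →ₐ[k] B') (b : B) :
    restrictForms β (KaehlerDifferential.D k B b) = KaehlerDifferential.D k B' (β b) := by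
  let := β.toRingHom.toAlgebra
  have : IsScalarTower k B B' := IsScalarTower.of_algebraMap_eq' β.comp_algebraMap.symm
  exact KaehlerDifferential.map_D k k B B' b

end Rings

section Schemes

variable {k : Type u} [Field k]

lemma le_preimage_top (X : Over (Spec (.of k))) (U : X.left.Opens) : U ≤ X.hom ⁻¹ᵁ ⊤ := le_top

/-- The homomorphism `k → Γ(X, U)` for an open `U` of a `k`-scheme `X`. -/
def structureMap (X : Over (Spec (.of k))) (U : X.left.Opens) : .of k ⟶ Γ(X.left, U) :=
  (Scheme.ΓSpecIso (.of k)).inv ≫ X.hom.appLE ⊤ U (le_preimage_top X U)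

/-- Sections of the structure sheaf of a `k`-scheme form a `k`-algebra. -/
instance sectionsAlgebra (X : Over (Spec (.of k))) (U : X.left.Opens) : Algebra k Γ(X.left, U) :=
  (structureMap X U).hom.toAlgebra

lemma structureMap_comp_appLE {X Y : Over (Spec (.of k))} (f : Y ⟶ X) (W : X.left.Opens)
    (U : Y.left.Opens) (h : U ≤ f.left ⁻¹ᵁ W) :
    structureMap X W ≫ f.left.appLE W U h = structureMap Y U := by
  have key : ∀ (g : Y.left ⟶ Spec (.of k)) (h' : U ≤ g ⁻¹ᵁ ⊤), f.left ≫ X.hom = g →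
      X.hom.appLE ⊤ W (le_preimage_top X W) ≫ f.left.appLE W U h = g.appLE ⊤ U h' := by
    rintro g h' rfl
    exact Scheme.Hom.appLE_comp_appLE _ _ _ _ _ _ _
  rw [structureMap, structureMap, Category.assoc, key Y.hom (le_preimage_top Y U) (Over.w f)]

lemma structureMap_comp_map (X : Over (Spec (.of k))) {U V : X.left.Opens} (h : U ≤ V) :
    structureMap X V ≫ X.left.presheaf.map (homOfLE h).op = structureMap X U := by
  rw [structureMap, structureMap, Category.assoc, Scheme.Hom.appLE_map]

/-- For a morphism `f : Y ⟶ X` of `k`-schemes and opens `U ⊆ f⁻¹ W`, the homomorphism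
`f^* : Γ(X, W) → Γ(Y, U)` of `k`-algebras. -/
def comorphism {X Y : Over (Spec (.of k))} (f : Y ⟶ X) (W : X.left.Opens) (U : Y.left.Opens)
    (h : U ≤ f.left ⁻¹ᵁ W) : Γ(X.left, W) →ₐ[k] Γ(Y.left, U) where
  __ := (f.left.appLE W U h).hom
  commutes' c := congrArg (fun g => g.hom c) (structureMap_comp_appLE f W U h)

/-- The restriction homomorphism `Γ(X, V) → Γ(X, U)` for opens `U ⊆ V`. -/
def res (X : Over (Spec (.of k))) {U V : X.left.Opens} (h : U ≤ V) :
    Γ(X.left, V) →ₐ[k] Γ(X.left, U) where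
  __ := (X.left.presheaf.map (homOfLE h).op).hom
  commutes' c := congrArg (fun g => g.hom c) (structureMap_comp_map X h)

/-- For a morphism `f : Y ⟶ X` and an open `V` of `Y`: a pair of an affine open `U ⊆ V` of `Y` and
an affine open `W` of `X` with `f(U) ⊆ W`. -/
structure AffinePair {X Y : Over (Spec (.of k))} (f : Y ⟶ X) (V : Y.left.Opens) where
  /-- The affine open of the source. -/
  U : Y.left.Opens
  /-- The affine open of the target. -/
  W : X.left.Opens
  affine_U : IsAffineOpen U
  affine_W : IsAffineOpen W
  le : U ≤ V
  le_preimage : U ≤ f.left ⁻¹ᵁ W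

namespace AffinePair

variable {X Y : Over (Spec (.of k))} {f : Y ⟶ X} {V V' : Y.left.Opens}

/-- The homomorphism `Γ(X, W) → Γ(Y, U)` of a pair `(U, W)`. -/
def hom (p : AffinePair f V) : Γ(X.left, p.W) →ₐ[k] Γ(Y.left, p.U) :=
  comorphism f p.W p.U p.le_preimage

/-- A pair for `V` is a pair for every larger open. -/
def enlarge (p : AffinePair f V) (h : V ≤ V') : AffinePair f V' where
  __ := p
  le := p.le.trans h

/-- For a pair `(U, W)`, the module `(f^* Ω_{X/k})(U) = Γ(Y, U) ⊗_{Γ(X, W)} Ω_{Γ(X, W)/k}`. -/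
abbrev Forms (p : AffinePair f V) : Type u := PulledForms p.hom

/-- The restriction map `(f^* Ω_{X/k})(U) → (f^* Ω_{X/k})(U')` for pairs `(U, W)` and `(U', W')`
with `U' ⊆ U` and `W' ⊆ W`. -/
def restrict (p q : AffinePair f V) (hU : q.U ≤ p.U) (hW : q.W ≤ p.W) :
    p.Forms →ₛₗ[(res Y hU).toRingHom] q.Forms :=
  PulledForms.restrict p.hom q.hom (res X hW) (res Y hU) (by
    ext a
    exact congrArg (fun g => g.hom a)
      ((Scheme.Hom.appLE_map f.left p.le_preimage (homOfLE hU).op).trans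
        (Scheme.Hom.map_appLE f.left q.le_preimage (homOfLE hW).op).symm))

end AffinePair

/-- The sections of `f^* Ω_{X/k}` (the pullback of the cotangent sheaf of `X`) over an open
`V ⊆ Y`. As `f^* Ω_{X/k}` is quasi-coherent, and the affine opens `U ⊆ Y` mapping into some affine
open `W ⊆ X` form a basis of `Y` on which its values are `Γ(Y, U) ⊗_{Γ(X, W)} Ω_{Γ(X, W)/k}`,
a section over `V` is a family of elements of these modules, compatible with restriction. -/
def pullbackCotangent {X Y : Over (Spec (.of k))} (f : Y ⟶ X) (V : Y.left.Opens) :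
    Submodule k (∀ p : AffinePair f V, p.Forms) where
  carrier := {σ | ∀ (p q : AffinePair f V) (hU : q.U ≤ p.U) (hW : q.W ≤ p.W),
    p.restrict q hU hW (σ p) = σ q}
  add_mem' hσ hτ p q hU hW := by
    simp only [Pi.add_apply, map_add, hσ p q hU hW, hτ p q hU hW]
  zero_mem' p q hU hW := map_zero _
  smul_mem' c σ hσ p q hU hW := by
    rw [Pi.smul_apply, Pi.smul_apply, ← algebraMap_smul Γ(Y.left, p.U) c (σ p),
      ← algebraMap_smul Γ(Y.left, q.U) c (σ q), ← hσ p q hU hW, map_smulₛₗ]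
    congr 1
    exact (res Y hU).commutes c

/-- Restriction of sections of `f^* Ω_{X/k}` to a smaller open. -/
def restrictSection {X Y : Over (Spec (.of k))} {f : Y ⟶ X} {V V' : Y.left.Opens} (h : V ≤ V') :
    pullbackCotangent f V' →ₗ[k] pullbackCotangent f V where
  toFun σ := ⟨fun p => σ.1 (p.enlarge h), fun p q hU hW => σ.2 (p.enlarge h) (q.enlarge h) hU hW⟩
  map_add' _ _ := rfl
  map_smul' _ _ := rfl

end Schemes

section ProjectiveLine

open MvPolynomial

variable (k : Type u) [Field k]

/-- The standard grading of `k[x₀, x₁]` by degree. -/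
abbrev grading : ℕ → Submodule k (MvPolynomial (Fin 2) k) := homogeneousSubmodule (Fin 2) k

instance : GradedRing (grading k) := MvPolynomial.gradedAlgebra

/-- The structure morphism `Proj k[x₀, x₁] ⟶ Spec k`. -/
def projStructure : Proj (grading k) ⟶ Spec (.of k) :=
  Proj.toSpecZero (grading k) ≫ Spec.map (CommRingCat.ofHom (algebraMap k (grading k 0)))

/-- The projective line `ℙ¹ = Proj k[x₀, x₁]` over `k`. -/
def P1 : Over (Spec (.of k)) := Over.mk (projStructure k)

/-- The affine open `D₊(x₀) ⊆ ℙ¹`. -/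
def D0 : (P1 k).left.Opens := Proj.basicOpen (grading k) (X 0)

/-- The affine open `D₊(x₁) ⊆ ℙ¹`. -/
def D1 : (P1 k).left.Opens := Proj.basicOpen (grading k) (X 1)

/-- The affine open `D₊(x₀ x₁) = D₊(x₀) ∩ D₊(x₁) ⊆ ℙ¹`. -/
def D01 : (P1 k).left.Opens := Proj.basicOpen (grading k) (X 0 * X 1)

lemma D01_le_D0 : D01 k ≤ D0 k := Proj.basicOpen_mono _ _ _ (Dvd.intro _ rfl)

lemma D01_le_D1 : D01 k ≤ D1 k := Proj.basicOpen_mono _ _ _ (Dvd.intro_left _ rfl)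

lemma X_mul_X_mem (i j : Fin 2) : (X i * X j : MvPolynomial (Fin 2) k) ∈ grading k (1 • 2) :=
  (isHomogeneous_X k i).mul (isHomogeneous_X k j)

/-- The fraction `x_i x_j / (x₀ x₁)`. -/
def awayFraction (i j : Fin 2) :
    HomogeneousLocalization.Away (grading k) (X 0 * X 1 : MvPolynomial (Fin 2) k) :=
  HomogeneousLocalization.Away.mk (grading k) (d := 2) (X_mul_X_mem k 0 1) 1 (X i * X j)
    (X_mul_X_mem k i j)

lemma awayFraction_mul (i j : Fin 2) (h : i ≠ j) :
    awayFraction k i i * awayFraction k j j = 1 := by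
  have hij : (X i * X i * (X j * X j) : MvPolynomial (Fin 2) k) = (X 0 * X 1) * (X 0 * X 1) := by
    fin_cases i <;> fin_cases j <;> first | exact absurd rfl h | (dsimp; ring)
  apply HomogeneousLocalization.val_injective
  simp only [awayFraction, HomogeneousLocalization.val_mul, HomogeneousLocalization.Away.val_mk,
    HomogeneousLocalization.val_one, Localization.mk_mul, hij]
  rw [← Localization.mk_one, Localization.mk_eq_mk_iff, Localization.r_iff_exists]
  exact ⟨1, by simp⟩

/-- The coordinate `z = x₁ / x₀ = x₁² / (x₀ x₁)`, a unit on `D₊(x₀ x₁)`, with inverse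
`x₀ / x₁ = x₀² / (x₀ x₁)`. -/
def coordinate : (Γ((P1 k).left, D01 k))ˣ where
  val := (Proj.awayToSection (grading k) (X 0 * X 1)).hom (awayFraction k 1 1)
  inv := (Proj.awayToSection (grading k) (X 0 * X 1)).hom (awayFraction k 0 0)
  val_inv := by
    refine (map_mul (Proj.awayToSection (grading k) (X 0 * X 1)).hom _ _).symm.trans ?_
    rw [awayFraction_mul k 1 0 (by decide)]
    exact map_one _
  inv_val := by
    refine (map_mul (Proj.awayToSection (grading k) (X 0 * X 1)).hom _ _).symm.trans ?_
    rw [awayFraction_mul k 0 1 (by decide)]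
    exact map_one _

/-- The coordinate `z = x₁ / x₀` restricted to an open `U ⊆ D₊(x₀ x₁)`. -/
def coordinateOn {U : (P1 k).left.Opens} (h : U ≤ D01 k) : (Γ((P1 k).left, U))ˣ :=
  Units.map (res (P1 k) h).toRingHom.toMonoidHom (coordinate k)

variable {k}

/-- The space `H⁰(ℙ¹, (T^*ℙ¹)(d))`. A section of a twist `F(d) = F ⊗ 𝒪(d)` is a pair of
sections `s₀ ∈ F(D₊(x₀))` and `s₁ ∈ F(D₊(x₁))` with `s₀ x₀ ^ d = s₁ x₁ ^ d` on the overlap, that is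
`s₀ = z ^ d s₁`. As `D₊(x_i)` is affine, the sections of `F = T^*ℙ¹` over it are the Kähler
differentials of its coordinate ring. -/
def twistedForms (d : ℤ) :
    Submodule k (Ω[Γ((P1 k).left, D0 k)⁄k] × Ω[Γ((P1 k).left, D1 k)⁄k]) where
  carrier := {ω | restrictForms (res (P1 k) (D01_le_D0 k)) ω.1 =
    ((coordinate k ^ d : (Γ((P1 k).left, D01 k))ˣ) : Γ((P1 k).left, D01 k)) •
      restrictForms (res (P1 k) (D01_le_D1 k)) ω.2}
  add_mem' {ω η} hω hη := by
    simp only [Set.mem_ofPred_eq, Prod.fst_add, Prod.snd_add, map_add, smul_add] at *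
    rw [hω, hη]
  zero_mem' := by
    refine (map_zero (restrictForms _)).trans ?_
    refine Eq.trans ?_ (congrArg _ (map_zero (restrictForms _)).symm)
    exact (smul_zero _).symm
  smul_mem' c ω hω := by
    simp only [Set.mem_ofPred_eq, Prod.smul_fst, Prod.smul_snd] at *
    rw [← algebraMap_smul Γ((P1 k).left, D0 k) c ω.1, ← algebraMap_smul Γ((P1 k).left, D1 k) c ω.2,
      map_smulₛₗ, map_smulₛₗ, hω, smul_comm]
    congr 1

/-- The space `H⁰(ℙ¹, (f^* T^*X)(d))` for a morphism `f : ℙ¹ ⟶ X`: pairs of sections of `f^* T^*X`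
over `D₊(x₀)` and `D₊(x₁)` with `s₀ = z ^ d s₁` on the overlap. -/
def twistedPullback {X : Over (Spec (.of k))} (f : P1 k ⟶ X) (d : ℤ) :
    Submodule k (pullbackCotangent f (D0 k) × pullbackCotangent f (D1 k)) where
  carrier := {σ | ∀ p : AffinePair f (D01 k),
    (restrictSection (D01_le_D0 k) σ.1).1 p =
      ((coordinateOn k p.le ^ d : (Γ((P1 k).left, p.U))ˣ) : Γ((P1 k).left, p.U)) •
        (restrictSection (D01_le_D1 k) σ.2).1 p}
  add_mem' {σ τ} hσ hτ p := by
    refine (congrArg₂ (· + ·) (hσ p) (hτ p)).trans (smul_add _ _ _).symm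
  zero_mem' p := (smul_zero _).symm
  smul_mem' c σ hσ p := by
    refine (congrArg (c • ·) (hσ p)).trans (smul_comm _ _ _)

/-- The image `V_d ⊆ H⁰(ℙ¹, (T^*ℙ¹)(d))` of `H⁰(ℙ¹, (f^* T^*X)(d))` under the codifferential
`f^* T^*X ⟶ T^*ℙ¹`: the twisted forms `ω` that agree with the codifferential of some section `σ`
on every affine open of `D₊(x₀)` or `D₊(x₁)` mapping into an affine open of `X`. -/
def imageForms {X : Over (Spec (.of k))} (f : P1 k ⟶ X) (d : ℤ) :
    Submodule k (twistedForms (k := k) d) where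
  carrier := {ω | ∃ σ ∈ twistedPullback f d,
    (∀ p : AffinePair f (D0 k),
      PulledForms.codiff p.hom (σ.1.1 p) = restrictForms (res (P1 k) p.le) ω.1.1) ∧
    (∀ p : AffinePair f (D1 k),
      PulledForms.codiff p.hom (σ.2.1 p) = restrictForms (res (P1 k) p.le) ω.1.2)}
  add_mem' := by
    rintro ω η ⟨σ, hσ, h0, h1⟩ ⟨τ, hτ, g0, g1⟩
    refine ⟨σ + τ, add_mem hσ hτ, fun p => ?_, fun p => ?_⟩
    · refine (map_add (PulledForms.codiff p.hom) (σ.1.1 p) (τ.1.1 p)).trans ?_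
      rw [h0, g0]
      exact (map_add _ _ _).symm
    · refine (map_add (PulledForms.codiff p.hom) (σ.2.1 p) (τ.2.1 p)).trans ?_
      rw [h1, g1]
      exact (map_add _ _ _).symm
  zero_mem' := by
    refine ⟨0, zero_mem _, fun p => ?_, fun p => ?_⟩
    · exact (map_zero (PulledForms.codiff p.hom)).trans (map_zero (restrictForms _)).symm
    · exact (map_zero (PulledForms.codiff p.hom)).trans (map_zero (restrictForms _)).symm
  smul_mem' := by
    rintro c ω ⟨σ, hσ, h0, h1⟩
    refine ⟨c • σ, Submodule.smul_mem _ c hσ, fun p => ?_, fun p => ?_⟩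
    · refine (map_smul (PulledForms.codiff p.hom) (algebraMap k _ c) (σ.1.1 p)).trans ?_
      rw [h0]
      refine Eq.trans ?_ (congrArg (restrictForms (res (P1 k) p.le))
        (algebraMap_smul Γ((P1 k).left, D0 k) c ω.1.1))
      rw [map_smulₛₗ]
      congr 1
    · refine (map_smul (PulledForms.codiff p.hom) (algebraMap k _ c) (σ.2.1 p)).trans ?_
      rw [h1]
      refine Eq.trans ?_ (congrArg (restrictForms (res (P1 k) p.le))
        (algebraMap_smul Γ((P1 k).left, D1 k) c ω.1.2))
      rw [map_smulₛₗ]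
      congr 1

/-- Two subspaces are transverse if they meet in the expected dimension: either they have zero
intersection or they span the ambient space. -/
def Transverse {M : Type u} [AddCommGroup M] [Module k M] (V W : Submodule k M) : Prop :=
  V ⊓ W = ⊥ ∨ V ⊔ W = ⊤

/-- The integer `d₀` of a pair of morphisms: the least `d ≥ 2` for which one of the maps
`H⁰(ℙ¹, (f_i^* T^*X_i)(d)) → H⁰(ℙ¹, (T^*ℙ¹)(d))` is surjective. -/
def leastSurjective {X₁ X₂ : Over (Spec (.of k))} (f₁ : P1 k ⟶ X₁) (f₂ : P1 k ⟶ X₂) : ℕ :=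
  sInf {d : ℕ | 2 ≤ d ∧ (imageForms f₁ (d : ℤ) = ⊤ ∨ imageForms f₂ (d : ℤ) = ⊤)}

/-- The substitution `x_i ↦ ∑ j, A i j x_j` as a graded endomorphism of `k[x₀, x₁]`. -/
def substitution (A : Matrix (Fin 2) (Fin 2) k) : grading k →+*ᵍ grading k where
  __ := (aeval (R := k) fun i => ∑ j, C (A i j) * X j :
    MvPolynomial (Fin 2) k →ₐ[k] MvPolynomial (Fin 2) k).toRingHom
  map_mem {n x} hx := by
    have h := IsHomogeneous.aeval (R := k) (S := k) (n := 1) hx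
      (fun i => ∑ j, C (A i j) * X j) (fun i => IsHomogeneous.sum _ _ _ fun j _ => by
        simpa using (isHomogeneous_C (Fin 2) (A i j)).mul (isHomogeneous_X k j))
    rwa [one_mul] at h

@[simp] lemma substitution_X (A : Matrix (Fin 2) (Fin 2) k) (i : Fin 2) :
    substitution A (X i) = ∑ j, C (A i j) * X j :=
  aeval_X _ i

@[simp] lemma substitution_C (A : Matrix (Fin 2) (Fin 2) k) (c : k) :
    substitution A (C c) = C c :=
  aeval_C _ c

lemma substitution_comp (A B : Matrix (Fin 2) (Fin 2) k) :
    (substitution B).comp (substitution A) = substitution (A * B) := by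
  have h : ((substitution B).comp (substitution A)).toRingHom = (substitution (A * B)).toRingHom := by
    refine MvPolynomial.ringHom_ext (fun c => ?_) (fun i => ?_)
    · change substitution B (substitution A (C c)) = substitution (A * B) (C c)
      simp
    · change substitution B (substitution A (X i)) = substitution (A * B) (X i)
      simp [Matrix.mul_apply, Fin.sum_univ_two]
      ring
  exact GradedRingHom.ext fun x => congrArg (fun g => g x) h

lemma substitution_one : substitution (1 : Matrix (Fin 2) (Fin 2) k) = .id (grading k) := by
  have h : (substitution (1 : Matrix (Fin 2) (Fin 2) k)).toRingHom =
      (GradedRingHom.id (grading k)).toRingHom := by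
    refine MvPolynomial.ringHom_ext (fun c => ?_) (fun i => ?_)
    · change substitution 1 (C c) = C c
      simp
    · change substitution 1 (X i) = X i
      simp [Matrix.one_apply]
  exact GradedRingHom.ext fun x => congrArg (fun g => g x) h

lemma map_substitution_le (A : Matrix (Fin 2) (Fin 2) k) :
    (HomogeneousIdeal.irrelevant (grading k)).map (substitution A) ≤
      HomogeneousIdeal.irrelevant (grading k) := by
  rw [HomogeneousIdeal.map_le_iff_le_comap, HomogeneousIdeal.irrelevant_le]
  intro i hi x hx
  change substitution A x ∈ HomogeneousIdeal.irrelevant (grading k)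
  rw [HomogeneousIdeal.mem_irrelevant_iff, GradedRing.proj_apply]
  exact DirectSum.decompose_of_mem_ne (grading k) ((substitution A).map_mem hx) hi.ne'

lemma irrelevant_le_map (A : GL (Fin 2) k) :
    HomogeneousIdeal.irrelevant (grading k) ≤
      (HomogeneousIdeal.irrelevant (grading k)).map (substitution A.1) := by
  have h : (substitution A.1).comp (substitution (A⁻¹).1) = .id (grading k) := by
    rw [substitution_comp, ← substitution_one]
    exact congrArg substitution A.inv_mul
  calc HomogeneousIdeal.irrelevant (grading k)
      = (HomogeneousIdeal.irrelevant (grading k)).map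
          ((substitution A.1).comp (substitution (A⁻¹).1)) := by
        rw [h, HomogeneousIdeal.map_id]
    _ ≤ _ := by
        rw [HomogeneousIdeal.map_comp]
        exact HomogeneousIdeal.map_mono _ (map_substitution_le _)

lemma projMap_comp_projStructure (A : GL (Fin 2) k) :
    Proj.map (substitution A.1) (irrelevant_le_map A) ≫ projStructure k = projStructure k := by
  refine (Proj.mapAffineOpenCover _ (irrelevant_le_map A)).openCover.hom_ext _ _ fun s => ?_
  have key : ∀ (m : ℕ) (hm : 0 < m) (t : MvPolynomial (Fin 2) k) (ht : t ∈ grading k m),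
      Proj.awayι (grading k) (substitution A.1 t) ((substitution A.1).2 ht) hm ≫
        Proj.map (substitution A.1) (irrelevant_le_map A) ≫ projStructure k =
      Proj.awayι (grading k) (substitution A.1 t) ((substitution A.1).2 ht) hm ≫
        projStructure k := by
    intro m hm t ht
    rw [projStructure, Proj.awayι_comp_map_assoc _ _ hm _ ht, Proj.awayι_toSpecZero_assoc,
      Proj.awayι_toSpecZero_assoc, ← Spec.map_comp, ← Spec.map_comp, ← Spec.map_comp]
    congr 1
    ext c
    have hc : substitution A.1 ((algebraMap k (grading k 0) c : grading k 0) :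
        MvPolynomial (Fin 2) k) = (algebraMap k (grading k 0) c : grading k 0) :=
      substitution_C A.1 c
    change (HomogeneousLocalization.Away.map (substitution A.1) t
      (HomogeneousLocalization.mk ⟨0, algebraMap k (grading k 0) c, 1, one_mem _⟩)).val =
      (HomogeneousLocalization.mk ⟨0, algebraMap k (grading k 0) c, 1, one_mem _⟩ :
        HomogeneousLocalization.Away (grading k) (substitution A.1 t)).val
    rw [HomogeneousLocalization.Away.map, HomogeneousLocalization.map_mk,
      HomogeneousLocalization.val_mk, HomogeneousLocalization.val_mk]
    congr 1
    simp
  exact key _ s.1.2 _ s.2.2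

/-- The endomorphism of `ℙ¹` over `k` given by an invertible matrix. -/
def moebiusHom (A : GL (Fin 2) k) : P1 k ⟶ P1 k :=
  Over.homMk (Proj.map (substitution A.1) (irrelevant_le_map A)) (projMap_comp_projStructure A)

lemma moebiusHom_comp (A B : GL (Fin 2) k) (h : A * B = 1) :
    moebiusHom B ≫ moebiusHom A = 𝟙 (P1 k) := by
  apply Over.OverMorphism.ext
  have h' : (substitution B.1).comp (substitution A.1) = .id (grading k) := by
    rw [substitution_comp, ← substitution_one]
    have hm : A.1 * B.1 = 1 := congrArg Units.val h
    rw [hm]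
  have key : ∀ (g : grading k →+*ᵍ grading k) (hg), g = .id (grading k) →
      Proj.map g hg = 𝟙 (Proj (grading k)) := by
    rintro g hg rfl
    exact Proj.map_id
  exact (Proj.map_comp _ _ (irrelevant_le_map A) (irrelevant_le_map B)).symm.trans (key _ _ h')

/-- The automorphism of `ℙ¹` over `k` given by an invertible `2 × 2` matrix `A`, that is
`[x₀ : x₁] ↦ [A₀₀ x₀ + A₀₁ x₁ : A₁₀ x₀ + A₁₁ x₁]`. All automorphisms of `ℙ¹` are of this form. -/
def moebius (A : GL (Fin 2) k) : P1 k ≅ P1 k where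
  hom := moebiusHom A
  inv := moebiusHom A⁻¹
  hom_inv_id := moebiusHom_comp _ _ (inv_mul_cancel A)
  inv_hom_id := moebiusHom_comp _ _ (mul_inv_cancel A)

/-- A property holds for a general automorphism of `ℙ¹` if it holds on a nonempty Zariski open
subset of `Aut(ℙ¹) = PGL₂(k)`, that is, for all invertible matrices outside the zero locus of some
nonzero polynomial in the four matrix entries. -/
def ForGeneralAut (P : (P1 k ≅ P1 k) → Prop) : Prop :=
  ∃ F : MvPolynomial (Fin 2 × Fin 2) k, F ≠ 0 ∧
    ∀ A : GL (Fin 2) k, MvPolynomial.eval (fun ij => A.1 ij.1 ij.2) F ≠ 0 → P (moebius A)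

end ProjectiveLine

end RationalCurves
end
open RationalCurves

/-!
A twisted form in `H⁰(ℙ¹, (T^*ℙ¹)(d))` is `G (x₀ dx₁ - x₁ dx₀)` for a unique binary form `G` of
degree `m = d - 2` (`ofForm_bijective`), and there is none for `d < 2`. So `V_d(f)` becomes a space
`imageCoeffs f m` of binary forms, and three facts about these spaces give the result.

* Precomposition of `f` with the automorphism `α` given by a matrix `A` transforms `V_d(f)` by the
  linear substitution `A` (`imageCoeffs_moebius`). Up to the nonzero factor `det A`, this is the
  behaviour of `G (x₀ dx₁ - x₁ dx₀)` under `α`.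
* The spaces `V_d(f)` are stable under multiplication by `x₀` and `x₁`. So `V_d(f)` is everything
  for all `d` beyond the first such `d ≥ 2` (`imageForms_eq_top_of_le`), which settles all `d ≥ d₀`.
  That `d₀` exists is due to `f` being unramified (`exists_imageCoeffs_eq_top`): over the affine
  open `D₊(x_i)`, the codifferential is then surjective on sections (`exists_hasCodiff`), and a
  section over `D₊(x_i)` extends to `ℙ¹` after multiplication by a power of `x_i`. Thus
  `x₀ ^ M` and `x₁ ^ N` lie in the spaces for suitable `M` and `N`, and every monomial of degree
  `M + N` is divisible by one of them.
* For `2 ≤ d < d₀`, the assumption on `p` makes `m!` invertible in `k`. Then any two spaces `A`, `B`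
  of binary forms of degree `m` are transverse after a general substitution in `B`
  (`exists_polynomial_transverse`). One may assume `dim A + dim B = m + 1`. As the condition
  `A + g B = ⊤` is the nonvanishing of a polynomial in the entries of `g`, a single `g` is enough.
  A general translate of `A` contains no nonzero form vanishing to order `dim A` at `[1 : 0]`
  (`exists_translate`): degenerating by the torus reduces this to spaces spanned by monomials, where
  it is the nonvanishing of a determinant of binomial coefficients, hence of a Vandermonde
  determinant. Likewise for `B` at `[0 : 1]`. Once both hold, a scaling `diag(1, c)` moves the two
  spaces apart (`exists_scaling`).

Only finitely many `d` remain in the last case, and the product of their polynomials cuts out the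
open subset.

Sections of `f^* Ω_{X/k}` are families indexed by the pairs of affine opens `U` and `W` with
`f(U) ⊆ W`. The lemmas about them rest on the compatibility of Kähler differentials with
localization and on the separatedness of `X`, by which two affine opens `W` can be intersected.
-/

noncomputable section

namespace RationalCurves

/-! ### Binary forms and linear substitutions -/

section BinaryForms

open Polynomial

/-- The binary form `∑ i, v i * x₀ ^ (m - i) * x₁ ^ i` of degree `m` with coefficients `v`. -/
def form {R : Type*} [CommRing R] (m : ℕ) :
    (Fin (m + 1) → R) →ₗ[R] MvPolynomial (Fin 2) R where
  toFun v := ∑ i : Fin (m + 1), MvPolynomial.C (v i) *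
    (MvPolynomial.X 0 ^ (m - i : ℕ) * MvPolynomial.X 1 ^ (i : ℕ))
  map_add' v w := by simp [add_mul, Finset.sum_add_distrib]
  map_smul' c v := by simp [MvPolynomial.smul_eq_C_mul, Finset.mul_sum, mul_assoc]

lemma form_apply {R : Type*} [CommRing R] {m : ℕ} (v : Fin (m + 1) → R) :
    form m v = ∑ i : Fin (m + 1), MvPolynomial.C (v i) *
      (MvPolynomial.X 0 ^ (m - i : ℕ) * MvPolynomial.X 1 ^ (i : ℕ)) := rfl

lemma aeval_form {R S : Type*} [CommRing R] [CommRing S] [Algebra R S] {m : ℕ}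
    (v : Fin (m + 1) → R) (s : Fin 2 → S) :
    MvPolynomial.aeval s (form m v) =
      ∑ i : Fin (m + 1), algebraMap R S (v i) * (s 0 ^ (m - i : ℕ) * s 1 ^ (i : ℕ)) := by
  simp [form_apply, map_sum]

/-- The action of a `2 × 2` matrix on binary forms of degree `m`, in terms of coefficients: the
coefficients of the form obtained by the substitution `x_i ↦ ∑ j, g i j x_j`. -/
def act {R : Type*} [CommRing R] (m : ℕ) (g : Matrix (Fin 2) (Fin 2) R) :
    (Fin (m + 1) → R) →ₗ[R] (Fin (m + 1) → R) where
  toFun v j := (MvPolynomial.aeval (fun i => C (g i 0) + C (g i 1) * X) (form m v) : R[X]).coeff j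
  map_add' v w := by ext j; simp
  map_smul' c v := by ext j; simp

lemma act_apply {R : Type*} [CommRing R] {m : ℕ} (g : Matrix (Fin 2) (Fin 2) R)
    (v : Fin (m + 1) → R) (j : Fin (m + 1)) :
    act m g v j =
      (MvPolynomial.aeval (fun i => C (g i 0) + C (g i 1) * X) (form m v) : R[X]).coeff j := rfl

lemma map_act {R S : Type*} [CommRing R] [CommRing S] (φ : R →+* S) {m : ℕ}
    (g : Matrix (Fin 2) (Fin 2) R) (v : Fin (m + 1) → R) (j : Fin (m + 1)) :
    φ (act m g v j) = act m (g.map φ) (φ ∘ v) j := by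
  simp only [act_apply, aeval_form]
  rw [← Polynomial.coeff_map]
  simp [Polynomial.map_sum]

variable {k : Type*} [Field k]

lemma form_mem {m : ℕ} (v : Fin (m + 1) → k) :
    form m v ∈ MvPolynomial.homogeneousSubmodule (Fin 2) k m := by
  rw [form_apply]
  refine Submodule.sum_mem _ fun i _ => ?_
  have h := (MvPolynomial.isHomogeneous_C (Fin 2) (v i)).mul
    (((MvPolynomial.isHomogeneous_X k (0 : Fin 2)).pow (m - i : ℕ)).mul
      ((MvPolynomial.isHomogeneous_X k (1 : Fin 2)).pow (i : ℕ)))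
  have e : 0 + (1 * (m - i : ℕ) + 1 * (i : ℕ)) = m := by have := i.2; omega
  rwa [e] at h

/-- The coefficients of a binary form can be read off after setting `x₀ = 1`. -/
lemma coeff_dehomogenize_form {m : ℕ} (v : Fin (m + 1) → k) (j : Fin (m + 1)) :
    (MvPolynomial.aeval ![1, X] (form m v) : k[X]).coeff j = v j := by
  simp only [aeval_form, Matrix.cons_val_zero, Matrix.cons_val_one, one_pow, one_mul,
    Polynomial.algebraMap_eq, Polynomial.finsetSum_coeff, Polynomial.coeff_C_mul_X_pow]
  rw [Finset.sum_eq_single j]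
  · simp
  · intro b _ hb
    rw [if_neg]
    exact fun h => hb (Fin.ext h.symm)
  · simp

lemma form_injective (m : ℕ) : Function.Injective (form (R := k) m) := fun v w h => by
  ext j
  rw [← coeff_dehomogenize_form v j, h, coeff_dehomogenize_form]

lemma exists_form_eq {m : ℕ} {G : MvPolynomial (Fin 2) k}
    (hG : G ∈ MvPolynomial.homogeneousSubmodule (Fin 2) k m) : ∃ v, form m v = G := by
  have hG' : G.IsHomogeneous m := hG
  suffices G ∈ LinearMap.range (form (R := k) m) from this
  rw [← G.support_sum_monomial_coeff]
  refine Submodule.sum_mem _ fun s hs => ?_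
  have hs' : s 0 + s 1 = m := by
    have h := hG' (MvPolynomial.mem_support_iff.mp hs)
    rw [Finsupp.weight_apply, Finsupp.sum_fintype _ _ (by simp)] at h
    simpa using h
  refine ⟨Pi.single ⟨s 1, by omega⟩ (G.coeff s), ?_⟩
  rw [form_apply, Finset.sum_eq_single ⟨s 1, by omega⟩]
  · rw [Pi.single_eq_same, MvPolynomial.monomial_eq, Finsupp.prod_fintype _ _ (by simp)]
    simp [← hs']
  · intro b _ hb
    rw [Pi.single_eq_of_ne hb, map_zero, zero_mul]
  · simp

lemma form_act {m : ℕ} (g : Matrix (Fin 2) (Fin 2) k) (v : Fin (m + 1) → k) :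
    form m (act m g v) = substitution g (form m v) := by
  obtain ⟨w, hw⟩ := exists_form_eq ((substitution g).map_mem (form_mem v))
  have hw : form m w = substitution g (form m v) := hw
  rw [← hw]
  congr 1
  ext j
  rw [act_apply, ← coeff_dehomogenize_form w j, hw]
  have h : ((MvPolynomial.aeval ![1, X] : MvPolynomial (Fin 2) k →ₐ[k] k[X]).comp
      (MvPolynomial.aeval fun i => ∑ j, MvPolynomial.C (g i j) * MvPolynomial.X j)) =
      MvPolynomial.aeval (fun i => C (g i 0) + C (g i 1) * X) := by
    ext i : 1
    simp [Fin.sum_univ_two]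
  exact congrArg (fun q : k[X] => q.coeff j) (DFunLike.congr_fun h (form m v)).symm

lemma act_mul {m : ℕ} (g h : Matrix (Fin 2) (Fin 2) k) (v : Fin (m + 1) → k) :
    act m (g * h) v = act m h (act m g v) := by
  apply form_injective
  rw [form_act, form_act, form_act, ← substitution_comp]
  rfl

lemma act_one {m : ℕ} (v : Fin (m + 1) → k) : act m 1 v = v := by
  apply form_injective
  rw [form_act, substitution_one]
  rfl

lemma act_inv_act {m : ℕ} (g : GL (Fin 2) k) (v : Fin (m + 1) → k) :
    act m (g⁻¹).1 (act m g.1 v) = v := by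
  rw [← act_mul]
  exact (congrArg (fun x : GL (Fin 2) k => act m x.1 v) (mul_inv_cancel g)).trans (act_one v)

/-- The action of an invertible matrix on binary forms of degree `m`. -/
def actEquiv (m : ℕ) (g : GL (Fin 2) k) : (Fin (m + 1) → k) ≃ₗ[k] (Fin (m + 1) → k) :=
  LinearEquiv.ofLinearMap (act m g.1) (act m (g⁻¹).1)
    (LinearMap.ext fun v => by simpa using act_inv_act g⁻¹ v)
    (LinearMap.ext fun v => act_inv_act g v)

/-- The torus `diag(1, c)` scales the coefficient of `x₁ ^ j` by `c ^ j`. -/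
lemma act_diagonal {m : ℕ} (c : k) (v : Fin (m + 1) → k) (j : Fin (m + 1)) :
    act m !![1, 0; 0, c] v j = c ^ (j : ℕ) * v j := by
  rw [act_apply, aeval_form]
  simp only [Matrix.of_apply, Matrix.cons_val', Matrix.cons_val_zero, Matrix.cons_val_one,
    Matrix.cons_val_fin_one, map_one, map_zero, zero_mul, add_zero, one_pow, one_mul, zero_add,
    mul_pow, ← C_pow, ← mul_assoc, Polynomial.algebraMap_eq, ← C_mul,
    Polynomial.finsetSum_coeff, Polynomial.coeff_C_mul_X_pow]
  rw [Finset.sum_eq_single j]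
  · simp [mul_comm]
  · intro b _ hb
    rw [if_neg]
    exact fun h => hb (Fin.ext h.symm)
  · simp

/-- Exchanging the coordinates reverses the list of coefficients. -/
lemma act_swap {m : ℕ} (v : Fin (m + 1) → k) (j : Fin (m + 1)) :
    act m !![0, 1; 1, 0] v j = v j.rev := by
  rw [act_apply, aeval_form]
  simp only [Matrix.of_apply, Matrix.cons_val', Matrix.cons_val_zero, Matrix.cons_val_one,
    Matrix.cons_val_fin_one, map_one, map_zero, zero_mul, add_zero, one_pow, one_mul, zero_add,
    mul_one, Polynomial.algebraMap_eq,
    Polynomial.finsetSum_coeff, Polynomial.coeff_C_mul_X_pow]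
  rw [Finset.sum_eq_single j.rev]
  · rw [if_pos]
    rw [Fin.val_rev]; omega
  · intro b _ hb
    rw [if_neg]
    intro h
    apply hb
    ext
    rw [Fin.val_rev]; omega
  · simp

/-- The coefficients after the substitution `x₁ ↦ x₀ + x₁`. -/
lemma act_translation {m : ℕ} (v : Fin (m + 1) → k) (j : Fin (m + 1)) :
    act m !![1, 0; 1, 1] v j = ∑ l : Fin (m + 1), v l * ((l : ℕ).choose j : k) := by
  rw [act_apply, aeval_form]
  simp only [Matrix.of_apply, Matrix.cons_val', Matrix.cons_val_zero, Matrix.cons_val_one,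
    Matrix.cons_val_fin_one, map_one, map_zero, zero_mul, add_zero, one_pow, one_mul,
    Polynomial.algebraMap_eq,
    Polynomial.finsetSum_coeff, Polynomial.coeff_C_mul, Polynomial.coeff_one_add_X_pow]

/-- A matrix of polynomials that is invertible at `0` is invertible at some nonzero scalar. -/
lemma exists_eval_det_ne_zero [Infinite k] {n : Type*} [Fintype n] [DecidableEq n]
    (M : Matrix n n k[X]) (h : (M.map (eval 0)).det ≠ 0) :
    ∃ c : k, c ≠ 0 ∧ (M.map (eval c)).det ≠ 0 := by
  have hdet : ∀ c : k, (M.map (eval c)).det = M.det.eval c := fun c =>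
    ((evalRingHom c).map_det M).symm
  rw [hdet] at h
  have h0 : X * M.det ≠ 0 := mul_ne_zero X_ne_zero fun h' => h (by rw [h', eval_zero])
  obtain ⟨c, hc⟩ : ∃ c : k, (X * M.det).eval c ≠ 0 := by
    by_contra! hall
    exact h0 (Polynomial.funext fun c => by rw [hall c, eval_zero])
  rw [eval_mul, eval_X] at hc
  exact ⟨c, left_ne_zero_of_mul hc, by rw [hdet]; exact right_ne_zero_of_mul hc⟩

/-- A subspace of dimension `a` contains `a` vectors with pairwise distinct top indices `e i`, where
the entry is normalized to `1`. -/
lemma exists_echelon {n a : ℕ} (A : Submodule k (Fin n → k)) (ha : Module.finrank k A = a) :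
    ∃ (e : Fin a → Fin n) (v : Fin a → Fin n → k),
      Function.Injective e ∧ (∀ i, v i ∈ A) ∧ (∀ i, v i (e i) = 1) ∧
        ∀ i j, e i < j → v i j = 0 := by
  classical
  subst ha
  -- the coordinates in the set `T` of all top indices separate the elements of `A`, so that there
  -- are at least `dim A` of them
  let T : Set (Fin n) := {i | ∃ v ∈ A, v i = 1 ∧ ∀ j, i < j → v j = 0}
  let r : A →ₗ[k] (T → k) := (LinearMap.funLeft k k (Subtype.val : T → Fin n)).comp A.subtype
  have hr : Function.Injective r := by
    rw [← LinearMap.ker_eq_bot, LinearMap.ker_eq_bot']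
    rintro ⟨v, hv⟩ h
    by_contra hne
    have hex : (Finset.univ.filter fun i => v i ≠ 0).Nonempty := by
      by_contra hem
      rw [Finset.not_nonempty_iff_eq_empty, Finset.filter_eq_empty_iff] at hem
      exact hne (Subtype.ext (funext fun i => not_not.mp (hem (Finset.mem_univ i))))
    set t := Finset.max' _ hex with ht
    have htm : v t ≠ 0 := (Finset.mem_filter.mp (Finset.max'_mem _ hex)).2
    have htop : ∀ j, t < j → v j = 0 := fun j hj => by
      by_contra hvj
      exact absurd (Finset.le_max' _ j (Finset.mem_filter.mpr ⟨Finset.mem_univ _, hvj⟩))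
        (not_le.mpr hj)
    have htT : t ∈ T :=
      ⟨(v t)⁻¹ • v, A.smul_mem _ hv, by simp [htm], fun j hj => by simp [htop j hj]⟩
    exact htm (congrFun h ⟨t, htT⟩)
  have hcard : Module.finrank k A ≤ Fintype.card T := by
    have := LinearMap.finrank_le_finrank_of_injective hr
    rwa [Module.finrank_fintype_fun_eq_card] at this
  obtain ⟨ι⟩ : Nonempty (Fin (Module.finrank k A) ↪ T) :=
    Function.Embedding.nonempty_of_card_le (by simpa using hcard)
  choose v hv using fun i => (ι i).2
  exact ⟨fun i => ι i, v, Subtype.val_injective.comp ι.injective, fun i => (hv i).1,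
    fun i => (hv i).2.1, fun i => (hv i).2.2⟩

/-- Up to the factors `j!`, the matrix of binomial coefficients `e_i choose j` is that of the values
of the monic polynomials `x (x - 1) ⋯ (x - j + 1)` at the `e_i`, so that its determinant is a
Vandermonde determinant. Its nodes `e_i ≤ m` remain distinct in `k` if `m!` is invertible. This is
the only place where the characteristic of `k` matters. -/
lemma det_choose_ne_zero {a m : ℕ} (hchar : ∀ i : ℕ, 0 < i → i ≤ m → (i : k) ≠ 0)
    (e : Fin a → Fin (m + 1)) (he : Function.Injective e) :
    (Matrix.of fun i j : Fin a => (((e i : ℕ).choose j : ℕ) : k)).det ≠ 0 := by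
  have hinj : Function.Injective fun i : Fin a => ((e i : ℕ) : k) := by
    have key : ∀ i j : Fin a, (e i : ℕ) < e j → ((e i : ℕ) : k) ≠ ((e j : ℕ) : k) := by
      intro i j hij h
      have := (e j).2
      refine hchar (e j - e i) (by omega) (by omega) ?_
      rw [Nat.cast_sub hij.le, h, sub_self]
    intro i j hij
    by_contra hne
    rcases lt_or_gt_of_ne (fun h => hne (he (Fin.ext h)) : (e i : ℕ) ≠ e j) with h | h
    · exact key _ _ h hij
    · exact key _ _ h hij.symm
  have hV := Matrix.det_vandermonde_ne_zero_iff.mpr hinj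
  rw [Matrix.det_eval_matrixOfPolynomials_eq_det_vandermonde _ (fun j : Fin a => descPochhammer k j)
    (fun j => descPochhammer_natDegree k j) (fun j => monic_descPochhammer k j)] at hV
  intro h0
  apply hV
  have : (Matrix.of fun i j : Fin a => (descPochhammer k j).eval ((e i : ℕ) : k)) =
      (Matrix.of fun i j : Fin a => (((e i : ℕ).choose j : ℕ) : k)) *
        Matrix.diagonal fun j : Fin a => (((j : ℕ).factorial : ℕ) : k) := by
    ext i j
    rw [Matrix.mul_diagonal, Matrix.of_apply, Matrix.of_apply,
      descPochhammer_eval_eq_descFactorial, Nat.descFactorial_eq_factorial_mul_choose,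
      Nat.cast_mul, mul_comm]
  rw [this, Matrix.det_mul, h0, zero_mul]

lemma span_rows_eq_top {n : Type*} [Fintype n] [DecidableEq n] {M : Matrix n n k}
    (h : M.det ≠ 0) : Submodule.span k (Set.range M.row) = ⊤ :=
  (Matrix.linearIndependent_rows_of_det_ne_zero h).span_eq_top_of_card_eq_finrank' (by simp)

/-- The diagonal matrix `diag(1, c)` as an element of `GL₂`. -/
def scaling (c : k) (hc : c ≠ 0) : GL (Fin 2) k :=
  Matrix.GeneralLinearGroup.mkOfDetNeZero !![1, 0; 0, c] (by simpa using hc)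

/-- If `m!` is invertible in `k`, then a general translate of a space `A` of forms of degree `m`
has no nonzero element vanishing to order `dim A` at `[1 : 0]`: after a torus degeneration, `A` is
spanned by monomials, for which the claim is the nonvanishing of a binomial determinant. -/
lemma exists_translate [Infinite k] {m : ℕ} (hchar : ∀ i : ℕ, 0 < i → i ≤ m → (i : k) ≠ 0)
    (A : Submodule k (Fin (m + 1) → k)) : ∃ g : GL (Fin 2) k, ∀ v ∈ A,
      (∀ j : Fin (m + 1), (j : ℕ) < Module.finrank k A → act m g.1 v j = 0) → v = 0 := by
  have ham : Module.finrank k A ≤ m + 1 := by simpa using A.finrank_le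
  generalize ha : Module.finrank k A = a at ham ⊢
  obtain ⟨e, v, he, hvA, hve, hvt⟩ := exists_echelon A ha
  -- scale `v i` by `diag(1, c⁻¹)`, multiply it by `c ^ e i`, and translate it: the first `a`
  -- coefficients are polynomials in `c`, to which only the top coefficient of `v i` contributes at
  -- `c = 0`
  let N : Matrix (Fin a) (Fin a) k[X] := Matrix.of fun i j =>
    ∑ l : Fin (m + 1), C (v i l * ((l : ℕ).choose j : k)) * X ^ ((e i : ℕ) - l)
  obtain ⟨c, hc, hdet⟩ := exists_eval_det_ne_zero N (by
    convert det_choose_ne_zero hchar e he using 2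
    ext i j
    simp only [N, Matrix.map_apply, Matrix.of_apply, eval_finsetSum, eval_mul, eval_C, eval_pow,
      eval_X]
    rw [Finset.sum_eq_single (e i)]
    · simp [hve]
    · intro l _ hl
      rcases lt_or_gt_of_ne hl with h | h
      · rw [zero_pow (by have : (l : ℕ) < e i := h; omega), mul_zero]
      · rw [hvt i l h, zero_mul, zero_mul]
    · simp)
  let T : GL (Fin 2) k := Matrix.GeneralLinearGroup.mkOfDetNeZero !![1, 0; 1, 1] (by simp)
  let g : GL (Fin 2) k := scaling c⁻¹ (inv_ne_zero hc) * T
  have hg : ∀ w, act m g.1 w = act m !![1, 0; 1, 1] (act m !![1, 0; 0, c⁻¹] w) := fun w =>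
    act_mul _ _ w
  refine ⟨g, fun w hw h0 => ?_⟩
  -- the first `a` coefficients after the substitution `g`; as `dim A = a`, surjectivity suffices
  let Φ : A →ₗ[k] (Fin a → k) :=
    ((LinearMap.funLeft k k (Fin.castLE ham)).comp (act m g.1)).comp A.subtype
  have hsurj : Function.Surjective Φ := by
    rw [← LinearMap.range_eq_top, eq_top_iff, ← span_rows_eq_top hdet, Submodule.span_le]
    rintro _ ⟨i, rfl⟩
    refine ⟨c ^ (e i : ℕ) • ⟨v i, hvA i⟩, ?_⟩
    ext j
    simp only [Φ, N, map_smul, Pi.smul_apply, LinearMap.comp_apply, LinearMap.funLeft_apply,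
      Submodule.subtype_apply, hg, act_translation, act_diagonal, Matrix.row, Matrix.map_apply,
      Matrix.of_apply, eval_finsetSum, eval_mul, eval_C, eval_pow, eval_X, smul_eq_mul,
      Finset.mul_sum, Fin.val_castLE]
    refine Finset.sum_congr rfl fun l _ => ?_
    rcases le_or_gt l (e i) with h | h
    · have : (l : ℕ) ≤ e i := h
      rw [pow_sub₀ c hc this, inv_pow]
      ring
    · rw [hvt i l h]
      simp
  have hinj : Function.Injective Φ :=
    (LinearMap.injective_iff_surjective_of_finrank_eq_finrank (by simp [ha])).mpr hsurj
  have : (⟨w, hw⟩ : A) = 0 := hinj (by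
    rw [map_zero]
    ext j
    exact h0 (Fin.castLE ham j) j.2)
  exact congrArg Subtype.val this

/-- The counterpart of `exists_translate` at the point `[0 : 1]`. -/
lemma exists_translate_rev [Infinite k] {m : ℕ}
    (hchar : ∀ i : ℕ, 0 < i → i ≤ m → (i : k) ≠ 0)
    (A : Submodule k (Fin (m + 1) → k)) : ∃ g : GL (Fin 2) k, ∀ v ∈ A,
      (∀ j : Fin (m + 1), m + 1 - Module.finrank k A ≤ j → act m g.1 v j = 0) → v = 0 := by
  obtain ⟨g, hg⟩ := exists_translate hchar A
  let w : GL (Fin 2) k := Matrix.GeneralLinearGroup.mkOfDetNeZero !![0, 1; 1, 0] (by simp)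
  refine ⟨g * w, fun v hv h0 => hg v hv fun j hj => ?_⟩
  have h := h0 j.rev (by rw [Fin.val_rev]; omega)
  have e : act m (g * w).1 v = act m !![0, 1; 1, 0] (act m g.1 v) := act_mul _ _ v
  rwa [e, act_swap, Fin.rev_rev] at h

/-- If the coordinates in `P` determine the elements of a space `A` of dimension `|P|`, then `A` has
a basis dual to these coordinates. -/
lemma exists_dual_vector {n : ℕ} (P : Fin n → Prop) [DecidablePred P]
    (A : Submodule k (Fin n → k)) (hA : Module.finrank k A = Fintype.card {i // P i})
    (h : ∀ v ∈ A, (∀ j, P j → v j = 0) → v = 0) (i : Fin n) :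
    ∃ v ∈ A, ∀ j, P j → v j = if i = j then 1 else 0 := by
  let Φ : A →ₗ[k] ({i // P i} → k) := (LinearMap.funLeft k k Subtype.val).comp A.subtype
  have hinj : Function.Injective Φ := by
    rw [← LinearMap.ker_eq_bot, LinearMap.ker_eq_bot']
    rintro ⟨v, hv⟩ h0
    exact Subtype.ext (h v hv fun j hj => congrFun h0 ⟨j, hj⟩)
  obtain ⟨v, hv⟩ := (LinearMap.injective_iff_surjective_of_finrank_eq_finrank
    (by simp [hA])).mp hinj fun j => if i = j then 1 else 0
  exact ⟨v, v.2, fun j hj => congrFun hv ⟨j, hj⟩⟩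

/-- Two spaces `A` and `B` of forms of complementary dimension, `A` without nonzero forms vanishing
to order `dim A` at `[1 : 0]` and `B` without nonzero forms vanishing to order `dim B` at `[0 : 1]`,
span all forms after a general scaling of `B`. -/
lemma exists_scaling [Infinite k] {m a : ℕ} (A B : Submodule k (Fin (m + 1) → k))
    (hA : Module.finrank k A = a) (hAB : Module.finrank k A + Module.finrank k B = m + 1)
    (h1 : ∀ v ∈ A, (∀ j : Fin (m + 1), (j : ℕ) < a → v j = 0) → v = 0)
    (h2 : ∀ v ∈ B, (∀ j : Fin (m + 1), ¬ (j : ℕ) < a → v j = 0) → v = 0) :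
    ∃ g : GL (Fin 2) k, A ⊔ B.map (act m g.1) = ⊤ := by
  have hcard : Fintype.card {i : Fin (m + 1) // (i : ℕ) < a} = a := by
    rw [Fintype.card_subtype, Fin.card_filter_val_lt]
    omega
  have hcard' : Fintype.card {i : Fin (m + 1) // ¬ (i : ℕ) < a} = m + 1 - a := by
    rw [Fintype.card_subtype_compl, hcard, Fintype.card_fin]
  choose p hpA hp using exists_dual_vector (fun i : Fin (m + 1) => (i : ℕ) < a) A
    (by rw [hA, hcard]) h1
  choose q hqB hq using exists_dual_vector (fun i : Fin (m + 1) => ¬ (i : ℕ) < a) B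
    (by rw [hcard']; omega) h2
  -- the rows are the dual basis of `A` and the dual basis of `B` scaled by `diag(1, c⁻¹)`, the
  -- `i`-th row of the latter multiplied by `c ^ i`; for `l > i` the exponent `i - l` is zero, which
  -- is harmless since the coefficient vanishes there; the matrix is triangular at `c = 0`
  let M : Matrix (Fin (m + 1)) (Fin (m + 1)) k[X] := Matrix.of fun i l =>
    if (i : ℕ) < a then C (p i l) else C (q i l) * X ^ ((i : ℕ) - l)
  obtain ⟨c, hc, hdet⟩ := exists_eval_det_ne_zero M (by
    rw [Matrix.det_of_isUpperTriangular]
    · refine Finset.prod_ne_zero_iff.mpr fun i _ => ?_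
      by_cases hi : (i : ℕ) < a
      · simp [M, hi, hp i i hi]
      · simp [M, hi, hq i i hi]
    · intro i j (hji : j < i)
      have hji' : (j : ℕ) < i := hji
      by_cases hi : (i : ℕ) < a
      · simp [M, hi, hp i j (by omega), hji.ne']
      · simp [M, hi, (show (i : ℕ) - j ≠ 0 by omega)])
  refine ⟨scaling c⁻¹ (inv_ne_zero hc), ?_⟩
  rw [eq_top_iff, ← span_rows_eq_top hdet, Submodule.span_le]
  rintro _ ⟨i, rfl⟩
  by_cases hi : (i : ℕ) < a
  · refine Submodule.mem_sup_left ?_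
    convert hpA i using 1
    ext l
    simp [M, hi, Matrix.row]
  · refine Submodule.mem_sup_right ⟨c ^ (i : ℕ) • q i, B.smul_mem _ (hqB i), ?_⟩
    ext l
    have e : act m (scaling c⁻¹ (inv_ne_zero hc)).1 (c ^ (i : ℕ) • q i) l =
      c⁻¹ ^ (l : ℕ) * (c ^ (i : ℕ) * q i l) := act_diagonal _ _ _
    rw [e]
    simp only [M, hi, Matrix.row, Matrix.map_apply, Matrix.of_apply, if_false, eval_mul, eval_C,
      eval_pow, eval_X]
    rcases le_or_gt l i with h | h
    · have : (l : ℕ) ≤ i := h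
      rw [pow_sub₀ c hc this, inv_pow]
      ring
    · have : (i : ℕ) < l := h
      rw [hq i l (by omega), if_neg h.ne]
      ring

lemma exists_submodule_le_finrank_eq {V : Type*} [AddCommGroup V] [Module k V]
    [FiniteDimensional k V] {B : Submodule k V} {d : ℕ} (hd : d ≤ Module.finrank k B) :
    ∃ B' ≤ B, Module.finrank k B' = d := by
  let b := Module.finBasis k B
  have hli : LinearIndependent k fun i : Fin d => (b (Fin.castLE hd i) : V) :=
    (b.linearIndependent.map' B.subtype B.ker_subtype).comp _ (Fin.castLE_injective hd)
  refine ⟨Submodule.span k (Set.range fun i : Fin d => (b (Fin.castLE hd i) : V)), ?_, ?_⟩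
  · rw [Submodule.span_le]
    rintro _ ⟨i, rfl⟩
    exact (b _).2
  · simpa using finrank_span_eq_card hli

lemma exists_le_submodule_finrank_eq {V : Type*} [AddCommGroup V] [Module k V]
    [FiniteDimensional k V] (B : Submodule k V) {d : ℕ} (hB : Module.finrank k B ≤ d)
    (hd : d ≤ Module.finrank k V) : ∃ B', B ≤ B' ∧ Module.finrank k B' = d := by
  obtain ⟨C, hC⟩ := B.exists_isCompl
  have hfin := Submodule.finrank_add_eq_of_isCompl hC
  obtain ⟨C', hC', hC'd⟩ := exists_submodule_le_finrank_eq (B := C)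
    (d := d - Module.finrank k B) (by omega)
  refine ⟨B ⊔ C', le_sup_left, ?_⟩
  have h := Submodule.finrank_sup_add_finrank_inf_eq B C'
  have h0 : B ⊓ C' = ⊥ := le_bot_iff.mp ((inf_le_inf_left B hC').trans hC.inf_eq_bot.le)
  rw [h0, finrank_bot] at h
  omega

/-- The key transversality statement for binary forms: two spaces of complementary dimension can be
moved into general position. -/
lemma exists_sup_map_act_eq_top [Infinite k] {m : ℕ}
    (hchar : ∀ i : ℕ, 0 < i → i ≤ m → (i : k) ≠ 0) (A B : Submodule k (Fin (m + 1) → k))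
    (hAB : Module.finrank k A + Module.finrank k B = m + 1) :
    ∃ g : GL (Fin 2) k, A ⊔ B.map (act m g.1) = ⊤ := by
  obtain ⟨g, hg⟩ := exists_translate hchar A
  obtain ⟨h, hh⟩ := exists_translate_rev hchar B
  obtain ⟨s, hs⟩ := exists_scaling (A.map (actEquiv m g).toLinearMap)
    (B.map (actEquiv m h).toLinearMap) ((actEquiv m g).finrank_map_eq A)
    (by rw [LinearEquiv.finrank_map_eq, LinearEquiv.finrank_map_eq, hAB])
    (by
      rintro _ ⟨v, hv, rfl⟩ h0
      exact (congrArg (actEquiv m g) (hg v hv h0)).trans (map_zero _))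
    (by
      rintro _ ⟨v, hv, rfl⟩ h0
      exact (congrArg (actEquiv m h) (hh v hv fun j hj => h0 j (by omega))).trans (map_zero _))
  refine ⟨h * s * g⁻¹, ?_⟩
  rw [eq_top_iff]
  intro v _
  have hv : act m g.1 v ∈ A.map (actEquiv m g).toLinearMap ⊔
      (B.map (actEquiv m h).toLinearMap).map (act m s.1) := hs ▸ trivial
  obtain ⟨_, ⟨x, hx, rfl⟩, _, ⟨_, ⟨y, hy, rfl⟩, rfl⟩, hxy⟩ := Submodule.mem_sup.mp hv
  have e : v = x + act m (h * s * g⁻¹).1 y := by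
    rw [← act_inv_act g v, ← hxy, map_add]
    refine congrArg₂ (· + ·) (act_inv_act g x) ?_
    exact ((act_mul _ _ y).trans (congrArg _ (act_mul _ _ y))).symm
  rw [e]
  exact Submodule.add_mem_sup hx (Submodule.mem_map_of_mem hy)

/-- The generic `2 × 2` matrix, with the polynomial variables as entries. -/
def genericMatrix (k : Type*) [Field k] :
    Matrix (Fin 2) (Fin 2) (MvPolynomial (Fin 2 × Fin 2) k) :=
  Matrix.of fun i j => MvPolynomial.X (i, j)

/-- The action of the generic matrix specializes to that of every matrix. -/
lemma eval_act_genericMatrix {m : ℕ} (g : Matrix (Fin 2) (Fin 2) k) (v : Fin (m + 1) → k)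
    (j : Fin (m + 1)) :
    MvPolynomial.eval (fun ij => g ij.1 ij.2)
      (act m (genericMatrix k) (fun l => MvPolynomial.C (v l)) j) = act m g v j := by
  have h1 : (genericMatrix k).map (MvPolynomial.eval fun ij => g ij.1 ij.2) = g := by
    ext a b
    exact MvPolynomial.eval_X _
  have h2 : (MvPolynomial.eval fun ij : Fin 2 × Fin 2 => g ij.1 ij.2) ∘
      (fun l => MvPolynomial.C (v l)) = v := by
    ext l
    exact MvPolynomial.eval_C _
  have h := map_act (MvPolynomial.eval fun ij : Fin 2 × Fin 2 => g ij.1 ij.2) (genericMatrix k)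
    (fun l => MvPolynomial.C (v l)) j
  rwa [h1, h2] at h

lemma span_range_sumElim {m : ℕ} (A B : Submodule k (Fin (m + 1) → k))
    {ι κ : Type*} (bA : Module.Basis ι k A) (bB : Module.Basis κ k B)
    (T : (Fin (m + 1) → k) →ₗ[k] (Fin (m + 1) → k)) :
    Submodule.span k (Set.range (Sum.elim (fun i => (bA i : Fin (m + 1) → k))
      fun i => T (bB i))) = A ⊔ B.map T := by
  have h1 : Submodule.span k (Set.range fun i => (bA i : Fin (m + 1) → k)) = A := by
    have := congrArg (Submodule.map A.subtype) bA.span_eq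
    rwa [Submodule.map_span, ← Set.range_comp, Submodule.map_top, Submodule.range_subtype] at this
  have h2 : Submodule.span k (Set.range fun i => (bB i : Fin (m + 1) → k)) = B := by
    have := congrArg (Submodule.map B.subtype) bB.span_eq
    rwa [Submodule.map_span, ← Set.range_comp, Submodule.map_top, Submodule.range_subtype] at this
  have h3 : Submodule.span k (Set.range fun i => T (bB i)) = B.map T := by
    conv_rhs => rw [← h2, Submodule.map_span, ← Set.range_comp]
    rfl
  rw [Set.Sum.elim_range, Submodule.span_union, h1, h3]

/-- A polynomial in the matrix entries whose nonvanishing at `g` forces `A + g B` to be the space of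
all forms. -/
lemma exists_polynomial_sup_eq_top [Infinite k] {m : ℕ}
    (hchar : ∀ i : ℕ, 0 < i → i ≤ m → (i : k) ≠ 0) (A B : Submodule k (Fin (m + 1) → k))
    (hAB : Module.finrank k A + Module.finrank k B = m + 1) :
    ∃ F : MvPolynomial (Fin 2 × Fin 2) k, F ≠ 0 ∧ ∀ g : Matrix (Fin 2) (Fin 2) k,
      MvPolynomial.eval (fun ij => g ij.1 ij.2) F ≠ 0 → A ⊔ B.map (act m g) = ⊤ := by
  let bA := Module.finBasis k A
  let bB := Module.finBasis k B
  let ε : Fin (m + 1) ≃ Fin (Module.finrank k A) ⊕ Fin (Module.finrank k B) :=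
    (finCongr hAB.symm).trans finSumFinEquiv.symm
  -- bases of `A` and of `g B`, and their analogue for the generic matrix
  let row : Matrix (Fin 2) (Fin 2) k → Fin (Module.finrank k A) ⊕ Fin (Module.finrank k B) →
      Fin (m + 1) → k := fun g => Sum.elim (fun i => bA i) fun i => act m g (bB i)
  have hspan : ∀ g, Submodule.span k (Set.range fun i => row g (ε i)) = A ⊔ B.map (act m g) :=
    fun g => by
      rw [← span_range_sumElim A B bA bB (act m g), ← ε.surjective.range_comp]
      rfl
  let genericRow : Fin (Module.finrank k A) ⊕ Fin (Module.finrank k B) →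
      Fin (m + 1) → MvPolynomial (Fin 2 × Fin 2) k :=
    Sum.elim (fun i j => MvPolynomial.C ((bA i : Fin (m + 1) → k) j))
      fun i => act m (genericMatrix k) fun l => MvPolynomial.C ((bB i : Fin (m + 1) → k) l)
  have heval : ∀ g i j, MvPolynomial.eval (fun ij => g ij.1 ij.2) (genericRow i j) = row g i j := by
    rintro g (i | i) j
    · exact MvPolynomial.eval_C _
    · exact eval_act_genericMatrix g _ j
  clear_value row genericRow
  let N : Matrix (Fin (m + 1)) (Fin (m + 1)) (MvPolynomial (Fin 2 × Fin 2) k) :=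
    Matrix.of fun i => genericRow (ε i)
  have hdet : ∀ g : Matrix (Fin 2) (Fin 2) k, MvPolynomial.eval (fun ij => g ij.1 ij.2) N.det =
      (Matrix.of fun i => row g (ε i)).det := fun g => by
    rw [RingHom.map_det]
    congr 1
    ext i j
    exact heval g (ε i) j
  refine ⟨N.det, fun h0 => ?_, fun g hg => ?_⟩
  · obtain ⟨g, hg⟩ := exists_sup_map_act_eq_top hchar A B hAB
    have h := hdet g.1
    rw [h0, map_zero] at h
    rw [← hspan] at hg
    have hli := linearIndependent_of_top_le_span_of_card_eq_finrank hg.ge (by simp)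
    have hu : IsUnit (Matrix.of fun i => row g.1 (ε i)) :=
      Matrix.linearIndependent_rows_iff_isUnit.mp hli
    exact ((Matrix.isUnit_iff_isUnit_det _).mp hu).ne_zero h.symm
  · rw [hdet] at hg
    rw [← hspan]
    exact span_rows_eq_top hg

/-- Two subspaces are in general position after a general substitution, provided that `m!` is
invertible: `B` may be shrunk or enlarged to a space of dimension complementary to that of `A`. -/
lemma exists_polynomial_transverse {k : Type u} [Field k] [Infinite k] {m : ℕ}
    (hchar : ∀ i : ℕ, 0 < i → i ≤ m → (i : k) ≠ 0) (A B : Submodule k (Fin (m + 1) → k)) :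
    ∃ F : MvPolynomial (Fin 2 × Fin 2) k, F ≠ 0 ∧ ∀ g : GL (Fin 2) k,
      MvPolynomial.eval (fun ij => g.1 ij.1 ij.2) F ≠ 0 → Transverse A (B.map (act m g.1)) := by
  have hA : Module.finrank k A ≤ m + 1 := by simpa using A.finrank_le
  rcases le_total (m + 1 - Module.finrank k A) (Module.finrank k B) with hB | hB
  · obtain ⟨B', hB', hfin⟩ := exists_submodule_le_finrank_eq hB
    obtain ⟨F, hF, h⟩ := exists_polynomial_sup_eq_top hchar A B' (by omega)
    exact ⟨F, hF, fun g hg => Or.inr (top_le_iff.mp ((h g.1 hg).ge.trans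
      (sup_le_sup_left (Submodule.map_mono hB') A)))⟩
  · obtain ⟨B', hB', hfin⟩ := exists_le_submodule_finrank_eq B hB (by simp)
    obtain ⟨F, hF, h⟩ := exists_polynomial_sup_eq_top hchar A B' (by omega)
    refine ⟨F, hF, fun g hg => Or.inl ?_⟩
    have h1 := Submodule.finrank_sup_add_finrank_inf_eq A (B'.map (actEquiv m g).toLinearMap)
    have h2 : A ⊔ B'.map (actEquiv m g).toLinearMap = ⊤ := h g.1 hg
    rw [h2, LinearEquiv.finrank_map_eq, finrank_top, Module.finrank_fin_fun] at h1
    have h3 : A ⊓ B'.map (actEquiv m g).toLinearMap = ⊥ :=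
      Submodule.finrank_eq_zero.mp (by omega)
    exact le_bot_iff.mp ((inf_le_inf_left A (Submodule.map_mono hB')).trans h3.le)

end BinaryForms

/-! ### Pullback and localization of Kähler differentials -/

section Rings

variable {k : Type u} [CommRing k] {A B A' B' A'' B'' : Type u} [CommRing A] [CommRing B]
  [CommRing A'] [CommRing B'] [CommRing A''] [CommRing B''] [Algebra k A] [Algebra k B]
  [Algebra k A'] [Algebra k B'] [Algebra k A''] [Algebra k B'']

lemma forms_induction {P : Ω[B⁄k] → Prop} (zero : P 0) (add : ∀ x y, P x → P y → P (x + y))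
    (smul : ∀ b c : B, P (b • KaehlerDifferential.D k B c)) (x : Ω[B⁄k]) : P x := by
  have hx : x ∈ Submodule.span B (Set.range (KaehlerDifferential.D k B)) := by
    rw [KaehlerDifferential.span_range_derivation]
    trivial
  induction hx using Submodule.closure_induction with
  | zero => exact zero
  | add x y _ _ hx hy => exact add x y hx hy
  | smul_mem b x h =>
    obtain ⟨c, rfl⟩ := h
    exact smul b c

namespace PulledForms

lemma tmul_add (φ : A →ₐ[k] B) (b : B) (ω η : Ω[A⁄k]) :
    tmul φ b (ω + η) = tmul φ b ω + tmul φ b η :=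
  letI := φ.toRingHom.toAlgebra
  TensorProduct.tmul_add b ω η

lemma tmul_zero (φ : A →ₐ[k] B) (b : B) : tmul φ b 0 = 0 :=
  letI := φ.toRingHom.toAlgebra
  TensorProduct.tmul_zero _ b

lemma tmul_smul (φ : A →ₐ[k] B) (b : B) (a : A) (ω : Ω[A⁄k]) :
    tmul φ b (a • ω) = tmul φ (b * φ a) ω := by
  let := φ.toRingHom.toAlgebra
  refine (TensorProduct.smul_tmul (R := A) (R' := A) a b ω).symm.trans ?_
  rw [Algebra.smul_def, mul_comm]
  rfl

lemma induction_on {φ : A →ₐ[k] B} {P : PulledForms φ → Prop} (zero : P 0)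
    (add : ∀ x y, P x → P y → P (x + y))
    (tmul : ∀ b a, P (tmul φ b (KaehlerDifferential.D k A a))) (x : PulledForms φ) : P x := by
  let := φ.toRingHom.toAlgebra
  refine TensorProduct.induction_on (R := A) (M := B) (N := Ω[A⁄k]) (motive := P) x zero
    (fun b ω => ?_) add
  change P (PulledForms.tmul φ b ω)
  induction ω using forms_induction with
  | zero => rw [tmul_zero]; exact zero
  | add x y hx hy => rw [tmul_add]; exact add _ _ hx hy
  | smul c a => rw [tmul_smul]; exact tmul _ _

lemma restrict_restrict (φ : A →ₐ[k] B) (ψ : A' →ₐ[k] B') (χ : A'' →ₐ[k] B'')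
    (α : A →ₐ[k] A') (β : B →ₐ[k] B') (comm : β.comp φ = ψ.comp α)
    (α' : A' →ₐ[k] A'') (β' : B' →ₐ[k] B'') (comm' : β'.comp ψ = χ.comp α')
    (α'' : A →ₐ[k] A'') (β'' : B →ₐ[k] B'') (comm'' : β''.comp φ = χ.comp α'')
    (hα : ∀ a, α' (α a) = α'' a) (hβ : ∀ b, β' (β b) = β'' b) (x : PulledForms φ) :
    restrict ψ χ α' β' comm' (restrict φ ψ α β comm x) = restrict φ χ α'' β'' comm'' x := by
  induction x using induction_on with
  | zero => simp only [map_zero]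
  | add x y hx hy => simp only [map_add, hx, hy]
  | tmul b a => rw [restrict_tmul, restrict_tmul, restrict_tmul, hα, hβ]

lemma restrict_self (φ : A →ₐ[k] B) (α : A →ₐ[k] A) (β : B →ₐ[k] B)
    (comm : β.comp φ = φ.comp α) (hα : ∀ a, α a = a) (hβ : ∀ b, β b = b) (x : PulledForms φ) :
    restrict φ φ α β comm x = x := by
  induction x using induction_on with
  | zero => simp only [map_zero]
  | add x y hx hy => simp only [map_add, hx, hy]
  | tmul b a => rw [restrict_tmul, hα, hβ]

/-- The codifferential commutes with restriction. -/
lemma codiff_restrict (φ : A →ₐ[k] B) (ψ : A' →ₐ[k] B') (α : A →ₐ[k] A') (β : B →ₐ[k] B')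
    (comm : β.comp φ = ψ.comp α) (x : PulledForms φ) :
    codiff ψ (restrict φ ψ α β comm x) = restrictForms β (codiff φ x) := by
  induction x using induction_on with
  | zero => simp only [map_zero]
  | add x y hx hy => simp only [map_add, hx, hy]
  | tmul b a =>
    rw [restrict_tmul, codiff_tmul, codiff_tmul, map_smulₛₗ, restrictForms_D]
    exact congrArg (fun z => β b • KaehlerDifferential.D k B' z) (DFunLike.congr_fun comm a).symm

/-- For an unramified algebra, the codifferential is surjective as `Ω_{B/A} = 0`. -/
lemma codiff_surjective (φ : A →ₐ[k] B) (hφ : φ.toRingHom.FormallyUnramified) :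
    Function.Surjective (codiff φ) := by
  let := φ.toRingHom.toAlgebra
  have : IsScalarTower k A B := IsScalarTower.of_algebraMap_eq' φ.comp_algebraMap.symm
  have : Algebra.FormallyUnramified A B := hφ
  exact fun x => (KaehlerDifferential.exact_mapBaseChange_map k A B x).mp (Subsingleton.elim _ _)

/-- If `A'` is formally étale over `A` and `B'` is the localization of `B` at `g`, then
`B' ⊗_{A'} Ω_{A'/k}` is the localization of `B ⊗_A Ω_{A/k}` at `g`, because
`Ω_{A'/k} = A' ⊗_A Ω_{A/k}`. -/
lemma restrict_localization (φ : A →ₐ[k] B) (ψ : A' →ₐ[k] B') (α : A →ₐ[k] A') (β : B →ₐ[k] B')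
    (comm : β.comp φ = ψ.comp α) (g : B) (hα : α.toRingHom.FormallyEtale)
    (hβ : letI := β.toRingHom.toAlgebra; IsLocalization.Away g B') :
    (∀ x, restrict φ ψ α β comm x = 0 → ∃ n : ℕ, g ^ n • x = 0) ∧
      ∀ y, ∃ (n : ℕ) (x : PulledForms φ), restrict φ ψ α β comm x = β g ^ n • y := by
  let := φ.toRingHom.toAlgebra
  let := ψ.toRingHom.toAlgebra
  let := α.toRingHom.toAlgebra
  let := β.toRingHom.toAlgebra
  let := (ψ.comp α).toRingHom.toAlgebra
  have : IsScalarTower A A' B' := IsScalarTower.of_algebraMap_eq' rfl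
  have : IsScalarTower A B B' :=
    IsScalarTower.of_algebraMap_eq' (congrArg (fun f : A →ₐ[k] B' => f.toRingHom) comm).symm
  have : IsScalarTower k A A' := IsScalarTower.of_algebraMap_eq' α.comp_algebraMap.symm
  have : Algebra.FormallyEtale A A' := hα
  let l : B ⊗[A] Ω[A⁄k] →ₗ[B] B' ⊗[A'] Ω[A'⁄k] :=
    LinearMap.liftBaseChange B
      (((TensorProduct.mk A' B' Ω[A'⁄k] 1).restrictScalars A).comp
        (KaehlerDifferential.map k k A A'))
  have h1 : IsBaseChange A' (KaehlerDifferential.map k k A A') :=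
    KaehlerDifferential.isBaseChange_of_formallyEtale k A A'
  have h2 : IsBaseChange B' (TensorProduct.mk A' B' Ω[A'⁄k] 1) :=
    TensorProduct.isBaseChange A' Ω[A'⁄k] B'
  have h3 : IsBaseChange B (TensorProduct.mk A B Ω[A⁄k] 1) :=
    TensorProduct.isBaseChange A Ω[A⁄k] B
  have h4 : IsBaseChange B' l := by
    refine IsBaseChange.of_comp h3 ?_
    convert h1.comp h2 using 1
    ext x
    simp [l]
  have : IsLocalization.Away g B' := hβ
  have h5 : IsLocalizedModule (.powers g) l :=
    (isLocalizedModule_iff_isBaseChange (.powers g) B' l).mpr h4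
  constructor
  · intro x hx
    have hx' : @Eq (B' ⊗[A'] Ω[A'⁄k]) (l x) 0 := hx
    obtain ⟨⟨_, n, rfl⟩, h⟩ := (IsLocalizedModule.eq_zero_iff (.powers g) l).mp hx'
    exact ⟨n, h⟩
  · intro y
    have hs := IsLocalizedModule.surj (.powers g) l (show B' ⊗[A'] Ω[A'⁄k] from y)
    obtain ⟨⟨x, ⟨_, n, rfl⟩⟩, h⟩ := hs
    refine ⟨n, x, h.symm.trans ?_⟩
    exact (algebraMap_smul B' (g ^ n) (show B' ⊗[A'] Ω[A'⁄k] from y)).symm.trans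
      (congrArg (fun c : B' => c • y) (map_pow β g n))

end PulledForms

lemma restrictForms_restrictForms (β : B →ₐ[k] B') (β' : B' →ₐ[k] B'') (β'' : B →ₐ[k] B'')
    (hβ : ∀ b, β' (β b) = β'' b) (x : Ω[B⁄k]) :
    restrictForms β' (restrictForms β x) = restrictForms β'' x := by
  induction x using forms_induction with
  | zero => simp only [map_zero]
  | add x y hx hy => simp only [map_add, hx, hy]
  | smul b c =>
    rw [map_smulₛₗ, map_smulₛₗ, map_smulₛₗ, restrictForms_D, restrictForms_D, restrictForms_D, hβ]
    exact congrArg (· • _) (hβ b)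

/-- A form that vanishes on the localization at `g` is killed by a power of `g`. -/
lemma restrictForms_localization (β : B →ₐ[k] B') (g : B)
    (hβ : letI := β.toRingHom.toAlgebra; IsLocalization.Away g B') (x : Ω[B⁄k])
    (hx : restrictForms β x = 0) : ∃ n : ℕ, g ^ n • x = 0 := by
  let := β.toRingHom.toAlgebra
  have : IsScalarTower k B B' := IsScalarTower.of_algebraMap_eq' β.comp_algebraMap.symm
  have : IsLocalization.Away g B' := hβ
  have h5 : IsLocalizedModule (.powers g) (KaehlerDifferential.map k k B B') := inferInstance
  obtain ⟨⟨_, n, rfl⟩, h⟩ := (IsLocalizedModule.eq_zero_iff (.powers g) _).mp hx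
  exact ⟨n, h⟩

end Rings

/-! ### Restriction and gluing on affine pairs -/

section Sheaf

variable {k : Type u} [Field k] {X Y : Over (Spec (.of k))}

@[simp] lemma res_res {U V W : X.left.Opens} (h : U ≤ V) (h' : V ≤ W) (a : Γ(X.left, W)) :
    res X h (res X h' a) = res X (h.trans h') a :=
  (congrArg (fun g => g.hom a)
    (X.left.presheaf.map_comp (homOfLE h').op (homOfLE h).op)).symm

@[simp] lemma res_self {U : X.left.Opens} (h : U ≤ U) (a : Γ(X.left, U)) : res X h a = a :=
  congrArg (fun g => g.hom a) (X.left.presheaf.map_id (Opposite.op U))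

lemma basicOpen_res {U V : X.left.Opens} (h : U ≤ V) (a : Γ(X.left, V)) :
    X.left.basicOpen (res X h a) = U ⊓ X.left.basicOpen a :=
  X.left.basicOpen_res a (homOfLE h).op

lemma isUnit_res_of_eq {U V : X.left.Opens} (a : Γ(X.left, V)) (h : U ≤ V)
    (hU : U = X.left.basicOpen a) : IsUnit (res X h a) := by
  subst hU
  exact X.left.toRingedSpace.isUnit_res_basicOpen a

/-- Restriction between affine opens is étale, even if the smaller one is not a basic open. -/
lemma res_formallyEtale {U V : X.left.Opens} (h : U ≤ V) (hU : IsAffineOpen U)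
    (hV : IsAffineOpen V) : (res X h).toRingHom.FormallyEtale := by
  have h1 : ((𝟙 X.left : X.left ⟶ X.left).appLE V U h).hom.Etale :=
    Scheme.Hom.etale_appLE (𝟙 X.left) hV hU h
  have h2 : (𝟙 X.left : X.left ⟶ X.left).appLE V U h = X.left.presheaf.map (homOfLE h).op := by
    simp only [Scheme.Hom.appLE, Scheme.Hom.id_app]
    exact Category.id_comp _
  rw [h2] at h1
  exact h1.toAlgebra.formallyEtale

lemma res_isLocalization {U V : X.left.Opens} (hV : IsAffineOpen V) (a : Γ(X.left, V)) (h : U ≤ V)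
    (hU : U = X.left.basicOpen a) :
    letI := (res X h).toRingHom.toAlgebra
    IsLocalization.Away a Γ(X.left, U) := by
  subst hU
  exact hV.isLocalization_basicOpen a

/-- In a separated scheme, the intersection of two affine opens is affine. -/
lemma isAffineOpen_inf [IsSeparated X.hom] {U V : X.left.Opens} (hU : IsAffineOpen U)
    (hV : IsAffineOpen V) : IsAffineOpen (U ⊓ V) :=
  isAffineHom_diagonal_iff.mp (inferInstance : IsAffineHom (Limits.pullback.diagonal X.hom)) ⊤
    (isAffineOpen_top _) U le_top V le_top hU hV

/-- If `P` is inherited by smaller opens and holds locally on an affine open `U`, then the functions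
`g` for which `P` holds on `D(g)` generate the unit ideal. This is the form in which local
properties are used. -/
lemma span_basicOpen_eq_top {U : Y.left.Opens} (hU : IsAffineOpen U) (P : Y.left.Opens → Prop)
    (hP : ∀ U' V' : Y.left.Opens, U' ≤ V' → P V' → P U')
    (h : ∀ y ∈ U, ∃ U' : Y.left.Opens, y ∈ U' ∧ P U') :
    Ideal.span {g : Γ(Y.left, U) | P (Y.left.basicOpen g)} = ⊤ := by
  rw [← hU.self_le_iSup_basicOpen_iff]
  intro y hy
  obtain ⟨U', hyU', hPU'⟩ := h y hy
  obtain ⟨g, hg, hyg⟩ := hU.exists_basicOpen_le ⟨y, hyU'⟩ hy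
  exact TopologicalSpace.Opens.mem_iSup.mpr ⟨⟨g, hP _ _ hg hPU'⟩, hyg⟩

namespace AffinePair

variable {f : Y ⟶ X} {V V' : Y.left.Opens}

lemma restrict_restrict (p q r : AffinePair f V) (hU : q.U ≤ p.U) (hW : q.W ≤ p.W)
    (hU' : r.U ≤ q.U) (hW' : r.W ≤ q.W) (x : p.Forms) :
    q.restrict r hU' hW' (p.restrict q hU hW x) =
      p.restrict r (hU'.trans hU) (hW'.trans hW) x :=
  PulledForms.restrict_restrict _ _ _ _ _ _ _ _ _ _ _ _ (res_res hW' hW) (res_res hU' hU) x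

lemma restrict_self (p : AffinePair f V) (x : p.Forms) : p.restrict p le_rfl le_rfl x = x :=
  PulledForms.restrict_self _ _ _ _ (res_self _) (res_self _) x

lemma restrict_smul (p q : AffinePair f V) (hU : q.U ≤ p.U) (hW : q.W ≤ p.W)
    (b : Γ(Y.left, p.U)) (x : p.Forms) :
    p.restrict q hU hW (b • x) = res Y hU b • p.restrict q hU hW x :=
  map_smulₛₗ _ _ _

/-- `(f^* Ω_{X/k})(D(g))` is the localization of `(f^* Ω_{X/k})(U)` at `g`. -/
lemma restrict_localization (p q : AffinePair f V) (hU : q.U ≤ p.U) (hW : q.W ≤ p.W)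
    (g : Γ(Y.left, p.U)) (hg : q.U = Y.left.basicOpen g) :
    (∀ x, p.restrict q hU hW x = 0 → ∃ n : ℕ, g ^ n • x = 0) ∧
      ∀ y, ∃ (n : ℕ) (x : p.Forms), p.restrict q hU hW x = res Y hU g ^ n • y :=
  PulledForms.restrict_localization _ _ _ _ _ g (res_formallyEtale hW q.affine_W p.affine_W)
    (res_isLocalization p.affine_U g hU hg)

/-- The module `(f^* Ω_{X/k})(U)` does not depend on the affine open `W` of the target. -/
lemma restrict_bijective (p q : AffinePair f V) (hU : q.U ≤ p.U) (hW : q.W ≤ p.W)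
    (hU' : p.U = q.U) : Function.Bijective (p.restrict q hU hW) := by
  obtain ⟨h1, h2⟩ := p.restrict_localization q hU hW 1
    (hU'.symm.trans (Y.left.basicOpen_of_isUnit isUnit_one).symm)
  refine ⟨(injective_iff_map_eq_zero _).mpr fun x hx => ?_, fun y => ?_⟩
  · obtain ⟨n, hn⟩ := h1 x hx
    rwa [one_pow, one_smul] at hn
  · obtain ⟨n, x, hx⟩ := h2 y
    rw [map_one, one_pow, one_smul] at hx
    exact ⟨x, hx⟩

/-- The pair of the basic open `D(g)` of the source and the same affine open of the target. -/
def basic (p : AffinePair f V) (g : Γ(Y.left, p.U)) : AffinePair f V where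
  U := Y.left.basicOpen g
  W := p.W
  affine_U := p.affine_U.basicOpen g
  affine_W := p.affine_W
  le := (Y.left.basicOpen_le g).trans p.le
  le_preimage := (Y.left.basicOpen_le g).trans p.le_preimage

lemma basic_le (p : AffinePair f V) (g : Γ(Y.left, p.U)) : (p.basic g).U ≤ p.U :=
  Y.left.basicOpen_le g

lemma basic_W_le (p : AffinePair f V) (g : Γ(Y.left, p.U)) : (p.basic g).W ≤ p.W :=
  le_rfl

/-- The affine pair with prescribed opens. The given pair only serves to fix `f`. -/
def shrink (_ : AffinePair f V) (U : Y.left.Opens) (W : X.left.Opens) (hU : IsAffineOpen U)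
    (hW : IsAffineOpen W) (h : U ≤ V') (h' : U ≤ f.left ⁻¹ᵁ W) : AffinePair f V' where
  U := U
  W := W
  affine_U := hU
  affine_W := hW
  le := h
  le_preimage := h'

/-- The annihilator of `x` contains a power of each `g ∈ S`, hence the unit ideal. -/
lemma eq_zero_of_span (p : AffinePair f V) (x : p.Forms) (S : Set Γ(Y.left, p.U))
    (hS : Ideal.span S = ⊤) (h : ∀ g ∈ S, ∃ n : ℕ, g ^ n • x = 0) : x = 0 := by
  let I : Ideal Γ(Y.left, p.U) := LinearMap.ker (LinearMap.toSpanSingleton Γ(Y.left, p.U) p.Forms x)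
  have hI : I.radical = ⊤ := by
    rw [eq_top_iff, ← hS, Ideal.span_le]
    intro g hg
    obtain ⟨n, hn⟩ := h g hg
    exact ⟨n, hn⟩
  rw [Ideal.radical_eq_top] at hI
  have h1 : (1 : Γ(Y.left, p.U)) ∈ I := hI ▸ trivial
  exact (one_smul _ x).symm.trans h1

/-- An element of `(f^* Ω_{X/k})(U)` that vanishes locally is zero. -/
lemma eq_zero_of_local (p : AffinePair f V) (x : p.Forms)
    (h : ∀ y ∈ p.U, ∃ (q : AffinePair f V) (hU : q.U ≤ p.U) (hW : q.W ≤ p.W), y ∈ q.U ∧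
      p.restrict q hU hW x = 0) : x = 0 := by
  refine p.eq_zero_of_span x _ (span_basicOpen_eq_top p.affine_U
    (fun U' => ∃ (q : AffinePair f V) (hU : q.U ≤ p.U) (hW : q.W ≤ p.W), U' ≤ q.U ∧
      p.restrict q hU hW x = 0) ?_ ?_) ?_
  · rintro U' V' hUV ⟨q, hU, hW, hV', hq⟩
    exact ⟨q, hU, hW, hUV.trans hV', hq⟩
  · intro y hy
    obtain ⟨q, hU, hW, hyq, hq⟩ := h y hy
    exact ⟨q.U, hyq, q, hU, hW, le_rfl, hq⟩
  · rintro g ⟨q, hU, hW, hgq, hq⟩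
    let r : AffinePair f V := q.shrink (Y.left.basicOpen g) q.W (p.affine_U.basicOpen g) q.affine_W
      (hgq.trans q.le) (hgq.trans q.le_preimage)
    refine (p.restrict_localization r (hgq.trans hU) hW g rfl).1 x ?_
    rw [← p.restrict_restrict q r hU hW hgq le_rfl, hq, map_zero]

lemma eq_of_local (p : AffinePair f V) (x x' : p.Forms)
    (h : ∀ y ∈ p.U, ∃ (q : AffinePair f V) (hU : q.U ≤ p.U) (hW : q.W ≤ p.W), y ∈ q.U ∧
      p.restrict q hU hW x = p.restrict q hU hW x') : x = x' := by
  rw [← sub_eq_zero]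
  refine p.eq_zero_of_local _ fun y hy => ?_
  obtain ⟨q, hU, hW, hyq, hq⟩ := h y hy
  exact ⟨q, hU, hW, hyq, by rw [map_sub, hq, sub_self]⟩

/-- Elements of `(f^* Ω_{X/k})(D(g_i))` that agree on the overlaps glue to an element of
`(f^* Ω_{X/k})(U)` if the `D(g_i)` cover `U`. -/
lemma exists_glue {ι : Type*} [Finite ι] (p : AffinePair f V) (g : ι → Γ(Y.left, p.U))
    (hg : Ideal.span (Set.range g) = ⊤) (q : ι → AffinePair f V) (hU : ∀ i, (q i).U ≤ p.U)
    (hqU : ∀ i, (q i).U = Y.left.basicOpen (g i)) (hW : ∀ i, (q i).W = p.W)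
    (x : ∀ i, (q i).Forms)
    (hx : ∀ (i j : ι) (r : AffinePair f V) (hi : r.U ≤ (q i).U) (hj : r.U ≤ (q j).U)
      (hi' : r.W ≤ (q i).W) (hj' : r.W ≤ (q j).W),
      (q i).restrict r hi hi' (x i) = (q j).restrict r hj hj' (x j)) :
    ∃ y : p.Forms, ∀ i, p.restrict (q i) (hU i) (hW i).le y = x i := by
  cases nonempty_fintype ι
  -- `x i = z i / g i ^ n` with an exponent `n` independent of `i`
  have hloc := fun i => p.restrict_localization (q i) (hU _) (hW _).le
    (g i) (hqU i)
  choose n₀ z₀ hz₀ using fun i => (hloc i).2 (x i)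
  obtain ⟨n, z, hz⟩ : ∃ (n : ℕ) (z : ι → p.Forms), ∀ i,
      p.restrict (q i) (hU _) (hW _).le (z i) =
        res Y (hU i) (g i) ^ n • x i := by
    refine ⟨Finset.univ.sup n₀, fun i => g i ^ (Finset.univ.sup n₀ - n₀ i) • z₀ i, fun i => ?_⟩
    dsimp only
    rw [restrict_smul, hz₀, map_pow, smul_smul, ← pow_add, Nat.sub_add_cancel
      (Finset.le_sup (f := n₀) (Finset.mem_univ i))]
  -- agreement on `D(g i) ∩ D(g j)` means agreement on `U` up to powers of `g i * g j`
  have hN : ∀ i j, ∃ N : ℕ, (g i * g j) ^ N • (g j ^ n • z i - g i ^ n • z j) = 0 := by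
    intro i j
    obtain ⟨r, hrU, hrg, hrW, hru⟩ : ∃ r : AffinePair f V,
        r.U = (q i).U ⊓ (q j).U ∧ r.U = Y.left.basicOpen (g i * g j) ∧
          r.W = p.W ∧ r.U ≤ p.U :=
      ⟨p.basic (g i * g j), by rw [hqU, hqU]; exact Y.left.basicOpen_mul _ _, rfl, rfl,
        p.basic_le _⟩
    have hri := hrU.le.trans inf_le_left
    have hrj := hrU.le.trans inf_le_right
    have hri' : r.W ≤ (q i).W := (hrW.trans (hW i).symm).le
    have hrj' : r.W ≤ (q j).W := (hrW.trans (hW j).symm).le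
    refine (p.restrict_localization r hru hrW.le (g i * g j) hrg).1 _ ?_
    rw [map_sub, sub_eq_zero, restrict_smul, restrict_smul,
      ← p.restrict_restrict (q i) r (hU _) (hW _).le hri hri',
      ← p.restrict_restrict (q j) r (hU _) (hW _).le hrj hrj',
      hz, hz, restrict_smul, restrict_smul, hx i j r hri hrj hri' hrj', map_pow, map_pow, map_pow,
      map_pow, res_res, res_res, smul_smul, smul_smul, mul_comm]
  choose N₀ hN₀ using hN
  obtain ⟨N, hN⟩ : ∃ N : ℕ, ∀ i j, (g i * g j) ^ N • (g j ^ n • z i - g i ^ n • z j) = 0 := by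
    refine ⟨Finset.univ.sup fun ij : ι × ι => N₀ ij.1 ij.2, fun i j => ?_⟩
    rw [← Nat.sub_add_cancel (Finset.le_sup (f := fun ij : ι × ι => N₀ ij.1 ij.2)
      (Finset.mem_univ (i, j))), pow_add, mul_smul, hN₀, smul_zero]
  -- glue by means of a partition of unity `∑ a j * g j ^ (n + N) = 1`
  have hsp : Ideal.span (Set.range fun i => g i ^ (n + N)) = ⊤ := by
    have := Ideal.span_pow_eq_top _ hg (n + N)
    rwa [← Set.range_comp] at this
  have h1 : (1 : Γ(Y.left, p.U)) ∈ Ideal.span (Set.range fun i => g i ^ (n + N)) := hsp ▸ trivial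
  obtain ⟨a, ha⟩ := (Ideal.mem_span_range_iff_exists_fun).mp h1
  refine ⟨∑ j, (a j * g j ^ N) • z j, fun i => ?_⟩
  have hy : g i ^ (n + N) • ∑ j, (a j * g j ^ N) • z j = g i ^ N • z i := by
    calc g i ^ (n + N) • ∑ j, (a j * g j ^ N) • z j
        = ∑ j, (a j * g j ^ (n + N)) • g i ^ N • z i := by
          rw [Finset.smul_sum]
          refine Finset.sum_congr rfl fun j _ => ?_
          have h := hN i j
          rw [smul_sub, sub_eq_zero, smul_smul, smul_smul] at h
          rw [smul_smul, smul_smul,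
            show g i ^ (n + N) * (a j * g j ^ N) = a j * ((g i * g j) ^ N * g i ^ n) by ring,
            mul_smul, ← h, smul_smul]
          congr 1
          ring
      _ = g i ^ N • z i := by rw [← Finset.sum_smul, ha, one_smul]
  have hu : IsUnit (res Y (hU i) (g i) ^ (n + N)) :=
    (isUnit_res_of_eq (g i) (hU i) (hqU i)).pow (n + N)
  refine hu.smul_left_cancel.mp ?_
  rw [← map_pow, ← restrict_smul, hy, restrict_smul, hz, map_pow, map_pow, smul_smul, ← pow_add,
    add_comm]

end AffinePair
end Sheaf

/-! ### Sections of the pulled back cotangent sheaf -/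

section Sections

variable {k : Type u} [Field k] {X Y : Over (Spec (.of k))} {f : Y ⟶ X} {V V' V'' : Y.left.Opens}

/-- The sections of `f^* Ω_{X/k}` over `V` form a module over `Γ(Y, V)`. -/
instance : Module Γ(Y.left, V) (pullbackCotangent f V) where
  smul b σ := ⟨fun p => res Y p.le b • σ.1 p, fun p q hU hW => by
    rw [p.restrict_smul q, res_res, σ.2 p q hU hW]⟩
  one_smul σ := Subtype.ext (funext fun p =>
    (congrArg (· • σ.1 p) (map_one (res Y p.le))).trans (one_smul _ _))
  mul_smul a b σ := Subtype.ext (funext fun p =>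
    (congrArg (· • σ.1 p) (map_mul (res Y p.le) a b)).trans (mul_smul _ _ _))
  smul_zero a := Subtype.ext (funext fun p => smul_zero (res Y p.le a))
  smul_add a σ τ := Subtype.ext (funext fun p => smul_add (res Y p.le a) (σ.1 p) (τ.1 p))
  add_smul a b σ := Subtype.ext (funext fun p =>
    (congrArg (· • σ.1 p) (map_add (res Y p.le) a b)).trans (add_smul _ _ _))
  zero_smul σ := Subtype.ext (funext fun p =>
    (congrArg (· • σ.1 p) (map_zero (res Y p.le))).trans (zero_smul _ _))

lemma section_smul_apply (b : Γ(Y.left, V)) (σ : pullbackCotangent f V) (p : AffinePair f V) :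
    (b • σ).1 p = res Y p.le b • σ.1 p := rfl

lemma restrictSection_apply (h : V ≤ V') (σ : pullbackCotangent f V') (p : AffinePair f V) :
    (restrictSection h σ).1 p = σ.1 (p.enlarge h) := rfl

lemma restrictSection_smul (h : V ≤ V') (b : Γ(Y.left, V')) (σ : pullbackCotangent f V') :
    restrictSection h (b • σ) = res Y h b • restrictSection h σ :=
  Subtype.ext (funext fun p =>
    congrArg (· • σ.1 (p.enlarge h)) (res_res p.le h b).symm)

@[simp] lemma restrictSection_restrictSection (h : V ≤ V') (h' : V' ≤ V'')
    (σ : pullbackCotangent f V'') :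
    restrictSection h (restrictSection h' σ) = restrictSection (h.trans h') σ := rfl

lemma restrictSection_res_pow_smul (h : V ≤ V') (h' : V' ≤ V'') (g : Γ(Y.left, V'')) (n : ℕ)
    (σ : pullbackCotangent f V') :
    restrictSection h (res Y h' g ^ n • σ) = res Y (h.trans h') g ^ n • restrictSection h σ := by
  rw [restrictSection_smul, map_pow, res_res]

lemma exists_affinePair (f : Y ⟶ X) (V : Y.left.Opens) (y : Y.left) (hy : y ∈ V) :
    ∃ p : AffinePair f V, y ∈ p.U := by
  obtain ⟨W, hW, hyW, -⟩ := TopologicalSpace.Opens.isBasis_iff_nbhd.mp X.left.isBasis_affineOpens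
    (show f.left y ∈ (⊤ : X.left.Opens) from trivial)
  obtain ⟨U, hU, hyU, hle⟩ := TopologicalSpace.Opens.isBasis_iff_nbhd.mp Y.left.isBasis_affineOpens
    (show y ∈ V ⊓ f.left ⁻¹ᵁ W from ⟨hy, hyW⟩)
  exact ⟨⟨U, W, hU, hW, hle.trans inf_le_left, hle.trans inf_le_right⟩, hyU⟩

lemma exists_finite_affinePair_cover (f : Y ⟶ X) (hV : IsAffineOpen V) :
    ∃ (T : Type u) (_ : Fintype T) (c : T → AffinePair f V), ∀ y ∈ V, ∃ i, y ∈ (c i).U := by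
  choose c hc using fun y : V => exists_affinePair f V y y.2
  obtain ⟨T, hT⟩ := hV.isCompact.elim_finite_subcover (fun y : V => ((c y).U : Set Y.left))
    (fun y => (c y).U.isOpen) (fun y hy => Set.mem_iUnion.mpr ⟨⟨y, hy⟩, hc ⟨y, hy⟩⟩)
  refine ⟨T, inferInstance, fun i => c i, fun y hy => ?_⟩
  obtain ⟨i, hi, hyi⟩ := Set.mem_iUnion₂.mp (hT hy)
  exact ⟨⟨i, hi⟩, hyi⟩

/-- Sections of `f^* Ω_{X/k}` that agree locally are equal. -/
lemma section_eq_of_local {ι : Type*} (U : ι → Y.left.Opens) (hU : ∀ i, U i ≤ V)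
    (hV : ∀ y ∈ V, ∃ i, y ∈ U i) (σ τ : pullbackCotangent f V)
    (h : ∀ i, restrictSection (hU i) σ = restrictSection (hU i) τ) : σ = τ := by
  refine Subtype.ext (funext fun p => p.eq_of_local _ _ fun y hy => ?_)
  obtain ⟨i, hi⟩ := hV y (p.le hy)
  obtain ⟨g, hg, hyg⟩ := p.affine_U.exists_basicOpen_le ⟨y, hi⟩ hy
  refine ⟨p.basic g, p.basic_le g, p.basic_W_le g, hyg, ?_⟩
  rw [σ.2 p (p.basic g), τ.2 p (p.basic g)]
  let q : AffinePair f (U i) := p.shrink (Y.left.basicOpen g) p.W (p.affine_U.basicOpen g)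
    p.affine_W hg ((p.basic_le g).trans p.le_preimage)
  exact congrArg (fun s => s.1 q) (h i)

/-- Sections of `f^* Ω_{X/k}` that agree on overlaps can be glued. -/
lemma exists_glue_section {ι : Type*} (U : ι → Y.left.Opens) (hU : ∀ i, U i ≤ V)
    (hV : ∀ y ∈ V, ∃ i, y ∈ U i) (σ : ∀ i, pullbackCotangent f (U i))
    (hσ : ∀ i j, restrictSection (inf_le_left : U i ⊓ U j ≤ U i) (σ i) =
      restrictSection inf_le_right (σ j)) :
    ∃ τ : pullbackCotangent f V, ∀ i, restrictSection (hU i) τ = σ i := by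
  -- the value at `p` is determined by its restrictions to smaller pairs inside some `U i`
  have hcompat : ∀ (r : AffinePair f V) (i j : ι) (hi : r.U ≤ U i) (hj : r.U ≤ U j),
      (σ i).1 (r.shrink r.U r.W r.affine_U r.affine_W hi r.le_preimage) =
        (σ j).1 (r.shrink r.U r.W r.affine_U r.affine_W hj r.le_preimage) := fun r i j hi hj =>
    congrArg (fun s => s.1 (r.shrink r.U r.W r.affine_U r.affine_W (le_inf hi hj) r.le_preimage))
      (hσ i j)
  have hrestr : ∀ (q r : AffinePair f V) (hU' : r.U ≤ q.U) (hW' : r.W ≤ q.W) (i : ι)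
      (hi : q.U ≤ U i), q.restrict r hU' hW'
        ((σ i).1 (q.shrink q.U q.W q.affine_U q.affine_W hi q.le_preimage)) =
        (σ i).1 (r.shrink r.U r.W r.affine_U r.affine_W (hU'.trans hi) r.le_preimage) :=
    fun q r hU' hW' i hi => (σ i).2 (q.shrink q.U q.W q.affine_U q.affine_W hi q.le_preimage)
      (r.shrink r.U r.W r.affine_U r.affine_W (hU'.trans hi) r.le_preimage) hU' hW'
  have key : ∀ p : AffinePair f V, ∃ x : p.Forms, ∀ (q : AffinePair f V) (hqU : q.U ≤ p.U)
      (hqW : q.W ≤ p.W) (i : ι) (hi : q.U ≤ U i), p.restrict q hqU hqW x =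
        (σ i).1 (q.shrink q.U q.W q.affine_U q.affine_W hi q.le_preimage) := by
    intro p
    have hspan := span_basicOpen_eq_top p.affine_U (fun U' => ∃ i, U' ≤ U i)
      (fun U' V' h ⟨i, hi⟩ => ⟨i, h.trans hi⟩) (fun y hy => by
        obtain ⟨i, hi⟩ := hV y (p.le hy)
        exact ⟨U i, hi, i, le_rfl⟩)
    obtain ⟨S, hS, hS'⟩ := (Ideal.span_eq_top_iff_finite _).mp hspan
    choose i hi using fun g : S => hS g.2
    obtain ⟨x, hx⟩ := p.exists_glue (fun g : S => (g : Γ(Y.left, p.U))) (by simpa using hS')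
      (fun g => p.basic g) (fun g => p.basic_le _) (fun _ => rfl) (fun _ => rfl)
      (fun g => (σ (i g)).1 (p.shrink (Y.left.basicOpen g.1) p.W (p.affine_U.basicOpen g.1)
        p.affine_W (hi g) ((p.basic_le g.1).trans p.le_preimage)))
      (fun g g' r hg hg' hgW hgW' => by
        exact (hrestr (p.basic g) r hg hgW (i g) (hi g)).trans ((hcompat r (i g) (i g')
          (hg.trans (hi g)) (hg'.trans (hi g'))).trans
          (hrestr (p.basic g') r hg' hgW' (i g') (hi g')).symm))
    refine ⟨x, fun q hqU hqW j hj => ?_⟩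
    -- compare on the basic opens of `q` inside some `D(g)`
    refine q.eq_of_local _ _ fun y hy => ?_
    have hyS : y ∈ ⨆ g : (S : Set Γ(Y.left, p.U)), Y.left.basicOpen g.1 :=
      (p.affine_U.self_le_iSup_basicOpen_iff.mpr hS') (hqU hy)
    obtain ⟨g, hyg⟩ := TopologicalSpace.Opens.mem_iSup.mp hyS
    obtain ⟨h, hh, hyh⟩ := q.affine_U.exists_basicOpen_le ⟨y, hyg⟩ hy
    have hle : (q.basic h).U ≤ (p.basic g.1).U := hh
    refine ⟨q.basic h, q.basic_le h, q.basic_W_le h, hyh, ?_⟩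
    rw [p.restrict_restrict, hrestr, ← p.restrict_restrict (p.basic g.1) (q.basic h)
      (p.basic_le _) (p.basic_W_le _) hle hqW, hx g]
    exact (hrestr (p.basic g.1) (q.basic h) hle hqW _ (hi g)).trans (hcompat _ _ _ _ _)
  choose x hx using key
  refine ⟨⟨x, fun p q hqU hqW => ?_⟩, fun i => Subtype.ext (funext fun p => ?_)⟩
  · refine q.eq_of_local _ _ fun y hy => ?_
    obtain ⟨i, hi⟩ := hV y (q.le hy)
    obtain ⟨g, hg, hyg⟩ := q.affine_U.exists_basicOpen_le ⟨y, hi⟩ hy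
    refine ⟨q.basic g, q.basic_le g, q.basic_W_le g, hyg, ?_⟩
    rw [p.restrict_restrict, hx q _ _ _ i hg]
    exact hx p _ _ _ i hg
  · have h := hx (p.enlarge (hU i)) (p.enlarge (hU i)) le_rfl le_rfl i p.le
    rwa [AffinePair.restrict_self] at h

section Separated

variable [IsSeparated X.hom]

namespace AffinePair

/-- The pair of the smaller affine open of the source and the intersection of the two affine opens
of the target. -/
def inf (p q : AffinePair f V) (h : q.U ≤ p.U) : AffinePair f V :=
  q.shrink q.U (p.W ⊓ q.W) q.affine_U (isAffineOpen_inf p.affine_W q.affine_W) q.le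
    fun _ hy => ⟨p.le_preimage (h hy), q.le_preimage hy⟩

variable (p q : AffinePair f V) (h : q.U ≤ p.U)

lemma inf_U_le_left : (p.inf q h).U ≤ p.U := h

lemma inf_U_le_right : (p.inf q h).U ≤ q.U := le_rfl

lemma inf_W_le_left : (p.inf q h).W ≤ p.W := inf_le_left

lemma inf_W_le_right : (p.inf q h).W ≤ q.W := inf_le_right

end AffinePair

/-- A section over an affine open that maps into an affine open is determined by its value there. -/
lemma section_eq_of_apply_eq (p : AffinePair f V) (hp : p.U = V) (σ τ : pullbackCotangent f V)
    (h : σ.1 p = τ.1 p) : σ = τ := by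
  refine Subtype.ext (funext fun q => ?_)
  have hqp : q.U ≤ p.U := q.le.trans hp.ge
  refine (q.restrict_bijective (p.inf q hqp) (p.inf_U_le_right q hqp)
    (p.inf_W_le_right q hqp) rfl).1 ?_
  rw [σ.2 q, τ.2 q, ← σ.2 p (p.inf q hqp) hqp (p.inf_W_le_left q hqp),
    ← τ.2 p (p.inf q hqp) hqp (p.inf_W_le_left q hqp), h]

/-- Every element of `(f^* Ω_{X/k})(U)` comes from a section over `U`. -/
lemma exists_section_apply_eq (p : AffinePair f V) (hp : p.U = V) (x : p.Forms) :
    ∃ σ : pullbackCotangent f V, σ.1 p = x := by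
  have hle : ∀ q : AffinePair f V, q.U ≤ p.U := fun q => q.le.trans hp.ge
  -- the value at `q` is determined by that at the pair `p.inf q` with the same source
  have hbij : ∀ q : AffinePair f V, Function.Bijective (q.restrict (p.inf q (hle q))
      (p.inf_U_le_right q (hle q)) (p.inf_W_le_right q (hle q))) := fun q =>
    q.restrict_bijective _ _ _ rfl
  choose s hs using fun q : AffinePair f V => (hbij q).2
    (p.restrict (p.inf q (hle q)) (p.inf_U_le_left q (hle q)) (p.inf_W_le_left q (hle q)) x)
  refine ⟨⟨s, fun q q' hU hW => (hbij q').1 ?_⟩, (hbij p).1 (hs p)⟩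
  have hU' : (p.inf q' (hle q')).U ≤ (p.inf q (hle q)).U := hU
  have hW' : (p.inf q' (hle q')).W ≤ (p.inf q (hle q)).W := inf_le_inf_left _ hW
  rw [hs, q.restrict_restrict, ← q.restrict_restrict (p.inf q (hle q)) (p.inf q' (hle q'))
    (p.inf_U_le_right q (hle q)) (p.inf_W_le_right q (hle q)) hU' hW', hs, p.restrict_restrict]

/-- If `U` is an affine open that maps into an affine open, then the sections over `U ∩ D(g)` are
the localization at `g` of those over `U`. -/
lemma AffinePair.section_localization (c : AffinePair f V) (g : Γ(Y.left, V)) :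
    (∀ σ : pullbackCotangent f c.U,
      restrictSection (inf_le_left : c.U ⊓ Y.left.basicOpen g ≤ c.U) σ = 0 →
        ∃ n : ℕ, res Y c.le g ^ n • σ = 0) ∧
      ∀ σ : pullbackCotangent f (c.U ⊓ Y.left.basicOpen g),
        ∃ (n : ℕ) (τ : pullbackCotangent f c.U),
          restrictSection (inf_le_left : c.U ⊓ Y.left.basicOpen g ≤ c.U) τ =
            res Y (inf_le_left.trans c.le : c.U ⊓ Y.left.basicOpen g ≤ V) g ^ n • σ := by
  let p : AffinePair f c.U := c.shrink c.U c.W c.affine_U c.affine_W le_rfl c.le_preimage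
  have hq : c.U ⊓ Y.left.basicOpen g = Y.left.basicOpen (res Y c.le g) := (basicOpen_res _ _).symm
  let q : AffinePair f (c.U ⊓ Y.left.basicOpen g) := c.shrink _ c.W
    (hq ▸ c.affine_U.basicOpen _) c.affine_W le_rfl (inf_le_left.trans c.le_preimage)
  obtain ⟨h1, h2⟩ := p.restrict_localization (q.enlarge inf_le_left) inf_le_left le_rfl
      (res Y c.le g) hq
  constructor
  · intro σ hσ
    obtain ⟨n, hn⟩ := h1 (σ.1 p) ((σ.2 p (q.enlarge inf_le_left) inf_le_left le_rfl).trans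
      (congrArg (fun s => s.1 q) hσ))
    refine ⟨n, section_eq_of_apply_eq p rfl _ _ ?_⟩
    exact (congrArg (fun b : Γ(Y.left, p.U) => b • σ.1 p) (res_self le_rfl _)).trans hn
  · intro σ
    obtain ⟨n, x, hx⟩ := h2 (σ.1 q)
    obtain ⟨τ, hτ⟩ := exists_section_apply_eq p rfl x
    refine ⟨n, τ, section_eq_of_apply_eq q rfl _ _ ?_⟩
    rw [section_smul_apply, restrictSection_apply, ← τ.2 p (q.enlarge inf_le_left) inf_le_left
      le_rfl, hτ, hx]
    refine congrArg (fun b : Γ(Y.left, q.U) => b • σ.1 q) ?_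
    exact congrArg (· ^ n) (res_res _ _ g) |>.trans (res_self _ _).symm

/-- A section over `D(g)`, for an affine open `V` and `g ∈ Γ(Y, V)`, extends to `V` after
multiplication by a power of `g`. -/
lemma exists_pow_smul_extends [IsSeparated Y.hom] (hV : IsAffineOpen V) (g : Γ(Y.left, V))
    (σ : pullbackCotangent f (Y.left.basicOpen g)) :
    ∃ (n : ℕ) (τ : pullbackCotangent f V), restrictSection (Y.left.basicOpen_le g) τ =
      res Y (Y.left.basicOpen_le g) g ^ n • σ := by
  obtain ⟨T, hT, c, hcov⟩ := exists_finite_affinePair_cover f hV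
  -- the statement on the pieces of the cover
  choose n₀ τ₀ hτ₀ using fun i => ((c i).section_localization g).2 (restrictSection inf_le_right σ)
  obtain ⟨n, τ, hτ⟩ : ∃ (n : ℕ) (τ : ∀ i, pullbackCotangent f (c i).U), ∀ i,
      restrictSection (inf_le_left : (c i).U ⊓ Y.left.basicOpen g ≤ (c i).U) (τ i) =
        res Y (inf_le_left.trans (c i).le : (c i).U ⊓ Y.left.basicOpen g ≤ V) g ^ n •
          restrictSection inf_le_right σ := by
    refine ⟨Finset.univ.sup n₀, fun i => res Y (c i).le g ^ (Finset.univ.sup n₀ - n₀ i) • τ₀ i,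
      fun i => ?_⟩
    refine (restrictSection_res_pow_smul _ _ _ _ _).trans ?_
    rw [hτ₀, smul_smul, ← pow_add, Nat.sub_add_cancel
      (Finset.le_sup (f := n₀) (Finset.mem_univ i))]
  -- the pieces agree on overlaps after multiplication by a further power
  have hover : ∀ i j, ∃ N : ℕ,
      res Y (inf_le_left.trans (c i).le : (c i).U ⊓ (c j).U ≤ V) g ^ N •
      (restrictSection (inf_le_left : (c i).U ⊓ (c j).U ≤ (c i).U) (τ i) -
        restrictSection inf_le_right (τ j)) = 0 := by
    intro i j
    let p : AffinePair f V := (c i).shrink ((c i).U ⊓ (c j).U) (c i).W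
      (isAffineOpen_inf (c i).affine_U (c j).affine_U) (c i).affine_W (inf_le_left.trans (c i).le)
      (inf_le_left.trans (c i).le_preimage)
    refine (p.section_localization g).1 _ ?_
    have h1 := congrArg (restrictSection (inf_le_inf_right _ inf_le_left :
      p.U ⊓ Y.left.basicOpen g ≤ (c i).U ⊓ Y.left.basicOpen g)) (hτ i)
    have h2 := congrArg (restrictSection (inf_le_inf_right _ inf_le_right :
      p.U ⊓ Y.left.basicOpen g ≤ (c j).U ⊓ Y.left.basicOpen g)) (hτ j)
    rw [restrictSection_res_pow_smul] at h1 h2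
    exact (map_sub (restrictSection inf_le_left) _ _).trans (sub_eq_zero.mpr (h1.trans h2.symm))
  choose N₀ hN₀ using hover
  obtain ⟨N, hN⟩ : ∃ N : ℕ, ∀ i j,
      res Y (inf_le_left.trans (c i).le : (c i).U ⊓ (c j).U ≤ V) g ^ N •
      (restrictSection (inf_le_left : (c i).U ⊓ (c j).U ≤ (c i).U) (τ i) -
        restrictSection inf_le_right (τ j)) = 0 := by
    refine ⟨Finset.univ.sup fun ij : T × T => N₀ ij.1 ij.2, fun i j => ?_⟩
    rw [← Nat.sub_add_cancel (Finset.le_sup (f := fun ij : T × T => N₀ ij.1 ij.2)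
      (Finset.mem_univ (i, j))), pow_add, mul_smul, hN₀, smul_zero]
  obtain ⟨ρ, hρ⟩ := exists_glue_section (V := V) (fun i => (c i).U) (fun i => (c i).le) hcov
    (fun i => res Y (c i).le g ^ N • τ i) (fun i j => by
      have h := hN i j
      rw [smul_sub, sub_eq_zero] at h
      refine (restrictSection_res_pow_smul _ _ _ _ _).trans (h.trans ?_)
      exact (restrictSection_res_pow_smul _ _ _ _ _).symm)
  refine ⟨N + n, ρ, section_eq_of_local (fun i => (c i).U ⊓ Y.left.basicOpen g)
    (fun i => inf_le_right) (fun y hy => ?_) _ _ fun i => ?_⟩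
  · obtain ⟨i, hi⟩ := hcov y (Y.left.basicOpen_le g hy)
    exact ⟨i, hi, hy⟩
  · have h := congrArg
      (restrictSection (inf_le_left : (c i).U ⊓ Y.left.basicOpen g ≤ (c i).U)) (hρ i)
    rw [restrictSection_res_pow_smul, hτ, smul_smul, ← pow_add] at h
    rw [restrictSection_res_pow_smul]
    exact h

end Separated
end Sections

/-! ### Differential forms attached to binary forms, and charts of the projective line -/

section HomogeneousForms

open KaehlerDifferential

variable {k : Type u} [Field k] {B B' : Type u} [CommRing B] [Algebra k B] [CommRing B']
  [Algebra k B']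

/-- The differential form `G(w₀, w₁) (w₀ dw₁ - w₁ dw₀)` attached to two functions `w₀, w₁` and the
binary form `G` of degree `m` with coefficients `v`. It is homogeneous of degree `m + 2` in `w`. -/
def homogeneousForm {m : ℕ} (w : Fin 2 → B) : (Fin (m + 1) → k) →ₗ[k] Ω[B⁄k] where
  toFun v := MvPolynomial.aeval w (form m v) • (w 0 • D k B (w 1) - w 1 • D k B (w 0))
  map_add' v v' := by simp [add_smul]
  map_smul' c v := by simp [smul_assoc]

lemma homogeneousForm_apply {m : ℕ} (w : Fin 2 → B) (v : Fin (m + 1) → k) :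
    homogeneousForm w v =
      MvPolynomial.aeval w (form m v) • (w 0 • D k B (w 1) - w 1 • D k B (w 0)) := rfl

/-- Homogeneity: the derivative of `c` cancels in `w₀ dw₁ - w₁ dw₀`. -/
lemma homogeneousForm_mul {m : ℕ} (c : B) (w : Fin 2 → B) (v : Fin (m + 1) → k) :
    homogeneousForm (fun i => c * w i) v = c ^ (m + 2) • homogeneousForm w v := by
  have h1 : MvPolynomial.aeval (fun i => c * w i) (form m v) =
      c ^ m * MvPolynomial.aeval w (form m v) := by
    rw [aeval_form, aeval_form, Finset.mul_sum]
    refine Finset.sum_congr rfl fun i _ => ?_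
    have : c ^ m = c ^ (m - i : ℕ) * c ^ (i : ℕ) := by
      rw [← pow_add, Nat.sub_add_cancel (Nat.lt_succ_iff.mp i.2)]
    rw [this]
    ring
  rw [homogeneousForm_apply, homogeneousForm_apply, h1]
  simp only [Derivation.leibniz, smul_add, smul_sub, smul_smul]
  module

/-- A linear substitution multiplies `w₀ dw₁ - w₁ dw₀` by its determinant. -/
lemma homogeneousForm_substitution {m : ℕ} (g : Matrix (Fin 2) (Fin 2) k) (w : Fin 2 → B)
    (v : Fin (m + 1) → k) :
    homogeneousForm (fun i => ∑ j, algebraMap k B (g i j) * w j) v =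
      homogeneousForm w (g.det • act m g v) := by
  have h1 : MvPolynomial.aeval (fun i => ∑ j, algebraMap k B (g i j) * w j) (form m v) =
      MvPolynomial.aeval w (form m (act m g v)) := by
    have h : (MvPolynomial.aeval w).comp
        (MvPolynomial.aeval fun i => ∑ j, MvPolynomial.C (g i j) * MvPolynomial.X j) =
        MvPolynomial.aeval (fun i => ∑ j, algebraMap k B (g i j) * w j) := by
      ext i
      simp
    rw [form_act, ← h]
    rfl
  rw [homogeneousForm_apply, homogeneousForm_apply, h1, map_smul, map_smul, Matrix.det_fin_two]
  simp only [Fin.sum_univ_two, map_add, Derivation.leibniz, Derivation.map_algebraMap, smul_zero,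
    add_zero]
  simp only [Algebra.smul_def, map_sub, map_mul, smul_add, smul_sub, smul_smul]
  module

lemma restrictForms_homogeneousForm {m : ℕ} (β : B →ₐ[k] B') (w : Fin 2 → B)
    (v : Fin (m + 1) → k) :
    restrictForms β (homogeneousForm w v) = homogeneousForm (fun i => β (w i)) v := by
  rw [homogeneousForm_apply, homogeneousForm_apply, map_smulₛₗ, map_sub, map_smulₛₗ, map_smulₛₗ,
    restrictForms_D, restrictForms_D]
  have h : β (MvPolynomial.aeval w (form m v)) =
      MvPolynomial.aeval (fun i => β (w i)) (form m v) :=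
    congrArg (fun φ : MvPolynomial (Fin 2) k →ₐ[k] B' => φ (form m v))
      (MvPolynomial.comp_aeval w β)
  exact congrArg (· • (β (w 0) • D k B' (β (w 1)) - β (w 1) • D k B' (β (w 0)))) h

end HomogeneousForms

section Charts

open MvPolynomial

variable (k : Type u) [Field k]

instance : IsSeparated (P1 k).hom := by
  change IsSeparated (projStructure k)
  rw [projStructure]
  infer_instance

/-- The coordinate `x_i` as a linear form. -/
def linearX (i : Fin 2) : grading k 1 := ⟨X i, isHomogeneous_X k i⟩

variable {k}

/-- The complement `D₊(s)` of the zero locus of a linear form `s`. -/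
def linearOpen (s : grading k 1) : (P1 k).left.Opens := Proj.basicOpen (grading k) s.1

lemma isAffineOpen_linearOpen (s : grading k 1) : IsAffineOpen (linearOpen s) :=
  Proj.isAffineOpen_basicOpen _ _ s.2 one_pos

variable (k) in
/-- The standard affine open `D₊(x_i) ⊆ ℙ¹`. -/
abbrev chart (i : Fin 2) : (P1 k).left.Opens := linearOpen (linearX k i)

lemma exists_mem_chart (y : (P1 k).left) : ∃ i, y ∈ chart k i := by
  have h := Proj.iSup_basicOpen_eq_top' (grading k)
    (fun i : Fin 2 => (X i : MvPolynomial (Fin 2) k)) (fun i => ⟨1, isHomogeneous_X k i⟩) (by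
    refine eq_top_iff.mpr fun x _ => ?_
    induction x using MvPolynomial.induction_on with
    | C c => exact Subalgebra.algebraMap_mem _ (⟨C c, isHomogeneous_C _ c⟩ : grading k 0)
    | add x y hx hy => exact add_mem (hx trivial) (hy trivial)
    | mul_X x i hx => exact mul_mem (hx trivial) (Algebra.subset_adjoin ⟨i, rfl⟩))
  exact TopologicalSpace.Opens.mem_iSup.mp (h.ge (Set.mem_univ y))

/-- The homogeneous fraction `t / s` of two linear forms. -/
def awayFractionLinear (s t : grading k 1) :
    HomogeneousLocalization.Away (grading k) (s : MvPolynomial (Fin 2) k) :=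
  HomogeneousLocalization.Away.mk (grading k) s.2 1 t (by simp)

/-- Homogeneous fractions of degree zero with denominator a power of the linear form `s`, as
functions on `D₊(s)`. -/
def toSection (s : grading k 1) : HomogeneousLocalization.Away (grading k)
    (s : MvPolynomial (Fin 2) k) →+* Γ((P1 k).left, linearOpen s) :=
  (Proj.awayToSection (grading k) s.1).hom

/-- The function `t / s` on `D₊(s)`, for two linear forms `s` and `t`. -/
def linearFraction (s t : grading k 1) : Γ((P1 k).left, linearOpen s) :=
  toSection s (awayFractionLinear s t)

/-- The structure morphism of an open subscheme, in terms of its ring of functions. -/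
lemma ι_comp_hom_eq (X : Over (Spec (.of k))) (U : X.left.Opens) :
    U.ι ≫ X.hom = U.toSpecΓ ≫ Spec.map (structureMap X U) := by
  have h1 := Scheme.Opens.toSpecΓ_SpecMap_appLE X.hom ⊤ U (le_preimage_top X U)
  rw [structureMap, Spec.map_comp, ← Category.assoc]
  refine Eq.trans ?_ (congrArg (· ≫ Spec.map (Scheme.ΓSpecIso (.of k)).inv) h1).symm
  rw [Scheme.Opens.toSpecΓ_top]
  simp

/-- The constant functions on `D₊(s)` are the homogeneous fractions `c / 1`. -/
lemma algebraMap_linearOpen (s : grading k 1) (c : k) :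
    algebraMap k Γ((P1 k).left, linearOpen s) c =
      toSection s
        (HomogeneousLocalization.fromZeroRingHom (grading k) _ (algebraMap k (grading k 0) c)) := by
  have h1 : (Proj.basicOpen (grading k) s.1).ι ≫ projStructure k =
      (Proj.basicOpen (grading k) s.1).toSpecΓ ≫ Spec.map
        (CommRingCat.ofHom (algebraMap k (grading k 0)) ≫ CommRingCat.ofHom
          (HomogeneousLocalization.fromZeroRingHom (grading k) (.powers s.1)) ≫
            Proj.awayToSection (grading k) s.1) := by
    have := Proj.awayι_toSpecZero (grading k) s.1 s.2 one_pos
    rw [Proj.awayι, Category.assoc, Iso.inv_comp_eq, Proj.basicOpenIsoSpec_hom,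
      Proj.basicOpenToSpec] at this
    rw [Spec.map_comp, Spec.map_comp, projStructure, reassoc_of% this]
    simp only [Category.assoc]
  have h2 := (ι_comp_hom_eq (P1 k) (linearOpen s)).symm.trans h1
  have h3 : IsIso (linearOpen s).toSpecΓ :=
    inferInstanceAs (IsIso (isAffineOpen_linearOpen s).isoSpec.hom)
  have h4 := Spec.map_injective ((cancel_epi _).mp h2)
  exact congrArg (fun g => g.hom c) h4

lemma linearFraction_self (s : grading k 1) : linearFraction s s = 1 := by
  have : awayFractionLinear s s = 1 := by
    apply HomogeneousLocalization.val_injective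
    rw [awayFractionLinear, HomogeneousLocalization.Away.val_mk, HomogeneousLocalization.val_one]
    simp
  rw [linearFraction, this]
  exact map_one _

lemma linearFraction_add (s t t' : grading k 1) :
    linearFraction s (t + t') = linearFraction s t + linearFraction s t' := by
  have : awayFractionLinear s (t + t') = awayFractionLinear s t + awayFractionLinear s t' := by
    apply HomogeneousLocalization.val_injective
    simp only [awayFractionLinear, HomogeneousLocalization.Away.val_mk,
      HomogeneousLocalization.val_add, Localization.add_mk_self, Submodule.coe_add]
  rw [linearFraction, this]
  exact map_add _ _ _

lemma linearFraction_smul (s t : grading k 1) (c : k) :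
    linearFraction s (c • t) = algebraMap k _ c * linearFraction s t := by
  have : awayFractionLinear s (c • t) =
      HomogeneousLocalization.fromZeroRingHom (grading k) _ (algebraMap k (grading k 0) c) *
        awayFractionLinear s t := by
    apply HomogeneousLocalization.val_injective
    rw [HomogeneousLocalization.val_mul]
    change _ = Localization.mk (C c) 1 * _
    simp only [awayFractionLinear, HomogeneousLocalization.Away.val_mk, Localization.mk_mul,
      one_mul, Submodule.coe_smul, MvPolynomial.smul_eq_C_mul]
  rw [linearFraction, this, algebraMap_linearOpen]
  exact map_mul _ _ _

/-- The cocycle relation `l / s = (t / s) (l / t)`. -/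
lemma res_linearFraction_mul {U : (P1 k).left.Opens} {s t : grading k 1} (hs : U ≤ linearOpen s)
    (ht : U ≤ linearOpen t) (l : grading k 1) :
    res (P1 k) hs (linearFraction s l) =
      res (P1 k) hs (linearFraction s t) * res (P1 k) ht (linearFraction t l) := by
  let W : (P1 k).left.Opens := Proj.basicOpen (grading k) (s.1 * t.1)
  have hU : U ≤ W := (le_inf hs ht).trans (Proj.basicOpen_mul _ _ _).ge
  have hWs : W ≤ linearOpen s := Proj.basicOpen_mono _ _ _ (Dvd.intro _ rfl)
  have hWt : W ≤ linearOpen t := Proj.basicOpen_mono _ _ _ (Dvd.intro_left _ rfl)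
  -- the relation holds among the fractions with denominator a power of `s * t`
  let γ : HomogeneousLocalization.Away (grading k) (s.1 * t.1) →+* Γ((P1 k).left, U) :=
    (res (P1 k) hU).toRingHom.comp (Proj.awayToSection (grading k) (s.1 * t.1)).hom
  have h1 : ∀ a, γ (HomogeneousLocalization.awayMap (grading k) t.2 rfl a) =
      res (P1 k) hs (toSection s a) := fun a =>
    (congrArg (fun φ => res (P1 k) hU (φ.hom a)) (Proj.awayMap_awayToSection (grading k)
      (f := s.1) (x := s.1 * t.1) t.2 rfl)).trans (res_res hU hWs (toSection s a))
  have h2 : ∀ a, γ (HomogeneousLocalization.awayMap (grading k) s.2 (mul_comm _ _) a) =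
      res (P1 k) ht (toSection t a) := fun a =>
    (congrArg (fun φ => res (P1 k) hU (φ.hom a)) (Proj.awayMap_awayToSection (grading k)
      (f := t.1) (x := s.1 * t.1) s.2 (mul_comm _ _))).trans (res_res hU hWt (toSection t a))
  have h3 : HomogeneousLocalization.awayMap (grading k) t.2 (rfl : s.1 * t.1 = _)
        (awayFractionLinear s l) =
      HomogeneousLocalization.awayMap (grading k) t.2 (rfl : s.1 * t.1 = _)
        (awayFractionLinear s t) *
      HomogeneousLocalization.awayMap (grading k) s.2 (mul_comm s.1 t.1)
        (awayFractionLinear t l) := by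
    apply HomogeneousLocalization.val_injective
    simp only [awayFractionLinear, HomogeneousLocalization.awayMap_mk,
      HomogeneousLocalization.val_mul, HomogeneousLocalization.Away.val_mk, Localization.mk_mul]
    rw [Localization.mk_eq_mk_iff, Localization.r_iff_exists]
    refine ⟨1, ?_⟩
    simp only [OneMemClass.coe_one, Submonoid.coe_mul]
    ring
  have h4 := congrArg γ h3
  rw [map_mul, h1, h1, h2] at h4
  exact h4

lemma val_mapId_awayFractionLinear (s t : grading k 1) (y : ProjectiveSpectrum (grading k))
    (hy : s.1 ∉ y.asHomogeneousIdeal) :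
    (HomogeneousLocalization.mapId (grading k) (Submonoid.powers_le.mpr
      (show s.1 ∈ y.asHomogeneousIdeal.toIdeal.primeCompl from hy))
      (awayFractionLinear s t)).val = Localization.mk t.1 ⟨s.1, hy⟩ := by
  change (HomogeneousLocalization.mk _).val = _
  rw [HomogeneousLocalization.val_mk]
  simp

lemma notMem_of_isUnit_mk (s t : MvPolynomial (Fin 2) k) (y : ProjectiveSpectrum (grading k))
    (hy : s ∉ y.asHomogeneousIdeal)
    (h : IsUnit (Localization.mk t ⟨s, hy⟩ :
      Localization.AtPrime y.asHomogeneousIdeal.toIdeal)) : t ∉ y.asHomogeneousIdeal := by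
  rwa [Localization.mk_eq_mk', IsLocalization.AtPrime.isUnit_mk'_iff (Localization.AtPrime _)
    y.asHomogeneousIdeal.toIdeal] at h

/-- The open set where `t / s` does not vanish is `D₊(s) ∩ D₊(t)`. -/
lemma basicOpen_linearFraction (s t : grading k 1) :
    (P1 k).left.basicOpen (linearFraction s t) = linearOpen s ⊓ linearOpen t := by
  apply le_antisymm
  · intro y hy
    have hys : y ∈ linearOpen s := (P1 k).left.basicOpen_le _ hy
    refine ⟨hys, fun hyt => ?_⟩
    obtain ⟨b, hb⟩ := isUnit_iff_exists_inv.mp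
      (isUnit_res_of_eq (linearFraction s t) ((P1 k).left.basicOpen_le _) rfl)
    have h1 : HomogeneousLocalization.mapId (grading k) (Submonoid.powers_le.mpr hys)
        (awayFractionLinear s t) * b.1 ⟨y, hy⟩ = 1 :=
      congrArg (fun c => c.1 ⟨y, hy⟩) hb
    have h2 := congrArg HomogeneousLocalization.val h1
    rw [HomogeneousLocalization.val_mul, HomogeneousLocalization.val_one] at h2
    have h3 := IsUnit.of_mul_eq_one _ h2
    rw [val_mapId_awayFractionLinear s t y hys] at h3
    exact notMem_of_isUnit_mk _ _ y hys h3 hyt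
  · have h1 := res_linearFraction_mul (inf_le_left : linearOpen s ⊓ linearOpen t ≤ _)
      inf_le_right s
    have h2 : IsUnit (res (P1 k) (inf_le_left : linearOpen s ⊓ linearOpen t ≤ _)
        (linearFraction s t)) := by
      refine IsUnit.of_mul_eq_one _ (h1.symm.trans ?_)
      rw [linearFraction_self, map_one]
    have h3 := basicOpen_res (inf_le_left : linearOpen s ⊓ linearOpen t ≤ _) (linearFraction s t)
    rw [(P1 k).left.basicOpen_of_isUnit h2] at h3
    exact h3.le.trans inf_le_right

variable (k) in
/-- The function `x_j / x_i` on `D₊(x_i)`. -/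
def ratio (i j : Fin 2) : Γ((P1 k).left, chart k i) := linearFraction (linearX k i) (linearX k j)

@[simp] lemma ratio_self (i : Fin 2) : ratio k i i = 1 := linearFraction_self _

lemma res_ratio_mul {U : (P1 k).left.Opens} {i j : Fin 2} (hi : U ≤ chart k i)
    (hj : U ≤ chart k j) (l : Fin 2) :
    res (P1 k) hi (ratio k i l) = res (P1 k) hi (ratio k i j) * res (P1 k) hj (ratio k j l) :=
  res_linearFraction_mul hi hj (linearX k l)

lemma basicOpen_ratio (i j : Fin 2) :
    (P1 k).left.basicOpen (ratio k i j) = chart k i ⊓ chart k j :=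
  basicOpen_linearFraction _ _

lemma linearFraction_sum (s : grading k 1) (c : Fin 2 → k) :
    linearFraction s (∑ j, c j • linearX k j) =
      ∑ j, algebraMap k _ (c j) * linearFraction s (linearX k j) := by
  rw [Fin.sum_univ_two, Fin.sum_univ_two, linearFraction_add, linearFraction_smul,
    linearFraction_smul]

/-- A homogeneous fraction `G / x_i ^ n` is the form `G` evaluated at the functions `x_j / x_i`. -/
lemma toSection_mk (i : Fin 2) (n : ℕ) (G : MvPolynomial (Fin 2) k) (hG : G ∈ grading k (n • 1)) :
    toSection (linearX k i) (HomogeneousLocalization.Away.mk (grading k) (linearX k i).2 n G hG) =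
      aeval (ratio k i) G := by
  obtain ⟨v, rfl⟩ : ∃ v, form n v = G := exists_form_eq (by simpa using hG)
  let ρ : k →+* HomogeneousLocalization.Away (grading k) (linearX k i).1 :=
    (HomogeneousLocalization.fromZeroRingHom (grading k) _).comp (algebraMap k (grading k 0))
  have h1 : HomogeneousLocalization.Away.mk (grading k) (linearX k i).2 n (form n v) hG =
      ∑ j, ρ (v j) * (awayFractionLinear (linearX k i) (linearX k 0) ^ (n - j : ℕ) *
        awayFractionLinear (linearX k i) (linearX k 1) ^ (j : ℕ)) := by
    apply HomogeneousLocalization.val_injective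
    have h : ∀ c, (ρ c).val = Localization.mk (C c) 1 := fun c => rfl
    rw [← HomogeneousLocalization.algebraMap_apply, ← HomogeneousLocalization.algebraMap_apply,
      map_sum]
    simp only [map_mul, map_pow, HomogeneousLocalization.algebraMap_apply, h, awayFractionLinear,
      HomogeneousLocalization.Away.val_mk, Localization.mk_pow, Localization.mk_mul, form_apply,
      Localization.mk_sum]
    refine Finset.sum_congr rfl fun j _ => ?_
    refine congrArg (Localization.mk _) (Subtype.ext ?_)
    simp only [SubmonoidClass.coe_pow, one_mul, pow_one,
      ← pow_add, Nat.sub_add_cancel (Nat.lt_succ_iff.mp j.2)]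
  have h2 : ∀ c, toSection (linearX k i) (ρ c) = algebraMap k _ c := fun c =>
    (algebraMap_linearOpen (linearX k i) c).symm
  rw [h1, aeval_form, map_sum]
  refine Finset.sum_congr rfl fun j _ => ?_
  rw [map_mul, map_mul, map_pow, map_pow, h2]
  rfl

lemma coordinate_eq : (coordinate k : Γ((P1 k).left, D01 k)) =
    res (P1 k) (D01_le_D0 k) (ratio k 0 1) := by
  have h : ∀ s t : grading k 1, (HomogeneousLocalization.awayMap (grading k) t.2
      (rfl : s.1 * t.1 = _) (awayFractionLinear s t)).val =
      (Localization.mk (t.1 * t.1) ⟨(s.1 * t.1) ^ 1, 1, rfl⟩ :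
        Localization.Away (s.1 * t.1)) := fun s t => by
    simp only [awayFractionLinear, HomogeneousLocalization.awayMap_mk,
      HomogeneousLocalization.Away.val_mk, pow_one]
  have h1 : HomogeneousLocalization.awayMap (grading k) (linearX k 1).2
      (rfl : X 0 * X 1 = (linearX k 0).1 * (linearX k 1).1)
      (awayFractionLinear (linearX k 0) (linearX k 1)) = awayFraction k 1 1 :=
    HomogeneousLocalization.val_injective _ (h (linearX k 0) (linearX k 1))
  refine (congrArg (Proj.awayToSection (grading k) (X 0 * X 1)).hom h1).symm.trans ?_
  exact congrArg (fun φ => φ.hom (awayFractionLinear (linearX k 0) (linearX k 1)))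
    (Proj.awayMap_awayToSection (grading k) (f := X 0) (x := X 0 * X 1) (linearX k 1).2 rfl)

end Charts

/-! ### The coordinate rings of the standard charts -/

section ChartCoordinates

open KaehlerDifferential

variable {k : Type u} [Field k]

lemma toSection_bijective (i : Fin 2) : Function.Bijective (toSection (linearX k i)) :=
  ConcreteCategory.bijective_of_isIso
    (Proj.basicOpenIsoAway (grading k) (linearX k i).1 (linearX k i).2 one_pos).hom

/-- A homomorphism sending the linear form `s` to `1` is defined on homogeneous fractions with
denominator a power of `s`. -/
lemma exists_away_hom {S : Type*} [CommRing S] (s : grading k 1)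
    (e : MvPolynomial (Fin 2) k →+* S) (he : e s.1 = 1) :
    ∃ l : HomogeneousLocalization.Away (grading k) s.1 →+* S,
      ∀ n G hG, l (HomogeneousLocalization.Away.mk (grading k) s.2 n G hG) = e G := by
  refine ⟨(IsLocalization.Away.lift (S := Localization.Away s.1) s.1 (g := e)
    (he ▸ isUnit_one)).comp (algebraMap _ _), fun n G hG => ?_⟩
  rw [RingHom.comp_apply, HomogeneousLocalization.algebraMap_apply,
    HomogeneousLocalization.Away.val_mk, Localization.mk_eq_mk', IsLocalization.Away.lift,
    IsLocalization.lift_mk'_spec]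
  change e G = e (s.1 ^ n) * e G
  rw [map_pow, he, one_pow, one_mul]

lemma fromZeroRingHom_eq_mk (s : grading k 1) (c : k) :
    HomogeneousLocalization.fromZeroRingHom (grading k) (.powers s.1)
      (algebraMap k (grading k 0) c) =
    HomogeneousLocalization.Away.mk (grading k) s.2 0 (MvPolynomial.C c) (by
      rw [zero_smul]; exact MvPolynomial.isHomogeneous_C _ c) := by
  apply HomogeneousLocalization.val_injective
  rw [HomogeneousLocalization.Away.val_mk]
  change Localization.mk (MvPolynomial.C c) 1 = _
  exact congrArg (Localization.mk _) (Subtype.ext (pow_zero _).symm)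

/-- Setting `x_i = 1` defines a homomorphism from functions on `D₊(x_i)` to polynomials, which shows
that `x_j / x_i` satisfies no polynomial relation. -/
lemma exists_retraction (i j : Fin 2) (hij : i ≠ j) :
    ∃ r : Γ((P1 k).left, chart k i) →+* Polynomial k,
      r.comp (Polynomial.aeval (ratio k i j)).toRingHom = RingHom.id _ := by
  obtain ⟨l, hmk⟩ := exists_away_hom (linearX k i)
    (MvPolynomial.eval₂Hom Polynomial.C fun l => if l = i then 1 else Polynomial.X)
    ((MvPolynomial.eval₂Hom_X' _ _ i).trans (if_pos rfl))
  let s := RingEquiv.ofBijective _ (toSection_bijective (k := k) i)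
  have hl : ∀ a, l (s.symm (toSection (linearX k i) a)) = l a := fun a =>
    congrArg l (s.symm_apply_apply a)
  refine ⟨l.comp s.symm.toRingHom, Polynomial.ringHom_ext (fun c => ?_) ?_⟩
  · change l (s.symm (Polynomial.aeval (ratio k i j) (Polynomial.C c))) = Polynomial.C c
    rw [Polynomial.aeval_C, algebraMap_linearOpen, hl]
    rw [fromZeroRingHom_eq_mk, hmk, MvPolynomial.eval₂Hom_C]
  · change l (s.symm (Polynomial.aeval (ratio k i j) Polynomial.X)) = Polynomial.X
    rw [Polynomial.aeval_X, ratio, linearFraction, hl, awayFractionLinear, hmk]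
    exact (MvPolynomial.eval₂Hom_X' _ _ j).trans (if_neg hij.symm)

/-- The functions on `D₊(x_i)` are the polynomials in `x_j / x_i`. -/
def chartEquiv (i j : Fin 2) (hij : i ≠ j) : Polynomial k ≃ₐ[k] Γ((P1 k).left, chart k i) :=
  AlgEquiv.ofBijective (Polynomial.aeval (ratio k i j)) (by
    constructor
    · obtain ⟨r, hr⟩ := exists_retraction (k := k) i j hij
      exact Function.LeftInverse.injective (g := r) fun P => DFunLike.congr_fun hr P
    · intro a
      obtain ⟨b, rfl⟩ := (toSection_bijective i).2 a
      obtain ⟨n, G, hG, rfl⟩ :=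
        HomogeneousLocalization.Away.mk_surjective (grading k) (linearX k i).2 b
      refine ⟨MvPolynomial.aeval (fun l => if l = i then 1 else Polynomial.X) G, ?_⟩
      rw [toSection_mk]
      refine congrArg (fun φ : MvPolynomial (Fin 2) k →ₐ[k] _ => φ G)
        ((MvPolynomial.comp_aeval _ (Polynomial.aeval (ratio k i j))).trans
        (congrArg MvPolynomial.aeval (funext fun l => ?_)))
      rcases eq_or_ne l i with rfl | hl
      · rw [if_pos rfl, map_one, ratio_self]
      · rw [if_neg hl, Polynomial.aeval_X]
        congr 1
        omega)

lemma chartEquiv_apply (i j : Fin 2) (hij : i ≠ j) (P : Polynomial k) :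
    chartEquiv i j hij P = Polynomial.aeval (ratio k i j) P := rfl

/-- `Ω` on a standard chart is generated by the differential of the coordinate. -/
lemma exists_smul_D_ratio (i j : Fin 2) (hij : i ≠ j) (ω : Ω[Γ((P1 k).left, chart k i)⁄k]) :
    ∃ P : Polynomial k, ω = Polynomial.aeval (ratio k i j) P • D k _ (ratio k i j) := by
  induction ω using forms_induction with
  | zero => exact ⟨0, by rw [map_zero, zero_smul]⟩
  | add x y hx hy =>
    obtain ⟨P, rfl⟩ := hx
    obtain ⟨Q, rfl⟩ := hy
    exact ⟨P + Q, by rw [map_add, add_smul]⟩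
  | smul b c =>
    obtain ⟨P, rfl⟩ := (chartEquiv i j hij).surjective b
    obtain ⟨Q, rfl⟩ := (chartEquiv i j hij).surjective c
    refine ⟨P * Polynomial.derivative Q, ?_⟩
    rw [chartEquiv_apply, chartEquiv_apply, map_mul, mul_smul, Derivation.map_aeval]

/-- `Ω` on a standard chart is free on the differential of the coordinate. -/
lemma eq_zero_of_smul_D_ratio (i j : Fin 2) (hij : i ≠ j) (P : Polynomial k)
    (h : Polynomial.aeval (ratio k i j) P • D k _ (ratio k i j) = 0) : P = 0 := by
  have h1 := congrArg (restrictForms (chartEquiv (k := k) i j hij).symm.toAlgHom) h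
  rw [map_smulₛₗ, restrictForms_D, map_zero] at h1
  have h2 : ∀ Q,
      (chartEquiv (k := k) i j hij).symm.toAlgHom (Polynomial.aeval (ratio k i j) Q) = Q :=
    (chartEquiv (k := k) i j hij).symm_apply_apply
  have h3 := h2 Polynomial.X
  rw [Polynomial.aeval_X] at h3
  rw [h3] at h1
  have h4 := congrArg (polynomialEquiv k) (((congrArg (· • _) (h2 P)).symm).trans h1)
  rw [map_zero, map_smul, polynomialEquiv_D, Polynomial.derivative_X, smul_eq_mul, mul_one] at h4
  exact h4

end ChartCoordinates

/-! ### Twisted forms as binary forms -/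

section TwistedForms

open KaehlerDifferential

variable {k : Type u} [Field k]

lemma D_inverse {B : Type u} [CommRing B] [Algebra k B] {z w : B} (h : z * w = 1) :
    D k B w = -(w ^ 2 • D k B z) := by
  have h1 : z • D k B w + w • D k B z = 0 := by
    rw [← Derivation.leibniz, h, Derivation.map_one_eq_zero]
  have h2 := congrArg (w • ·) h1
  simp only [smul_add, smul_smul, smul_zero, mul_comm w z, h, one_smul] at h2
  rw [pow_two, eq_neg_iff_add_eq_zero]
  exact h2

/-- If `P(z) dz = z ^ (b - a) Q(w) dw` for `w = 1 / z`, then `z ^ (a + 2 + N) P(z) dz` is the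
negative of `z ^ (b + N) Q(1 / z) dz`, which has polynomial coefficients when `deg Q ≤ N`. -/
lemma smul_D_eq_zero_of_change_coordinate {B : Type u} [CommRing B] [Algebra k B] {z w : B}
    (hzw : z * w = 1) (c : B) (a b : ℕ) (hc : z ^ a * c = z ^ b) (P Q : Polynomial k)
    (h : Polynomial.aeval z P • D k B z = c • Polynomial.aeval w Q • D k B w) :
    Polynomial.aeval z (Polynomial.X ^ (a + 2 + Q.natDegree) * P +
      Polynomial.X ^ b * Polynomial.reflect Q.natDegree Q) • D k B z = 0 := by
  let : Invertible w := ⟨z, hzw, by rw [mul_comm, hzw]⟩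
  have h1 : Polynomial.aeval w Q =
      Polynomial.aeval z (Polynomial.reflect Q.natDegree Q) * w ^ Q.natDegree :=
    (Polynomial.eval₂_reflect_mul_pow (algebraMap k B) w Q.natDegree Q le_rfl).symm
  have h2 : z ^ Q.natDegree * w ^ Q.natDegree = 1 := by rw [← mul_pow, hzw, one_pow]
  have h3 : z ^ 2 * w ^ 2 = 1 := by rw [← mul_pow, hzw, one_pow]
  rw [map_add, map_mul, map_mul, map_pow, map_pow, Polynomial.aeval_X, add_smul, mul_smul, h, h1,
    D_inverse hzw]
  simp only [smul_neg, smul_smul]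
  rw [neg_add_eq_zero]
  congr 1
  calc _ = (z ^ a * c) * (z ^ Q.natDegree * w ^ Q.natDegree) * (z ^ 2 * w ^ 2) *
      Polynomial.aeval z (Polynomial.reflect Q.natDegree Q) := by ring
    _ = _ := by rw [hc, h2, h3, mul_one, mul_one]

lemma ratio_mul_ratio {U : (P1 k).left.Opens} {i j : Fin 2} (hi : U ≤ chart k i)
    (hj : U ≤ chart k j) : res (P1 k) hi (ratio k i j) * res (P1 k) hj (ratio k j i) = 1 := by
  rw [← res_ratio_mul, ratio_self, map_one]

/-- A form on a standard chart that vanishes on the overlap of the two charts is zero. -/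
lemma eq_zero_of_restrictForms_eq_zero {U : (P1 k).left.Opens} {i j : Fin 2} (hij : i ≠ j)
    (hU : U = chart k i ⊓ chart k j) (hi : U ≤ chart k i) (ω : Ω[Γ((P1 k).left, chart k i)⁄k])
    (h : restrictForms (res (P1 k) hi) ω = 0) : ω = 0 := by
  obtain ⟨n, hn⟩ := restrictForms_localization (res (P1 k) hi) (ratio k i j)
    (res_isLocalization (isAffineOpen_linearOpen _) _ hi (hU.trans (basicOpen_ratio i j).symm)) ω h
  obtain ⟨P, rfl⟩ := exists_smul_D_ratio i j hij ω
  have h1 : Polynomial.X ^ n * P = 0 := by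
    refine eq_zero_of_smul_D_ratio i j hij _ ?_
    rw [map_mul, map_pow, Polynomial.aeval_X, mul_smul, hn]
  rw [(mul_eq_zero.mp h1).resolve_left (pow_ne_zero _ Polynomial.X_ne_zero), map_zero, zero_smul]

lemma D01_le_chart (i : Fin 2) : D01 k ≤ chart k i := by
  fin_cases i
  · exact D01_le_D0 k
  · exact D01_le_D1 k

lemma D01_eq : D01 k = chart k 0 ⊓ chart k 1 := Proj.basicOpen_mul _ _ _

lemma coordinate_eq_ratio : (coordinate k : Γ((P1 k).left, D01 k)) =
    res (P1 k) (D01_le_chart 0) (ratio k 0 1) := coordinate_eq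

/-- The restriction of a twisted form to `D₊(x₀)`. -/
def twistedFst {d : ℤ} (ω : twistedForms (k := k) d) : Ω[Γ((P1 k).left, chart k 0)⁄k] := ω.1.1

/-- The restriction of a twisted form to `D₊(x₁)`. -/
def twistedSnd {d : ℤ} (ω : twistedForms (k := k) d) : Ω[Γ((P1 k).left, chart k 1)⁄k] := ω.1.2

/-- The compatibility of the two components of a twisted form. -/
lemma twistedForms_relation {d : ℤ} (ω : twistedForms (k := k) d) :
    restrictForms (res (P1 k) (D01_le_chart 0)) (twistedFst ω) =
      ((coordinate k ^ d : (Γ((P1 k).left, D01 k))ˣ) : Γ((P1 k).left, D01 k)) •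
        restrictForms (res (P1 k) (D01_le_chart 1)) (twistedSnd ω) := ω.2

/-- A twisted form is determined by its restriction to `D₊(x₀)`. -/
lemma twistedForms_ext {d : ℤ} (ω η : twistedForms (k := k) d)
    (h : twistedFst ω = twistedFst η) : ω = η := by
  rw [← sub_eq_zero]
  have h1 : twistedFst (ω - η) = 0 := sub_eq_zero.mpr h
  generalize ω - η = ξ at h1 ⊢
  refine Subtype.ext (Prod.ext h1 ?_)
  refine eq_zero_of_restrictForms_eq_zero (i := 1) (j := 0) (by decide)
    (D01_eq.trans (inf_comm _ _)) (D01_le_chart 1) (twistedSnd ξ) ?_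
  have h2 := twistedForms_relation ξ
  rw [h1, map_zero] at h2
  exact ((coordinate k ^ d).isUnit.smul_eq_zero).mp h2.symm

/-- The form `P(z) dz` has a pole of order at most `deg P + 2` at infinity, which the twist by
`𝒪(d)` has to cancel. -/
lemma natDegree_le_of_mem_twistedForms {d : ℤ} (ω : twistedForms (k := k) d) (P : Polynomial k)
    (hP : P ≠ 0) (h : twistedFst ω = Polynomial.aeval (ratio k 0 1) P • D k _ (ratio k 0 1)) :
    (P.natDegree : ℤ) + 2 ≤ d := by
  obtain ⟨Q, hQ⟩ := exists_smul_D_ratio 1 0 (by decide) (twistedSnd ω)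
  have h1 := twistedForms_relation ω
  rw [h, hQ, map_smulₛₗ, map_smulₛₗ, restrictForms_D, restrictForms_D] at h1
  have hz : ∀ P : Polynomial k, res (P1 k) (D01_le_chart 0) (Polynomial.aeval (ratio k 0 1) P) =
    Polynomial.aeval (res (P1 k) (D01_le_chart 0) (ratio k 0 1)) P :=
    fun P => (Polynomial.aeval_algHom_apply _ _ P).symm
  have hw : res (P1 k) (D01_le_chart 1) (Polynomial.aeval (ratio k 1 0) Q) =
    Polynomial.aeval (res (P1 k) (D01_le_chart 1) (ratio k 1 0)) Q :=
    (Polynomial.aeval_algHom_apply _ _ Q).symm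
  -- `z ^ d` is a quotient of powers with natural exponents, one of which is zero
  have hc : (res (P1 k) (D01_le_chart 0) (ratio k 0 1)) ^ (-d).toNat *
      ((coordinate k ^ d : (Γ((P1 k).left, D01 k))ˣ) : Γ((P1 k).left, D01 k)) =
      (res (P1 k) (D01_le_chart 0) (ratio k 0 1)) ^ d.toNat := by
    rw [← coordinate_eq_ratio, ← Units.val_pow_eq_pow_val, ← Units.val_pow_eq_pow_val,
      ← Units.val_mul, ← zpow_natCast, ← zpow_natCast, ← zpow_add]
    congr 2
    omega
  have h2 := smul_D_eq_zero_of_change_coordinate (k := k)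
    (ratio_mul_ratio (D01_le_chart 0) (D01_le_chart 1)) _ _ _ hc P Q
    ((congrArg (fun a => a • D k Γ((P1 k).left, D01 k) (res (P1 k) (D01_le_chart 0) (ratio k 0 1)))
      (hz P).symm).trans (h1.trans (congrArg (fun a =>
        ((coordinate k ^ d : (Γ((P1 k).left, D01 k))ˣ) : Γ((P1 k).left, D01 k)) • a •
          D k Γ((P1 k).left, D01 k) (res (P1 k) (D01_le_chart 1) (ratio k 1 0))) hw)))
  have h3 := eq_zero_of_smul_D_ratio 0 1 (by decide)
    (Polynomial.X ^ ((-d).toNat + 2 + Q.natDegree) * P +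
      Polynomial.X ^ d.toNat * Polynomial.reflect Q.natDegree Q)
    (eq_zero_of_restrictForms_eq_zero (by decide) D01_eq (D01_le_chart 0) _ (by
      rw [map_smulₛₗ, restrictForms_D]
      exact (congrArg (fun a => a • D k Γ((P1 k).left, D01 k)
        (res (P1 k) (D01_le_chart 0) (ratio k 0 1))) (hz _)).trans h2))
  have h4 := congrArg Polynomial.natDegree (eq_neg_of_add_eq_zero_left h3)
  rw [Polynomial.natDegree_neg, Polynomial.natDegree_X_pow_mul _ hP] at h4
  have h5 := Polynomial.natDegree_reflect_le (p := Q) (N := Q.natDegree)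
  have h6 := Polynomial.natDegree_mul_le (p := (Polynomial.X ^ d.toNat : Polynomial k))
    (q := Polynomial.reflect Q.natDegree Q)
  rw [Polynomial.natDegree_X_pow] at h6
  have h7 : max Q.natDegree Q.natDegree = Q.natDegree := max_self _
  omega

lemma twistedForms_eq_zero {d : ℤ} (hd : d < 2) (ω : twistedForms (k := k) d) : ω = 0 := by
  obtain ⟨P, hP⟩ := exists_smul_D_ratio 0 1 (by decide) (twistedFst ω)
  refine twistedForms_ext _ _ ?_
  rcases eq_or_ne P 0 with rfl | h
  · rw [hP, map_zero, zero_smul]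
    rfl
  · have := natDegree_le_of_mem_twistedForms ω P h hP
    omega

/-- The twisted forms attached to a binary form `G` on the two standard charts differ by the
expected power of the transition function. -/
lemma restrictForms_homogeneousForm_ratio {m : ℕ} {U : (P1 k).left.Opens} {i j : Fin 2}
    (hi : U ≤ chart k i) (hj : U ≤ chart k j) (v : Fin (m + 1) → k) :
    restrictForms (res (P1 k) hi) (homogeneousForm (ratio k i) v) =
      res (P1 k) hi (ratio k i j) ^ (m + 2) •
        restrictForms (res (P1 k) hj) (homogeneousForm (ratio k j) v) := by
  rw [restrictForms_homogeneousForm, restrictForms_homogeneousForm, ← homogeneousForm_mul]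
  exact congrArg (fun w => homogeneousForm w v) (funext fun l => res_ratio_mul hi hj l)

/-- The twisted form `G (x₀ dx₁ - x₁ dx₀)` of degree `m + 2` attached to the binary form `G` of
degree `m` with coefficients `v`. -/
def ofForm (m : ℕ) : (Fin (m + 1) → k) →ₗ[k] twistedForms (k := k) (m + 2) where
  toFun v := ⟨(homogeneousForm (ratio k 0) v, homogeneousForm (ratio k 1) v), by
    refine (restrictForms_homogeneousForm_ratio (D01_le_chart 0) (D01_le_chart 1) v).trans ?_
    refine congrArg
      (· • restrictForms (res (P1 k) (D01_le_chart 1)) (homogeneousForm (ratio k 1) v)) ?_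
    rw [← coordinate_eq_ratio, ← Units.val_pow_eq_pow_val, ← zpow_natCast]
    norm_cast⟩
  map_add' v w := Subtype.ext (Prod.ext (map_add _ _ _) (map_add _ _ _))
  map_smul' c v := Subtype.ext (Prod.ext (map_smul _ _ _) (map_smul _ _ _))

lemma ofForm_fst {m : ℕ} (v : Fin (m + 1) → k) :
    twistedFst (ofForm m v) = homogeneousForm (ratio k 0) v := rfl

lemma homogeneousForm_ratio_zero {m : ℕ} (v : Fin (m + 1) → k) :
    homogeneousForm (ratio k 0) v =
      Polynomial.aeval (ratio k 0 1)
        (∑ i : Fin (m + 1), Polynomial.C (v i) * Polynomial.X ^ (i : ℕ)) •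
          D k _ (ratio k 0 1) := by
  rw [homogeneousForm_apply, aeval_form]
  simp [map_sum]

/-- `H⁰(ℙ¹, (T^*ℙ¹)(m + 2))` is the space of binary forms of degree `m`. -/
lemma ofForm_bijective (m : ℕ) : Function.Bijective (ofForm (k := k) m) := by
  have hcoeff : ∀ (v : Fin (m + 1) → k) (j : Fin (m + 1)),
      (∑ i : Fin (m + 1), Polynomial.C (v i) * Polynomial.X ^ (i : ℕ)).coeff j = v j := by
    intro v j
    simp [Polynomial.coeff_C_mul, Polynomial.coeff_X_pow, Fin.val_inj]
  constructor
  · refine (injective_iff_map_eq_zero _).mpr fun v hv => funext fun j => ?_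
    have h1 := congrArg twistedFst hv
    have h2 := eq_zero_of_smul_D_ratio 0 1 (by decide) _
      ((homogeneousForm_ratio_zero v).symm.trans h1)
    rw [← hcoeff v j, h2]
    rfl
  · intro ω
    obtain ⟨P, hP⟩ := exists_smul_D_ratio 0 1 (by decide) (twistedFst ω)
    refine ⟨fun i => P.coeff i, twistedForms_ext _ _ ?_⟩
    rw [ofForm_fst, homogeneousForm_ratio_zero, hP]
    congr 2
    rcases eq_or_ne P 0 with rfl | h
    · simp
    · have := natDegree_le_of_mem_twistedForms ω P h hP
      rw [Fin.sum_univ_eq_sum_range (fun i => Polynomial.C (P.coeff i) * Polynomial.X ^ i)]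
      exact (P.as_sum_range_C_mul_X_pow' (by omega)).symm

end TwistedForms

/-! ### The codifferential and its image -/

section Codifferential

variable {k : Type u} [Field k] {X Y : Over (Spec (.of k))} {f : Y ⟶ X} {V V' : Y.left.Opens}

/-- The form `ω` on the open `V` is the image of the section `σ` of `f^* Ω_{X/k}` under the
codifferential. -/
def HasCodiff (σ : pullbackCotangent f V) (ω : Ω[Γ(Y.left, V)⁄k]) : Prop :=
  ∀ p : AffinePair f V, PulledForms.codiff p.hom (σ.1 p) = restrictForms (res Y p.le) ω

lemma restrictForms_res_res {U V W : Y.left.Opens} (h : U ≤ V) (h' : V ≤ W)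
    (ω : Ω[Γ(Y.left, W)⁄k]) :
    restrictForms (res Y h) (restrictForms (res Y h') ω) = restrictForms (res Y (h.trans h')) ω :=
  restrictForms_restrictForms _ _ _ (res_res h h') ω

lemma AffinePair.codiff_restrict (p q : AffinePair f V) (hU : q.U ≤ p.U) (hW : q.W ≤ p.W)
    (x : p.Forms) : PulledForms.codiff q.hom (p.restrict q hU hW x) =
      restrictForms (res Y hU) (PulledForms.codiff p.hom x) :=
  PulledForms.codiff_restrict _ _ _ _ _ _

lemma restrictForms_smul {B B' : Type u} [CommRing B] [CommRing B'] [Algebra k B] [Algebra k B']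
    (β : B →ₐ[k] B') (b : B) (ω : Ω[B⁄k]) :
    restrictForms β (b • ω) = β b • restrictForms β ω :=
  map_smulₛₗ _ _ _

lemma HasCodiff.smul {σ : pullbackCotangent f V} {ω : Ω[Γ(Y.left, V)⁄k]} (h : HasCodiff σ ω)
    (b : Γ(Y.left, V)) : HasCodiff (b • σ) (b • ω) := fun p => by
  rw [section_smul_apply, map_smul, h p, restrictForms_smul]

lemma HasCodiff.add {σ τ : pullbackCotangent f V} {ω η : Ω[Γ(Y.left, V)⁄k]} (h : HasCodiff σ ω)
    (h' : HasCodiff τ η) : HasCodiff (σ + τ) (ω + η) := fun p => by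
  rw [map_add, ← h p, ← h' p, ← map_add]
  rfl

lemma HasCodiff.restrict {σ : pullbackCotangent f V'} {ω : Ω[Γ(Y.left, V')⁄k]} (h : HasCodiff σ ω)
    (hV : V ≤ V') : HasCodiff (restrictSection hV σ) (restrictForms (res Y hV) ω) := fun p =>
  (h (p.enlarge hV)).trans (restrictForms_res_res p.le hV ω).symm

/-- A form on an affine open that vanishes locally is zero. -/
lemma forms_eq_zero_of_local {U : Y.left.Opens} (hU : IsAffineOpen U) (x : Ω[Γ(Y.left, U)⁄k])
    (h : ∀ y ∈ U, ∃ (U' : Y.left.Opens) (hU' : U' ≤ U), y ∈ U' ∧ restrictForms (res Y hU') x = 0) :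
    x = 0 := by
  have hspan := span_basicOpen_eq_top hU
    (fun U' => ∃ (U'' : Y.left.Opens) (hU'' : U'' ≤ U), U' ≤ U'' ∧ restrictForms (res Y hU'') x = 0)
    (fun U' V' h1 ⟨U'', h2, h3, h4⟩ => ⟨U'', h2, h1.trans h3, h4⟩)
    (fun y hy => by
      obtain ⟨U', hU', hy', h0⟩ := h y hy
      exact ⟨U', hy', U', hU', le_rfl, h0⟩)
  let I : Ideal Γ(Y.left, U) :=
    LinearMap.ker (LinearMap.toSpanSingleton Γ(Y.left, U) Ω[Γ(Y.left, U)⁄k] x)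
  have hI : I.radical = ⊤ := by
    rw [eq_top_iff, ← hspan, Ideal.span_le]
    rintro g ⟨U'', h2, h3, h4⟩
    obtain ⟨n, hn⟩ := restrictForms_localization (res Y (Y.left.basicOpen_le g)) g
      (res_isLocalization hU g _ rfl) x (by
        rw [← restrictForms_res_res h3 h2, h4, map_zero])
    exact ⟨n, hn⟩
  rw [Ideal.radical_eq_top] at hI
  have h1 : (1 : Γ(Y.left, U)) ∈ I := hI ▸ trivial
  exact (one_smul _ x).symm.trans h1

/-- The relation between `σ` and its codifferential may be checked on an open cover. -/
lemma HasCodiff.of_local {ι : Type*} (U : ι → Y.left.Opens) (hU : ∀ i, U i ≤ V)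
    (hV : ∀ y ∈ V, ∃ i, y ∈ U i) (σ : pullbackCotangent f V) (ω : Ω[Γ(Y.left, V)⁄k])
    (h : ∀ i, HasCodiff (restrictSection (hU i) σ) (restrictForms (res Y (hU i)) ω)) :
    HasCodiff σ ω := fun p => by
  rw [← sub_eq_zero]
  refine forms_eq_zero_of_local p.affine_U _ fun y hy => ?_
  obtain ⟨i, hi⟩ := hV y (p.le hy)
  obtain ⟨g, hg, hyg⟩ := p.affine_U.exists_basicOpen_le ⟨y, hi⟩ hy
  refine ⟨_, p.basic_le g, hyg, ?_⟩
  rw [map_sub, sub_eq_zero, restrictForms_res_res]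
  let q : AffinePair f (U i) := p.shrink (Y.left.basicOpen g) p.W (p.affine_U.basicOpen g)
    p.affine_W hg ((p.basic g).le_preimage)
  have h1 := h i q
  rw [restrictForms_res_res] at h1
  refine Eq.trans ?_ h1
  have h2 := σ.2 p (p.basic g) (p.basic_le g) (p.basic_W_le g)
  refine (p.codiff_restrict (p.basic g) (p.basic_le g) (p.basic_W_le g) (σ.1 p)).symm.trans ?_
  exact congrArg (PulledForms.codiff (p.basic g).hom) h2

end Codifferential

section ImageCoefficients

variable {k : Type u} [Field k] {X : Over (Spec (.of k))}

/-- The space `V_{m + 2}`, as a space of binary forms of degree `m`. -/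
def imageCoeffs (f : P1 k ⟶ X) (m : ℕ) : Submodule k (Fin (m + 1) → k) :=
  (imageForms f (m + 2)).comap (ofForm m)

/-- A family of sections `s i` over the standard charts that is a section of `(f^* Ω_{X/k})(d)`:
`s_i = (x_j / x_i) ^ d s_j` on overlaps. Quantifying over all opens inside an overlap keeps the two
charts symmetric. -/
def IsTwistedFamily (f : P1 k ⟶ X) (d : ℕ) (s : ∀ i, pullbackCotangent f (chart k i)) : Prop :=
  ∀ (i j : Fin 2) (U : (P1 k).left.Opens) (hi : U ≤ chart k i) (hj : U ≤ chart k j),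
    restrictSection hi (s i) = res (P1 k) hi (ratio k i j) ^ d • restrictSection hj (s j)

/-- It suffices to check the transition between the two charts in one direction on the overlap. -/
lemma isTwistedFamily_of_overlap {f : P1 k ⟶ X} {d : ℕ}
    {s : ∀ i, pullbackCotangent f (chart k i)} {i j : Fin 2} (hij : i ≠ j)
    {U : (P1 k).left.Opens} (hU : chart k i ⊓ chart k j ≤ U) (hi : U ≤ chart k i)
    (hj : U ≤ chart k j)
    (h : restrictSection hi (s i) = res (P1 k) hi (ratio k i j) ^ d • restrictSection hj (s j)) :
    IsTwistedFamily f d s := by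
  have h01 : ∀ (U' : (P1 k).left.Opens) (hi : U' ≤ chart k i) (hj : U' ≤ chart k j),
      restrictSection hi (s i) = res (P1 k) hi (ratio k i j) ^ d • restrictSection hj (s j) := by
    intro U' hi' hj'
    have h1 := congrArg (restrictSection ((le_inf hi' hj').trans hU)) h
    rwa [restrictSection_smul, map_pow, res_res, restrictSection_restrictSection,
      restrictSection_restrictSection] at h1
  intro a b U' ha hb
  obtain rfl | ⟨rfl, rfl⟩ | ⟨rfl, rfl⟩ : a = b ∨ (a = i ∧ b = j) ∨ (a = j ∧ b = i) := by omega
  · rw [ratio_self, map_one, one_pow, one_smul]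
  · exact h01 U' ha hb
  · rw [h01 U' hb ha, ← mul_smul, ← mul_pow, ratio_mul_ratio, one_pow, one_smul]

lemma coordinateOn_zpow {U : (P1 k).left.Opens} (h : U ≤ D01 k) (d : ℕ) :
    ((coordinateOn k h ^ (d : ℤ) : (Γ((P1 k).left, U))ˣ) : Γ((P1 k).left, U)) =
      res (P1 k) h (res (P1 k) (D01_le_chart 0) (ratio k 0 1) ^ d) := by
  rw [zpow_natCast, Units.val_pow_eq_pow_val, map_pow, ← coordinate_eq_ratio]
  rfl

lemma mem_imageCoeffs_iff {f : P1 k ⟶ X} {m : ℕ} {v : Fin (m + 1) → k} :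
    v ∈ imageCoeffs f m ↔ ∃ s : ∀ i, pullbackCotangent f (chart k i),
      IsTwistedFamily f (m + 2) s ∧ ∀ i, HasCodiff (s i) (homogeneousForm (ratio k i) v) := by
  constructor
  · rintro ⟨σ, hσ, h0, h1⟩
    let s : ∀ i, pullbackCotangent f (chart k i) := Fin.cons σ.1 (Fin.cons σ.2 finZeroElim)
    refine ⟨s, isTwistedFamily_of_overlap (i := 0) (j := 1) (by decide) D01_eq.ge
      (D01_le_chart 0) (D01_le_chart 1) (Subtype.ext (funext fun p => ?_)), fun i => ?_⟩
    · have h2 := coordinateOn_zpow p.le (m + 2)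
      push_cast at h2
      exact (hσ p).trans (congrArg (· • (restrictSection (D01_le_D1 k) σ.2).1 p) h2)
    · match i with
      | 0 => exact h0
      | 1 => exact h1
  · rintro ⟨s, hs, h⟩
    refine ⟨(s 0, s 1), fun p => ?_, h 0, h 1⟩
    have h2 := coordinateOn_zpow p.le (m + 2)
    push_cast at h2
    have h3 := congrArg (fun σ => σ.1 p) (hs 0 1 _ (D01_le_chart 0) (D01_le_chart 1))
    exact h3.trans (congrArg (· • (restrictSection (D01_le_chart 1) (s 1)).1 p) h2.symm)

end ImageCoefficients

/-! ### Transport along isomorphisms -/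

section Transport

variable {k : Type u} [Field k] {X Y Y' : Over (Spec (.of k))}

lemma comorphism_res (f : Y ⟶ X) {W W' : X.left.Opens} {U : Y.left.Opens} (hW : W' ≤ W)
    (h : U ≤ f.left ⁻¹ᵁ W') (h' : U ≤ f.left ⁻¹ᵁ W) (a : Γ(X.left, W)) :
    comorphism f W' U h (res X hW a) = comorphism f W U h' a :=
  congrArg (fun g => g.hom a) (Scheme.Hom.map_appLE f.left h (homOfLE hW).op)

lemma res_comorphism (f : Y ⟶ X) {W : X.left.Opens} {U U' : Y.left.Opens} (hU : U' ≤ U)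
    (h : U ≤ f.left ⁻¹ᵁ W) (a : Γ(X.left, W)) :
    res Y hU (comorphism f W U h a) = comorphism f W U' (hU.trans h) a :=
  congrArg (fun g => g.hom a) (Scheme.Hom.appLE_map f.left h (homOfLE hU).op)

lemma comorphism_comp (g : Y' ⟶ Y) (f : Y ⟶ X) {W : X.left.Opens} {V : Y.left.Opens}
    {U : Y'.left.Opens} (h : V ≤ f.left ⁻¹ᵁ W) (h' : U ≤ g.left ⁻¹ᵁ V)
    (h'' : U ≤ (g ≫ f).left ⁻¹ᵁ W) (a : Γ(X.left, W)) :
    comorphism g V U h' (comorphism f W V h a) = comorphism (g ≫ f) W U h'' a :=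
  congrArg (fun g => g.hom a) (Scheme.Hom.appLE_comp_appLE g.left f.left W V U h h')

variable (α : Y' ≅ Y)

lemma inv_preimage_hom_preimage (V : Y.left.Opens) : α.inv.left ⁻¹ᵁ α.hom.left ⁻¹ᵁ V = V := by
  have h : α.inv.left ≫ α.hom.left = 𝟙 _ := congrArg (fun g => g.left) α.inv_hom_id
  rw [← Scheme.Hom.comp_preimage, h, Scheme.Hom.id_preimage]

lemma hom_preimage_inv_preimage (V : Y'.left.Opens) : α.hom.left ⁻¹ᵁ α.inv.left ⁻¹ᵁ V = V :=
  inv_preimage_hom_preimage α.symm V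

lemma isIso_inv_left : IsIso α.inv.left :=
  ((Over.forget _).mapIso α.symm).isIso_hom

variable {α} {f : Y ⟶ X} {V : Y.left.Opens} {V' : Y'.left.Opens}

/-- The affine pair of `f` that corresponds to an affine pair of `f ∘ α`. -/
def AffinePair.transport (h : V' ≤ α.hom.left ⁻¹ᵁ V) (q : AffinePair (α.hom ≫ f) V') :
    AffinePair f V where
  U := α.inv.left ⁻¹ᵁ q.U
  W := q.W
  affine_U :=
    haveI := isIso_inv_left α
    q.affine_U.preimage_of_isIso α.inv.left
  affine_W := q.affine_W
  le := (α.inv.left.preimage_mono (q.le.trans h)).trans (inv_preimage_hom_preimage α V).le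
  le_preimage := (α.inv.left.preimage_mono q.le_preimage).trans
    (inv_preimage_hom_preimage α (f.left ⁻¹ᵁ q.W)).le

lemma AffinePair.le_transport (h : V' ≤ α.hom.left ⁻¹ᵁ V) (q : AffinePair (α.hom ≫ f) V') :
    q.U ≤ α.hom.left ⁻¹ᵁ (q.transport h).U :=
  (hom_preimage_inv_preimage α q.U).ge

lemma AffinePair.transport_comm (h : V' ≤ α.hom.left ⁻¹ᵁ V) (q : AffinePair (α.hom ≫ f) V') :
    (comorphism α.hom (q.transport h).U q.U (q.le_transport h)).comp (q.transport h).hom =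
      q.hom.comp (AlgHom.id k Γ(X.left, q.W)) := by
  ext a
  exact comorphism_comp α.hom f _ (q.le_transport h) _ a

/-- The pullback map `(f^* Ω_{X/k})(α(U)) → ((f ∘ α)^* Ω_{X/k})(U)`. -/
def AffinePair.transportForms (h : V' ≤ α.hom.left ⁻¹ᵁ V) (q : AffinePair (α.hom ≫ f) V') :
    (q.transport h).Forms →ₛₗ[(comorphism α.hom (q.transport h).U q.U
      (q.le_transport h)).toRingHom] q.Forms :=
  PulledForms.restrict (q.transport h).hom q.hom (AlgHom.id k Γ(X.left, q.W))
    (comorphism α.hom (q.transport h).U q.U (q.le_transport h)) (q.transport_comm h)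

lemma AffinePair.restrict_transportForms (h : V' ≤ α.hom.left ⁻¹ᵁ V)
    (p q : AffinePair (α.hom ≫ f) V') (hU : q.U ≤ p.U) (hW : q.W ≤ p.W)
    (x : (p.transport h).Forms) :
    p.restrict q hU hW (p.transportForms h x) = q.transportForms h
      ((p.transport h).restrict (q.transport h) (α.inv.left.preimage_mono hU) hW x) := by
  have hle : q.U ≤ α.hom.left ⁻¹ᵁ (p.transport h).U := hU.trans (p.le_transport h)
  have comm : (comorphism α.hom (p.transport h).U q.U hle).comp (p.transport h).hom =
      q.hom.comp (res X hW) := by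
    ext a
    refine (comorphism_comp α.hom f _ hle (hle.trans (α.hom.left.preimage_mono
      (p.transport h).le_preimage)) a).trans ?_
    exact (comorphism_res (α.hom ≫ f) hW q.le_preimage _ a).symm
  exact (PulledForms.restrict_restrict _ _ _ _ _ _ _ _ _ (res X hW)
    (comorphism α.hom (p.transport h).U q.U hle) comm (fun a => rfl)
    (fun b => res_comorphism α.hom hU (p.le_transport h) b) _).trans
    (PulledForms.restrict_restrict _ _ _ _ _ _ _ _ _ (res X hW)
    (comorphism α.hom (p.transport h).U q.U hle) comm (fun a => rfl)
    (fun b => comorphism_res α.hom _ (q.le_transport h) _ b) _).symm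

/-- The pullback of sections of `f^* Ω_{X/k}` along an isomorphism `α`. -/
def transportSection (h : V' ≤ α.hom.left ⁻¹ᵁ V) (σ : pullbackCotangent f V) :
    pullbackCotangent (α.hom ≫ f) V' :=
  ⟨fun q => q.transportForms h (σ.1 (q.transport h)), fun p q hU hW =>
    (p.restrict_transportForms h q hU hW _).trans (congrArg (q.transportForms h)
      (σ.2 (p.transport h) (q.transport h) (α.inv.left.preimage_mono hU) hW))⟩

lemma transportSection_smul (h : V' ≤ α.hom.left ⁻¹ᵁ V) (b : Γ(Y.left, V))
    (σ : pullbackCotangent f V) : transportSection h (b • σ) =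
      comorphism α.hom V V' h b • transportSection h σ := by
  refine Subtype.ext (funext fun q => ?_)
  refine (map_smulₛₗ (q.transportForms h) (res Y (q.transport h).le b)
    (σ.1 (q.transport h))).trans ?_
  refine congrArg (· • (transportSection h σ).1 q) ?_
  exact (comorphism_res α.hom (q.transport h).le (q.le_transport h) (q.le.trans h) b).trans
    (res_comorphism α.hom q.le h b).symm

/-- The codifferential commutes with pullback along an isomorphism. -/
lemma HasCodiff.transport (h : V' ≤ α.hom.left ⁻¹ᵁ V) {σ : pullbackCotangent f V}
    {ω : Ω[Γ(Y.left, V)⁄k]} (hσ : HasCodiff σ ω) :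
    HasCodiff (transportSection h σ) (restrictForms (comorphism α.hom V V' h) ω) := fun q => by
  refine (PulledForms.codiff_restrict _ _ _ _ (q.transport_comm h) (σ.1 (q.transport h))).trans ?_
  rw [hσ (q.transport h)]
  exact (restrictForms_restrictForms _ _ (comorphism α.hom V q.U (q.le.trans h))
    (fun b => comorphism_res α.hom _ (q.le_transport h) _ b) ω).trans
    (restrictForms_restrictForms _ _ _ (fun b => res_comorphism α.hom q.le h b) ω).symm

end Transport

section Moebius

open MvPolynomial

variable {k : Type u} [Field k]

/-- The linear form `∑ l, A j l x_l`, the pullback of `x_j` under the automorphism of `ℙ¹` given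
by `A`. -/
def rowForm (A : Matrix (Fin 2) (Fin 2) k) (j : Fin 2) : grading k 1 :=
  ∑ l, A j l • linearX k l

lemma substitution_linearX (A : Matrix (Fin 2) (Fin 2) k) (j : Fin 2) :
    substitution A (linearX k j).1 = (rowForm A j).1 := by
  refine (substitution_X A j).trans ?_
  simp [rowForm, linearX, MvPolynomial.smul_eq_C_mul]

lemma moebius_preimage_chart (A : GL (Fin 2) k) (j : Fin 2) :
    (moebius A).hom.left ⁻¹ᵁ chart k j = linearOpen (rowForm A.1 j) :=
  congrArg (Proj.basicOpen (grading k)) (substitution_linearX A.1 j)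

/-- The pullback of `x_l / x_j` is the quotient of the pulled back linear forms. -/
lemma comorphism_moebius_ratio (A : GL (Fin 2) k) (j l : Fin 2)
    (h : linearOpen (rowForm A.1 j) ≤ (moebius A).hom.left ⁻¹ᵁ chart k j) :
    comorphism (moebius A).hom (chart k j) (linearOpen (rowForm A.1 j)) h (ratio k j l) =
      linearFraction (rowForm A.1 j) (rowForm A.1 l) := by
  have key : ∀ (s t : grading k 1) (hs : substitution A.1 (linearX k j).1 = s.1)
      (ht : substitution A.1 (linearX k l).1 = t.1)
      (h : linearOpen s ≤ (moebius A).hom.left ⁻¹ᵁ chart k j),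
      comorphism (moebius A).hom (chart k j) (linearOpen s) h (ratio k j l) =
        linearFraction s t := by
    rintro ⟨s, hs'⟩ ⟨t, ht'⟩ rfl rfl h
    refine (congrArg (fun φ => φ.hom (awayFractionLinear (linearX k j) (linearX k l)))
      (Proj.awayToSection_comp_appLE (𝒜 := grading k) (ℬ := grading k) (substitution A.1)
        (irrelevant_le_map A) (linearX k j).2)).trans ?_
    refine congrArg (toSection ⟨substitution A.1 (linearX k j).1, hs'⟩) ?_
    exact HomogeneousLocalization.Away.map_mk _ _ _ _ _ _
  exact key _ _ (substitution_linearX A.1 j) (substitution_linearX A.1 l) h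

end Moebius

/-! ### The action of automorphisms of the projective line -/

section MoebiusAction

variable {k : Type u} [Field k] {X : Over (Spec (.of k))} {f : P1 k ⟶ X} (A : GL (Fin 2) k)

lemma le_moebius_preimage {A : GL (Fin 2) k} {U : (P1 k).left.Opens} {j : Fin 2}
    (h : U ≤ linearOpen (rowForm A.1 j)) : U ≤ (moebius A).hom.left ⁻¹ᵁ chart k j :=
  h.trans (moebius_preimage_chart A j).ge

lemma comorphism_moebius_ratio_of_le {U : (P1 k).left.Opens} {j : Fin 2}
    (h : U ≤ linearOpen (rowForm A.1 j)) (l : Fin 2) :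
    comorphism (moebius A).hom (chart k j) U (le_moebius_preimage h) (ratio k j l) =
      res (P1 k) h (linearFraction (rowForm A.1 j) (rowForm A.1 l)) := by
  rw [← comorphism_moebius_ratio A j l (le_moebius_preimage le_rfl), res_comorphism]

variable {A}

/-- The pullbacks of the members of a twisted family are related by the pulled back transition
functions. -/
lemma transportSection_family {d : ℕ} {s : ∀ i, pullbackCotangent f (chart k i)}
    (hs : IsTwistedFamily f d s) {U : (P1 k).left.Opens} {j j' : Fin 2}
    (hj : U ≤ linearOpen (rowForm A.1 j)) (hj' : U ≤ linearOpen (rowForm A.1 j')) :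
    transportSection (le_moebius_preimage hj) (s j) =
      res (P1 k) hj (linearFraction (rowForm A.1 j) (rowForm A.1 j')) ^ d •
        transportSection (le_moebius_preimage hj') (s j') := by
  have h : U ≤ (moebius A).hom.left ⁻¹ᵁ (chart k j ⊓ chart k j') :=
    le_inf (le_moebius_preimage hj) (le_moebius_preimage hj')
  have h1 := congrArg (transportSection h) (hs j j' _ inf_le_left inf_le_right)
  rw [transportSection_smul, map_pow, comorphism_res _ _ _ (le_moebius_preimage hj),
    comorphism_moebius_ratio_of_le] at h1
  exact h1

/-- The local expressions of the pullback of a twisted family satisfy the transition rules of a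
twisted family. -/
lemma smul_transportSection_family {d : ℕ} {s : ∀ i, pullbackCotangent f (chart k i)}
    (hs : IsTwistedFamily f d s) {U : (P1 k).left.Opens} {i i' j j' : Fin 2}
    (hi : U ≤ chart k i) (hi' : U ≤ chart k i')
    (hj : U ≤ linearOpen (rowForm A.1 j)) (hj' : U ≤ linearOpen (rowForm A.1 j')) :
    res (P1 k) hi (linearFraction (linearX k i) (rowForm A.1 j)) ^ d •
        transportSection (le_moebius_preimage hj) (s j) =
      res (P1 k) hi (ratio k i i') ^ d •
        res (P1 k) hi' (linearFraction (linearX k i') (rowForm A.1 j')) ^ d •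
          transportSection (le_moebius_preimage hj') (s j') := by
  rw [transportSection_family hs hj hj', ← mul_smul, ← mul_smul, ← mul_pow, ← mul_pow,
    ← res_linearFraction_mul hi hj, ratio, ← res_linearFraction_mul hi hi']

/-- The pullback of the twisted form of `G` is that of `G` after the substitution, up to the factor
`det A` by which `x₀ dx₁ - x₁ dx₀` changes. -/
lemma restrictForms_moebius_homogeneousForm {m : ℕ} {U : (P1 k).left.Opens} {i j : Fin 2}
    (hi : U ≤ chart k i) (hj : U ≤ linearOpen (rowForm A.1 j)) (v : Fin (m + 1) → k) :
    restrictForms (res (P1 k) hi) (homogeneousForm (ratio k i) (A.1.det • act m A.1 v)) =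
      res (P1 k) hi (linearFraction (linearX k i) (rowForm A.1 j)) ^ (m + 2) •
        restrictForms (comorphism (moebius A).hom (chart k j) U (le_moebius_preimage hj))
          (homogeneousForm (ratio k j) v) := by
  rw [← homogeneousForm_substitution, restrictForms_homogeneousForm, restrictForms_homogeneousForm,
    ← homogeneousForm_mul]
  refine congrArg (fun w => homogeneousForm w v) (funext fun l => ?_)
  rw [comorphism_moebius_ratio_of_le A hj, ← res_linearFraction_mul hi hj]
  exact congrArg (res (P1 k) hi) (linearFraction_sum (linearX k i) (A.1 l)).symm

variable (A) in
/-- The open where both `x_i` and the pullback of `x_j` under the automorphism do not vanish. -/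
def moebiusChart (i j : Fin 2) : (P1 k).left.Opens := chart k i ⊓ linearOpen (rowForm A.1 j)

lemma moebiusChart_le_chart (i j : Fin 2) : moebiusChart A i j ≤ chart k i := inf_le_left

lemma moebiusChart_le_linearOpen (i j : Fin 2) : moebiusChart A i j ≤ linearOpen (rowForm A.1 j) :=
  inf_le_right

lemma exists_mem_rowOpen (A : GL (Fin 2) k) (y : (P1 k).left) :
    ∃ j, y ∈ linearOpen (rowForm A.1 j) := by
  obtain ⟨j, hj⟩ := exists_mem_chart ((moebius A).hom.left y)
  exact ⟨j, (moebius_preimage_chart A j).le hj⟩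

/-- The `j`-th local expression over `D₊(x_i)` of the pullback of a twisted family of sections: on
the pullback of `D₊(x_j)`, the transition function is the `d`-th power of the pullback of `x_j`,
divided by `x_i`. -/
def moebiusSection (A : GL (Fin 2) k) (d : ℕ) (s : ∀ i, pullbackCotangent f (chart k i))
    (i j : Fin 2) : pullbackCotangent ((moebius A).hom ≫ f) (moebiusChart A i j) :=
  res (P1 k) (moebiusChart_le_chart (A := A) i j)
    (linearFraction (linearX k i) (rowForm A.1 j)) ^ d •
      transportSection (f := f) (le_moebius_preimage (moebiusChart_le_linearOpen (A := A) i j))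
        (s j)

lemma restrictSection_moebiusSection (d : ℕ) (s : ∀ i, pullbackCotangent f (chart k i))
    (i j : Fin 2) {U : (P1 k).left.Opens} (h : U ≤ moebiusChart A i j) (hi : U ≤ chart k i)
    (hj : U ≤ linearOpen (rowForm A.1 j)) :
    restrictSection h (moebiusSection A d s i j) =
      res (P1 k) hi (linearFraction (linearX k i) (rowForm A.1 j)) ^ d •
        transportSection (le_moebius_preimage hj) (s j) := by
  rw [moebiusSection, restrictSection_smul, map_pow, res_res]
  rfl

/-- The local expressions glue to a section over the chart. -/
lemma exists_glue_moebiusSection {d : ℕ} {s : ∀ i, pullbackCotangent f (chart k i)}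
    (hs : IsTwistedFamily f d s) (i : Fin 2) :
    ∃ τ : pullbackCotangent ((moebius A).hom ≫ f) (chart k i),
      ∀ j, restrictSection (moebiusChart_le_chart i j) τ = moebiusSection A d s i j := by
  refine exists_glue_section (moebiusChart A i) (moebiusChart_le_chart i) (fun y hy => ?_)
    (moebiusSection A d s i) (fun j j' => ?_)
  · obtain ⟨j, h⟩ := exists_mem_rowOpen A y
    exact ⟨j, hy, h⟩
  · have hj : moebiusChart A i j ⊓ moebiusChart A i j' ≤ linearOpen (rowForm A.1 j) :=
      inf_le_left.trans (moebiusChart_le_linearOpen i j)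
    have hj' : moebiusChart A i j ⊓ moebiusChart A i j' ≤ linearOpen (rowForm A.1 j') :=
      inf_le_right.trans (moebiusChart_le_linearOpen i j')
    have hi : moebiusChart A i j ⊓ moebiusChart A i j' ≤ chart k i :=
      inf_le_left.trans (moebiusChart_le_chart i j)
    rw [restrictSection_moebiusSection d s i j inf_le_left hi hj,
      restrictSection_moebiusSection d s i j' inf_le_right hi hj',
      smul_transportSection_family hs hi hi hj hj', ratio_self, map_one, one_pow, one_smul]

lemma isTwistedFamily_of_moebiusSection {d : ℕ} {s : ∀ i, pullbackCotangent f (chart k i)}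
    (hs : IsTwistedFamily f d s) (t : ∀ i, pullbackCotangent ((moebius A).hom ≫ f) (chart k i))
    (ht : ∀ i j, restrictSection (moebiusChart_le_chart i j) (t i) = moebiusSection A d s i j) :
    IsTwistedFamily ((moebius A).hom ≫ f) d t := by
  intro i i' W hW hW'
  refine section_eq_of_local (fun j => W ⊓ linearOpen (rowForm A.1 j)) (fun j => inf_le_left)
    (fun y hy => ?_) _ _ fun j => ?_
  · obtain ⟨j, h⟩ := exists_mem_rowOpen A y
    exact ⟨j, hy, h⟩
  · have hj : W ⊓ linearOpen (rowForm A.1 j) ≤ linearOpen (rowForm A.1 j) := inf_le_right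
    have hi : W ⊓ linearOpen (rowForm A.1 j) ≤ chart k i := inf_le_left.trans hW
    have hi' : W ⊓ linearOpen (rowForm A.1 j) ≤ chart k i' := inf_le_left.trans hW'
    have h1 : restrictSection hi (t i) = _ :=
      (congrArg (restrictSection (le_inf hi hj : _ ≤ moebiusChart A i j)) (ht i j)).trans
        (restrictSection_moebiusSection d s i j _ hi hj)
    have h2 : restrictSection hi' (t i') = _ :=
      (congrArg (restrictSection (le_inf hi' hj : _ ≤ moebiusChart A i' j)) (ht i' j)).trans
        (restrictSection_moebiusSection d s i' j _ hi' hj)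
    rw [restrictSection_smul, map_pow, res_res, restrictSection_restrictSection,
      restrictSection_restrictSection, h1, h2]
    exact smul_transportSection_family hs hi hi' hj hj

lemma act_mem_imageCoeffs (A : GL (Fin 2) k) {m : ℕ} {v : Fin (m + 1) → k}
    (hv : v ∈ imageCoeffs f m) : act m A.1 v ∈ imageCoeffs ((moebius A).hom ≫ f) m := by
  obtain ⟨s, hs, hv⟩ := mem_imageCoeffs_iff.mp hv
  suffices h : A.1.det • act m A.1 v ∈ imageCoeffs ((moebius A).hom ≫ f) m by
    have h1 := Submodule.smul_mem _ (A.1.det)⁻¹ h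
    have hdet : A.1.det ≠ 0 := (A.isUnit.map Matrix.detMonoidHom).ne_zero
    rwa [inv_smul_smul₀ hdet] at h1
  choose t ht using exists_glue_moebiusSection (A := A) hs
  refine mem_imageCoeffs_iff.mpr ⟨t, isTwistedFamily_of_moebiusSection hs t ht, fun i => ?_⟩
  refine HasCodiff.of_local (moebiusChart A i) (moebiusChart_le_chart i) (fun y hy => ?_) _ _
    fun j => ?_
  · obtain ⟨j, h⟩ := exists_mem_rowOpen A y
    exact ⟨j, hy, h⟩
  · rw [ht i j, restrictForms_moebius_homogeneousForm (moebiusChart_le_chart i j)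
      (moebiusChart_le_linearOpen i j)]
    exact ((hv j).transport _).smul _

/-- Precomposition with an automorphism of `ℙ¹` acts on `V_d` by linear substitution. -/
lemma imageCoeffs_moebius (A : GL (Fin 2) k) (f : P1 k ⟶ X) (m : ℕ) :
    imageCoeffs ((moebius A).hom ≫ f) m = (imageCoeffs f m).map (act m A.1) := by
  apply le_antisymm
  · intro v hv
    have h1 := act_mem_imageCoeffs A⁻¹ hv
    have h2 : (moebius A⁻¹).hom ≫ (moebius A).hom ≫ f = f :=
      (moebius A).inv_hom_id_assoc f
    rw [h2] at h1
    have h3 := act_inv_act A⁻¹ v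
    rw [inv_inv] at h3
    exact ⟨_, h1, h3⟩
  · rintro _ ⟨v, hv, rfl⟩
    exact act_mem_imageCoeffs A hv

end MoebiusAction

/-! ### Lifting forms along unramified morphisms -/

section LocalLifts

variable {k : Type u} [Field k] {X Y : Over (Spec (.of k))} {f : Y ⟶ X} {V V' : Y.left.Opens}

lemma restrictForms_res_self {U : Y.left.Opens} (h : U ≤ U) (ω : Ω[Γ(Y.left, U)⁄k]) :
    restrictForms (res Y h) ω = ω := by
  induction ω using forms_induction with
  | zero => rw [map_zero]
  | add x y hx hy => rw [map_add, hx, hy]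
  | smul b c => rw [restrictForms_smul, restrictForms_D, res_self, res_self]

/-- Over an affine open that maps into an affine open, the codifferential of a section can be
computed there. -/
lemma HasCodiff.of_apply [IsSeparated X.hom] (p : AffinePair f V) (hp : p.U = V)
    (σ : pullbackCotangent f V) (ω : Ω[Γ(Y.left, V)⁄k])
    (h : PulledForms.codiff p.hom (σ.1 p) = restrictForms (res Y p.le) ω) : HasCodiff σ ω := by
  intro q
  have hqp : q.U ≤ p.U := q.le.trans hp.ge
  have h1 := congrArg (PulledForms.codiff (p.inf q hqp).hom)
    ((σ.2 p (p.inf q hqp) (p.inf_U_le_left q hqp) (p.inf_W_le_left q hqp)).trans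
    (σ.2 q (p.inf q hqp) (p.inf_U_le_right q hqp) (p.inf_W_le_right q hqp)).symm)
  rw [AffinePair.codiff_restrict, AffinePair.codiff_restrict, h, restrictForms_res_res] at h1
  exact (restrictForms_res_self le_rfl _).symm.trans h1.symm

/-- If the codifferential maps `σ` to `ω` on `D(g)`, then it does so on the whole affine open after
multiplication by a power of `g`. -/
lemma HasCodiff.exists_pow_smul [IsSeparated X.hom] (hV : IsAffineOpen V)
    (g : Γ(Y.left, V)) (σ : pullbackCotangent f V) (ω : Ω[Γ(Y.left, V)⁄k])
    (h : HasCodiff (restrictSection (Y.left.basicOpen_le g) σ)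
      (restrictForms (res Y (Y.left.basicOpen_le g)) ω)) :
    ∃ N : ℕ, HasCodiff (g ^ N • σ) (g ^ N • ω) := by
  obtain ⟨T, hT, c, hcov⟩ := exists_finite_affinePair_cover f hV
  have hloc : ∀ i, ∃ N : ℕ, res Y (c i).le g ^ N •
      (PulledForms.codiff (c i).hom (σ.1 (c i)) - restrictForms (res Y (c i).le) ω) = 0 := by
    intro i
    let g' := res Y (c i).le g
    have hg' : Y.left.basicOpen g' ≤ Y.left.basicOpen g :=
      (basicOpen_res (c i).le g).le.trans inf_le_right
    refine restrictForms_localization (res Y ((c i).basic_le g')) g'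
      (res_isLocalization (c i).affine_U g' _ rfl) _ ?_
    let q : AffinePair f (Y.left.basicOpen g) := (c i).shrink (Y.left.basicOpen g') (c i).W
      ((c i).affine_U.basicOpen g') (c i).affine_W hg' ((c i).basic g').le_preimage
    have h1 := h q
    rw [restrictForms_res_res] at h1
    rw [map_sub, sub_eq_zero, restrictForms_res_res,
      ← (c i).codiff_restrict ((c i).basic g') ((c i).basic_le g') ((c i).basic_W_le g'),
      σ.2 (c i) ((c i).basic g')]
    exact h1
  choose N₀ hN₀ using hloc
  -- the maximum of the exponents works on all pieces of the cover
  refine ⟨Finset.univ.sup N₀, HasCodiff.of_local (fun i => (c i).U) (fun i => (c i).le) hcov _ _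
    fun i => ?_⟩
  let p : AffinePair f (c i).U := (c i).shrink (c i).U (c i).W (c i).affine_U (c i).affine_W le_rfl
    (c i).le_preimage
  refine HasCodiff.of_apply p rfl _ _ ?_
  have h2 : res Y (c i).le g ^ (Finset.univ.sup N₀) •
      (PulledForms.codiff (c i).hom (σ.1 (c i)) - restrictForms (res Y (c i).le) ω) = 0 := by
    rw [← Nat.sub_add_cancel (Finset.le_sup (f := N₀) (Finset.mem_univ i)), pow_add, mul_smul,
      hN₀, smul_zero]
  rw [smul_sub, sub_eq_zero] at h2
  rw [restrictForms_res_res, restrictForms_smul, map_pow]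
  refine Eq.trans ?_ h2
  refine Eq.trans ?_ (map_smul (PulledForms.codiff (c i).hom) _ _)
  refine congrArg (PulledForms.codiff (c i).hom) ?_
  refine congrArg (fun b : Γ(Y.left, (c i).U) => b • σ.1 (c i)) ?_
  exact map_pow _ _ _

lemma AffinePair.codiff_surjective [FormallyUnramified f.left] (p : AffinePair f V) :
    Function.Surjective (PulledForms.codiff p.hom) :=
  PulledForms.codiff_surjective _
    (f.left.formallyUnramified_appLE p.affine_W p.affine_U p.le_preimage)

/-- For an unramified morphism, every form on an affine open of the source lifts to a section of
`f^* Ω_{X/k}`. -/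
lemma exists_hasCodiff [IsSeparated X.hom] [IsSeparated Y.hom] [FormallyUnramified f.left]
    (hV : IsAffineOpen V) (ω : Ω[Γ(Y.left, V)⁄k]) :
    ∃ σ : pullbackCotangent f V, HasCodiff σ ω := by
  -- the functions `b` for which `b ω` lifts form an ideal, which contains a power of each `g`
  -- such that `D(g)` maps into an affine open
  let I : Ideal Γ(Y.left, V) :=
    { carrier := {b | ∃ σ : pullbackCotangent f V, HasCodiff σ (b • ω)}
      add_mem' := by
        rintro a b ⟨σ, hσ⟩ ⟨τ, hτ⟩
        exact ⟨σ + τ, by rw [add_smul]; exact hσ.add hτ⟩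
      zero_mem' := ⟨0, fun p => by
        rw [zero_smul, map_zero]
        exact map_zero _⟩
      smul_mem' := by
        rintro a b ⟨σ, hσ⟩
        exact ⟨a • σ, by rw [smul_eq_mul, mul_smul]; exact hσ.smul a⟩ }
  have hI : I.radical = ⊤ := by
    rw [eq_top_iff, ← span_basicOpen_eq_top hV (fun U => ∃ p : AffinePair f V, U ≤ p.U)
      (fun U' V' h1 ⟨p, hp⟩ => ⟨p, h1.trans hp⟩)
      (fun y hy => by
        obtain ⟨p, hp⟩ := exists_affinePair f V y hy
        exact ⟨p.U, hp, p, le_rfl⟩), Ideal.span_le]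
    rintro g ⟨p, hp⟩
    let q : AffinePair f (Y.left.basicOpen g) := p.shrink (Y.left.basicOpen g) p.W
      (hV.basicOpen g) p.affine_W le_rfl (hp.trans p.le_preimage)
    obtain ⟨x, hx⟩ := q.codiff_surjective
      (restrictForms (res Y q.le) (restrictForms (res Y (Y.left.basicOpen_le g)) ω))
    obtain ⟨σ, rfl⟩ := exists_section_apply_eq q rfl x
    have h1 := HasCodiff.of_apply q rfl σ _ hx
    obtain ⟨n, τ, hτ⟩ := exists_pow_smul_extends hV g σ
    obtain ⟨N, hN⟩ := HasCodiff.exists_pow_smul hV g τ (g ^ n • ω) (by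
      rw [hτ, restrictForms_smul, map_pow]
      exact h1.smul _)
    refine ⟨N + n, g ^ N • τ, ?_⟩
    rwa [pow_add, mul_smul]
  rw [Ideal.radical_eq_top] at hI
  obtain ⟨σ, hσ⟩ : (1 : Γ(Y.left, V)) ∈ I := hI ▸ trivial
  exact ⟨σ, by rwa [one_smul] at hσ⟩

end LocalLifts

/-! ### Stability under multiplication and large degrees -/

section LargeDegree

variable {k : Type u} [Field k] {X : Over (Spec (.of k))} {f : P1 k ⟶ X}

lemma homogeneousForm_of_form_eq_mul {B : Type u} [CommRing B] [Algebra k B] {m m' : ℕ}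
    (w : Fin 2 → B) {v : Fin (m + 1) → k} {v' : Fin (m' + 1) → k} {G : MvPolynomial (Fin 2) k}
    (h : form m' v' = G * form m v) :
    homogeneousForm w v' = MvPolynomial.aeval w G • homogeneousForm w v := by
  rw [homogeneousForm_apply, homogeneousForm_apply, h, map_mul, mul_smul]

/-- The spaces `V_d` are stable under multiplication by the coordinates. -/
lemma mem_imageCoeffs_of_form_eq_X_mul {m : ℕ} {v : Fin (m + 1) → k} {v' : Fin (m + 1 + 1) → k}
    (l : Fin 2) (h : form (m + 1) v' = MvPolynomial.X l * form m v) (hv : v ∈ imageCoeffs f m) :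
    v' ∈ imageCoeffs f (m + 1) := by
  obtain ⟨s, hs, hv⟩ := mem_imageCoeffs_iff.mp hv
  refine mem_imageCoeffs_iff.mpr ⟨fun i => ratio k i l • s i, fun i j U hi hj => ?_, fun i => ?_⟩
  · rw [restrictSection_smul, restrictSection_smul, hs i j U hi hj, res_ratio_mul hi hj l,
      smul_smul, smul_smul]
    congr 1
    ring
  · rw [homogeneousForm_of_form_eq_mul _ h, MvPolynomial.aeval_X]
    exact (hv i).smul _

/-- For an unramified `f`, a power of each coordinate of `ℙ¹` lies in the image of the
codifferential. -/
lemma exists_X_pow_mem_imageCoeffs [IsSeparated X.hom] [FormallyUnramified f.left] (i : Fin 2) :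
    ∃ (m : ℕ) (v : Fin (m + 1) → k), form m v = MvPolynomial.X i ^ m ∧ v ∈ imageCoeffs f m := by
  obtain ⟨j, hij⟩ : ∃ j : Fin 2, i ≠ j := ⟨1 - i, by omega⟩
  have hex : ∀ m : ℕ, ∃ v : Fin (m + 1) → k, form m v = MvPolynomial.X i ^ m := fun m =>
    exists_form_eq (MvPolynomial.isHomogeneous_X_pow i m)
  choose v hv using hex
  have hmul : ∀ {B : Type u} [CommRing B] [Algebra k B] (w : Fin 2 → B) (a b : ℕ),
      homogeneousForm w (v (a + b)) = w i ^ a • homogeneousForm w (v b) := by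
    intro B _ _ w a b
    rw [homogeneousForm_of_form_eq_mul w (v := v b) (G := MvPolynomial.X i ^ a)
      (by rw [hv, hv, pow_add]), map_pow, MvPolynomial.aeval_X]
  obtain ⟨σ, hσ⟩ := exists_hasCodiff (f := f) (isAffineOpen_linearOpen (linearX k i))
    (homogeneousForm (ratio k i) (v 0))
  -- extend the section over `D₊(x_i)` to a twisted section over `D₊(x_j)`; the factor
  -- `(x_i / x_j) ^ 2` comes from the shift between `d` and the degree `d - 2` of the forms
  have hU : (P1 k).left.basicOpen (ratio k j i) ≤ chart k i :=
    (basicOpen_ratio j i).le.trans inf_le_right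
  have hU' := (P1 k).left.basicOpen_le (ratio k j i)
  obtain ⟨n, τ, hτ⟩ := exists_pow_smul_extends (isAffineOpen_linearOpen (linearX k j))
    (ratio k j i) (restrictSection hU σ)
  obtain ⟨N, hN⟩ := HasCodiff.exists_pow_smul (isAffineOpen_linearOpen (linearX k j))
    (ratio k j i) (ratio k j i ^ 2 • τ) (homogeneousForm (ratio k j) (v n)) (by
      rw [restrictSection_smul, hτ, restrictForms_homogeneousForm_ratio hU' hU, smul_smul, map_pow,
        ← pow_add, add_comm 2 n]
      have h1 := hmul (ratio k i) n 0
      rw [ratio_self, one_pow, one_smul, add_zero] at h1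
      rw [h1]
      exact (hσ.restrict hU).smul _)
  let s : ∀ l, pullbackCotangent f (chart k l) :=
    Function.update (Function.update (fun _ => 0) i σ) j (ratio k j i ^ N • ratio k j i ^ 2 • τ)
  have hsi : s i = σ := by simp [s, hij]
  have hsj : s j = ratio k j i ^ N • ratio k j i ^ 2 • τ := by simp [s]
  refine ⟨N + n, v (N + n), hv _, mem_imageCoeffs_iff.mpr ⟨s, ?_, fun l => ?_⟩⟩
  · refine isTwistedFamily_of_overlap hij.symm (basicOpen_ratio j i).ge hU' hU ?_
    rw [hsi, hsj, restrictSection_smul, restrictSection_smul, hτ, smul_smul, smul_smul, map_pow,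
      map_pow]
    congr 1
    ring
  · obtain rfl | rfl : l = i ∨ l = j := by omega
    · have h1 := hmul (ratio k l) (N + n) 0
      rw [ratio_self, one_pow, one_smul, add_zero] at h1
      rw [hsi, h1]
      exact hσ
    · rw [hsj, hmul (ratio k l) N n]
      exact hN

/-- `V_{m + 2}` is everything as soon as it contains all monomials. -/
lemma imageCoeffs_eq_top {m : ℕ}
    (h : ∀ a b : ℕ, a + b = m → ∃ v ∈ imageCoeffs f m,
      form m v = MvPolynomial.X 0 ^ a * MvPolynomial.X 1 ^ b) : imageCoeffs f m = ⊤ := by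
  refine eq_top_iff.mpr fun v _ => ?_
  choose w hw hform using fun i : Fin (m + 1) =>
    h (m - i) i (Nat.sub_add_cancel (Nat.lt_succ_iff.mp i.2))
  have h1 : v = ∑ i, v i • w i := by
    refine form_injective m ?_
    rw [map_sum, form_apply]
    refine Finset.sum_congr rfl fun i _ => ?_
    rw [map_smul, hform, MvPolynomial.smul_eq_C_mul]
  rw [h1]
  exact sum_mem fun i _ => Submodule.smul_mem _ _ (hw i)

lemma exists_mem_of_X_mul {m : ℕ} (l : Fin 2) {G : MvPolynomial (Fin 2) k}
    (h : ∃ v ∈ imageCoeffs f m, form m v = G) :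
    ∃ v ∈ imageCoeffs f (m + 1), form (m + 1) v = MvPolynomial.X l * G := by
  obtain ⟨v, hv, rfl⟩ := h
  obtain ⟨v', hv'⟩ : ∃ v', form (m + 1) v' = MvPolynomial.X l * form m v := by
    refine exists_form_eq ?_
    rw [mul_comm]
    exact MvPolynomial.IsHomogeneous.mul (form_mem v) (MvPolynomial.isHomogeneous_X k l)
  exact ⟨v', mem_imageCoeffs_of_form_eq_X_mul l hv' hv, hv'⟩

lemma exists_mem_of_X_pow_mul {m m' n : ℕ} (hm : m + n = m') (l : Fin 2)
    {G : MvPolynomial (Fin 2) k} (h : ∃ v ∈ imageCoeffs f m, form m v = G) :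
    ∃ v ∈ imageCoeffs f m', form m' v = MvPolynomial.X l ^ n * G := by
  subst hm
  induction n with
  | zero => simpa using h
  | succ n ih =>
    rw [pow_succ', mul_assoc]
    exact exists_mem_of_X_mul l ih

/-- Every monomial of degree `m + 1` is a coordinate times a monomial of degree `m`. -/
lemma imageCoeffs_succ_eq_top {m : ℕ} (h : imageCoeffs f m = ⊤) : imageCoeffs f (m + 1) = ⊤ := by
  have hex : ∀ G ∈ grading k m, ∃ v ∈ imageCoeffs f m, form m v = G := fun G hG => by
    obtain ⟨v, rfl⟩ := exists_form_eq hG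
    exact ⟨v, h ▸ Submodule.mem_top, rfl⟩
  refine imageCoeffs_eq_top fun a b hab => ?_
  have hmem : ∀ a b : ℕ, a + b = m →
      (MvPolynomial.X 0 ^ a * MvPolynomial.X 1 ^ b : MvPolynomial (Fin 2) k) ∈ grading k m := by
    rintro a b rfl
    exact (MvPolynomial.isHomogeneous_X_pow 0 a).mul (MvPolynomial.isHomogeneous_X_pow 1 b)
  rcases a with _ | a
  · obtain rfl : b = m + 1 := by omega
    obtain ⟨v, hv, hv'⟩ := exists_mem_of_X_mul 1 (hex _ (hmem 0 m (by omega)))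
    exact ⟨v, hv, by rw [hv']; ring⟩
  · obtain ⟨v, hv, hv'⟩ := exists_mem_of_X_mul 0 (hex _ (hmem a b (by omega)))
    exact ⟨v, hv, by rw [hv']; ring⟩

/-- For an unramified `f`, the space `V_d` is everything for some `d`, so that `d₀` is the minimum
of a nonempty set. -/
lemma exists_imageCoeffs_eq_top (f : P1 k ⟶ X) [IsSeparated X.hom] [FormallyUnramified f.left] :
    ∃ m, imageCoeffs f m = ⊤ := by
  obtain ⟨M, v, hv, hvm⟩ := exists_X_pow_mem_imageCoeffs (f := f) 0
  obtain ⟨N, w, hw, hwm⟩ := exists_X_pow_mem_imageCoeffs (f := f) 1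
  -- a monomial of degree `M + N` is divisible by `x₀ ^ M` or by `x₁ ^ N`
  refine ⟨M + N, imageCoeffs_eq_top fun a b hab => ?_⟩
  rcases le_total M a with h | h
  · obtain ⟨x, hx, hx'⟩ := exists_mem_of_X_pow_mul (show a + b = M + N from hab) 1
      (exists_mem_of_X_pow_mul (Nat.add_sub_cancel' h) 0 ⟨v, hvm, hv⟩)
    exact ⟨x, hx, by rw [hx', ← pow_add, Nat.sub_add_cancel h, mul_comm]⟩
  · have h' : N ≤ b := by omega
    obtain ⟨x, hx, hx'⟩ := exists_mem_of_X_pow_mul (show b + a = M + N by omega) 0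
      (exists_mem_of_X_pow_mul (Nat.add_sub_cancel' h') 1 ⟨w, hwm, hw⟩)
    exact ⟨x, hx, by rw [hx', ← pow_add, Nat.sub_add_cancel h']⟩

lemma imageForms_eq_top_iff {m : ℕ} : imageForms f (m + 2) = ⊤ ↔ imageCoeffs f m = ⊤ := by
  constructor
  · intro h
    rw [imageCoeffs, h, Submodule.comap_top]
  · intro h
    refine eq_top_iff.mpr fun ω _ => ?_
    obtain ⟨v, rfl⟩ := (ofForm_bijective m).2 ω
    have : v ∈ imageCoeffs f m := h ▸ Submodule.mem_top
    exact this

lemma imageForms_eq_top_of_le {d d' : ℕ} (hd : 2 ≤ d) (h : imageForms f (d : ℤ) = ⊤)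
    (hdd' : d ≤ d') : imageForms f (d' : ℤ) = ⊤ := by
  obtain ⟨m, rfl⟩ := Nat.exists_eq_add_of_le' hd
  obtain ⟨n, rfl⟩ := Nat.exists_eq_add_of_le hdd'
  have h1 : imageCoeffs f m = ⊤ := imageForms_eq_top_iff.mp (by exact_mod_cast h)
  have h2 : imageCoeffs f (m + n) = ⊤ := by
    clear h hdd' hd
    induction n with
    | zero => exact h1
    | succ n ih => exact imageCoeffs_succ_eq_top ih
  have h3 := imageForms_eq_top_iff.mpr h2
  have h4 : ((m + 2 + n : ℕ) : ℤ) = ((m + n : ℕ) : ℤ) + 2 := by push_cast; ring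
  rw [h4]
  exact h3

/-- Transversality of two spaces `V_d` can be checked on binary forms. -/
lemma transverse_imageForms {X' : Over (Spec (.of k))} {g : P1 k ⟶ X'} {m : ℕ}
    (h : Transverse (imageCoeffs f m) (imageCoeffs g m)) :
    Transverse (imageForms f (m + 2)) (imageForms g (m + 2)) := by
  have hmap : ∀ V : Submodule k (twistedForms (k := k) (m + 2)),
      (V.comap (ofForm m)).map (ofForm m) = V := fun V =>
    Submodule.map_comap_eq_of_surjective (ofForm_bijective m).2 V
  rcases h with h | h
  · left
    rw [← hmap (_ ⊓ _), Submodule.comap_inf]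
    exact (congrArg (Submodule.map (ofForm m)) h).trans (Submodule.map_bot _)
  · right
    rw [← hmap (imageForms f (m + 2)), ← hmap (imageForms g (m + 2)), ← Submodule.map_sup]
    refine (congrArg (Submodule.map (ofForm m)) h).trans ?_
    rw [Submodule.map_top, LinearMap.range_eq_top]
    exact (ofForm_bijective m).2

end LargeDegree

end RationalCurves

end

open RationalCurves

/-! ### Transversality for a general automorphism -/

theorem proposition4p1 {k : Type u} [Field k] [IsAlgClosed k] (p : ℕ) [CharP k p]
    (X₁ X₂ : Over (Spec (.of k)))
    [IsIntegral X₁.left] [IsSeparated X₁.hom] [LocallyOfFiniteType X₁.hom] [QuasiCompact X₁.hom]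
    [IsIntegral X₂.left] [IsSeparated X₂.hom] [LocallyOfFiniteType X₂.hom] [QuasiCompact X₂.hom]
    (f₁ : P1 k ⟶ X₁) (f₂ : P1 k ⟶ X₂)
    [FormallyUnramified f₁.left] [FormallyUnramified f₂.left]
    (hp : p = 0 ∨ leastSurjective f₁ f₂ ≤ p + 1) :
    ForGeneralAut fun α : P1 k ≅ P1 k =>
      ∀ f : P1 k ⟶ X₁ ⊗ X₂, f = lift f₁ (α.hom ≫ f₂) →
        ∀ d : ℤ, Transverse (imageForms (f ≫ fst X₁ X₂) d) (imageForms (f ≫ snd X₁ X₂) d) := by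
  -- in a degree `m = d - 2` with `d < d₀`, the integers `1, …, m` are smaller than `p`
  have hF : ∀ m : ℕ, ∃ F : MvPolynomial (Fin 2 × Fin 2) k, F ≠ 0 ∧
      (m + 2 < leastSurjective f₁ f₂ → ∀ A : GL (Fin 2) k,
        MvPolynomial.eval (fun ij => A.1 ij.1 ij.2) F ≠ 0 →
          Transverse (imageCoeffs f₁ m) ((imageCoeffs f₂ m).map (act m A.1))) := by
    intro m
    by_cases hm : m + 2 < leastSurjective f₁ f₂
    · obtain ⟨F, hF, h⟩ := exists_polynomial_transverse (k := k) (m := m) (fun i hi him h0 => by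
        rw [CharP.cast_eq_zero_iff k p] at h0
        have := Nat.eq_zero_of_dvd_of_lt h0
        rcases hp with rfl | hp
        · exact hi.ne' (Nat.eq_zero_of_zero_dvd h0)
        · exact hi.ne' (this (by omega))) (imageCoeffs f₁ m) (imageCoeffs f₂ m)
      exact ⟨F, hF, fun _ => h⟩
    · exact ⟨1, one_ne_zero, fun h => absurd h hm⟩
  choose F hF0 hF using hF
  refine ⟨∏ m ∈ Finset.range (leastSurjective f₁ f₂), F m,
    Finset.prod_ne_zero_iff.mpr fun m _ => hF0 m, fun A hA f hf d => ?_⟩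
  rw [map_prod, Finset.prod_ne_zero_iff] at hA
  rw [hf, lift_fst, lift_snd]
  rcases lt_or_ge d 2 with hd | hd
  · exact Or.inl (eq_bot_iff.mpr fun ω _ => twistedForms_eq_zero hd ω)
  obtain ⟨m, rfl⟩ : ∃ m : ℕ, d = m + 2 := ⟨(d - 2).toNat, by omega⟩
  refine transverse_imageForms ?_
  rw [imageCoeffs_moebius]
  rcases lt_or_ge (m + 2) (leastSurjective f₁ f₂) with hm | hm
  · exact hF m hm A (hA m (Finset.mem_range.mpr (by omega)))
  · have hne : {d : ℕ | 2 ≤ d ∧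
        (imageForms f₁ (d : ℤ) = ⊤ ∨ imageForms f₂ (d : ℤ) = ⊤)}.Nonempty := by
      obtain ⟨n, hn⟩ := exists_imageCoeffs_eq_top f₁
      exact ⟨n + 2, by omega, Or.inl (imageForms_eq_top_iff.mpr hn)⟩
    obtain ⟨h2, h⟩ : 2 ≤ leastSurjective f₁ f₂ ∧
        (imageForms f₁ (leastSurjective f₁ f₂ : ℤ) = ⊤ ∨
          imageForms f₂ (leastSurjective f₁ f₂ : ℤ) = ⊤) := Nat.sInf_mem hne
    right
    rcases h with h | h
    · rw [imageForms_eq_top_iff.mp (imageForms_eq_top_of_le h2 h hm), top_sup_eq]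
    · rw [imageForms_eq_top_iff.mp (imageForms_eq_top_of_le h2 h hm), Submodule.map_top,
        LinearMap.range_eq_top.mpr, sup_top_eq]
      intro v
      have h3 := act_inv_act A⁻¹ v
      rw [inv_inv] at h3
      exact ⟨_, h3⟩
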